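/- **Setting.** Let $\Theta$ be the category whose objects are the strict $\omega$-categories that are free on a globular sum, with all strict $\omega$-functors as morphisms; a globular sum is an $\omega$-graph (globular set) obtained as the colimit of a zigzag of globes $D_{n_1}\leftarrow D_{m_1}\to D_{n_2}\leftarrow\cdots\to D_{n_p}$ with $p\ge 1$, $m_i<n_i,n_{i+1}$, where $D_{m_i}$ is included as the target in $D_{n_i}$ and as the source in $D_{n_{i+1}}$. A morphism of $\Theta$ is *inert* if it is free on a morphism of $\omega$-graphs between the generating globular sums. Let $\Xi\colon\Theta\to\Theta$ be the suspension ($\Xi C$ has two objects and hom $\omega$-category $C$ from the first to the second), so $\Xi D_n=D_{n+1}$, and let $$\Theta_{\mathbb Z}=\operatorname{colim}\bigl(\Theta\xrightarrow{\Xi}\Theta\xrightarrow{\Xi}\Theta\xrightarrow{\Xi}\cdots\bigr),$$ with $\Xi^{\infty-k}\colon\Theta\to\Theta_{\mathbb Z}$ the inclusion of the $k$-th copy. A morphism of $\Theta_{\mathbb Z}$ is inert if it is represented by an inert morphism at some finite stage. For $\ell\in\mathbb Z$ the stable globe $\overline{\ell}$ is $\Xi^{\infty-0}D_\ell$ if $\ell\ge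 0$ and $\Xi^{\infty-(-\ell)}D_0$ if $\ell<0$; the stable globes are the elementary objects, and for $m<n$ there are source and target inclusions $\overline m\rightrightarrows\overline n$. For $T\in\Theta_{\mathbb Z}$ let $(\Theta_{\mathbb Z}^{op})^{el}_{T/}$ be the category whose objects are the inert morphisms $T\to E$ of $\Theta_{\mathbb Z}^{op}$ with $E$ elementary, and whose morphisms are the inert morphisms under $T$. A *stable globular presentation* of $T\in\Theta_{\mathbb Z}$ by integers $n_1,\dots,n_p,m_1,\dots,m_{p-1}$ ($p\ge1$, $m_i<n_i,n_{i+1}$) is a cocone that exhibits $$T\simeq\overline{n_1}\amalg_{\overline{m_1}}\overline{n_2}\amalg_{\overline{m_2}}\cdots\amalg_{\overline{m_{p-1}}}\overline{n_p}$$ as the colimit in $\Theta_{\mathbb Z}$ of the zigzag of stable globes in which $\overline{m_i}$ is included as the target in $\overline{n_i}$ and as the source in $\overline{n_{i+1}}$. A *Segal $\Theta_{\mathbb Z}^{op}$-set* is a functor $X\colon\Theta_{\mathbb Z}^{op}\to\mathrm{Set}$ such that for every $T$ the canonical map $X(T)\to\lim_{E\in(\Theta_{\mathbb Z}^{op})^{el}_{T/}}X(E)$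 is bijective. A *strict $\mathbb Z$-category* (Lessard) is a functor $X\colon\Theta_{\mathbb Z}^{op}\to\mathrm{Set}$ that takes stable globular presentations to limits, that is, such that for every stable globular presentation as above the canonical map $$X(T)\to X(\overline{n_1})\times_{X(\overline{m_1})}\cdots\times_{X(\overline{m_{p-1}})}X(\overline{n_p})$$ is bijective. **Theorem.** (1) Let $T\in\Theta_{\mathbb Z}$ have a stable globular presentation by the integers $n_1,\dots,n_p,m_1,\dots,m_{p-1}$. Then the morphisms of the presentation from the stable globes $\overline{n_i},\overline{m_i}$ to $T$ are inert, and the resulting diagram $$\overline{n_1}\to\overline{m_1}\leftarrow\overline{n_2}\to\cdots\leftarrow\overline{n_p}$$ in $(\Theta_{\mathbb Z}^{op})^{el}_{T/}$ is initial, both as a functor of categories (its slices over the objects of $(\Theta_{\mathbb Z}^{op})^{el}_{T/}$ are non-empty and connected) and as a functor of $(\infty,1)$-categories (the classifying spaces of these slices are contractible). (2) A functor $X\colon\Theta_{\mathbb Z}^{op}\to\mathrm{Set}$ is a Segal $\Theta_{\mathbb Z}^{op}$-set if and only if it is a strict $\mathbb Z$-category. -/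

import Mathlib

open CategoryTheory CategoryTheory.Limits Opposite

universe u v w

/-! ## Strict ω-categories and ω-graphs -/

/-- A strict ω-category, in the one-sorted presentation: `bd false n` and `bd true n` are the
`n`-dimensional source and target, `comp n x y h` is the composite "first `x`, then `y`" along an
`n`-dimensional boundary, the `n`-cells are the elements fixed by the boundary operators of
dimension `n`, and every element is a cell of some finite dimension. -/
structure StrictOmegaCat : Type (u + 1) where
  carrier : Type u
  bd : Bool → ℕ → carrier → carrier
  comp : ∀ (n : ℕ) (x y : carrier), bd true n x = bd false n y → carrier
  bd_bd_of_lt : ∀ (ε δ : Bool) {m n : ℕ}, m < n → ∀ x, bd ε m (bd δ n x) = bd ε m x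
  bd_bd_of_le : ∀ (ε δ : Bool) {m n : ℕ}, m ≤ n → ∀ x, bd ε n (bd δ m x) = bd δ m x
  finite_dim : ∀ x, ∃ n, bd false n x = x
  src_comp : ∀ (n : ℕ) (x y) (h), bd false n (comp n x y h) = bd false n x
  tgt_comp : ∀ (n : ℕ) (x y) (h), bd true n (comp n x y h) = bd true n y
  bd_comp : ∀ (ε : Bool) {m n : ℕ}, m < n → ∀ (x y) (h) (h'),
    bd ε n (comp m x y h) = comp m (bd ε n x) (bd ε n y) h'
  id_comp : ∀ (n : ℕ) (x) (h), comp n (bd false n x) x h = x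
  comp_id : ∀ (n : ℕ) (x) (h), comp n x (bd true n x) h = x
  assoc : ∀ (n : ℕ) (x y z) (hxy) (hyz) (h) (h'),
    comp n (comp n x y hxy) z h = comp n x (comp n y z hyz) h'
  interchange : ∀ {m n : ℕ}, m < n → ∀ (x y z w) (hxy) (hzw) (hxz) (hyw) (h) (h'),
    comp m (comp n x y hxy) (comp n z w hzw) h = comp n (comp m x z hxz) (comp m y w hyw) h'

namespace StrictOmegaCat

/-- A strict ω-functor. -/
@[ext]
structure Hom (C D : StrictOmegaCat.{u}) : Type u where
  toFun : C.carrier → D.carrier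
  map_bd : ∀ (ε : Bool) (n : ℕ) (x), toFun (C.bd ε n x) = D.bd ε n (toFun x)
  map_comp : ∀ (n : ℕ) (x y) (h) (h'),
    toFun (C.comp n x y h) = D.comp n (toFun x) (toFun y) h'

instance : Category.{u} StrictOmegaCat.{u} where
  Hom := Hom
  id C := ⟨fun x => x, fun _ _ _ => rfl, fun _ _ _ _ _ => rfl⟩
  comp {C D E} F G :=
    ⟨fun x => G.toFun (F.toFun x), fun ε n x => by rw [F.map_bd, G.map_bd], fun n x y h h' => by
      have h'' : D.bd true n (F.toFun x) = D.bd false n (F.toFun y) := by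
        rw [← F.map_bd, ← F.map_bd, h]
      rw [F.map_comp n x y h h'', G.map_comp n _ _ h'' h']⟩

/-- The function on cells underlying a strict ω-functor. -/
def fn {C D : StrictOmegaCat.{u}} (F : C ⟶ D) : C.carrier → D.carrier := Hom.toFun F

theorem hom_ext {C D : StrictOmegaCat.{u}} {F G : C ⟶ D} (h : ∀ x, fn F x = fn G x) : F = G :=
  Hom.ext (funext h)

@[simp] theorem fn_id (C : StrictOmegaCat.{u}) (x : C.carrier) : fn (𝟙 C) x = x := rfl

@[simp] theorem fn_comp {C D E : StrictOmegaCat.{u}} (F : C ⟶ D) (G : D ⟶ E) (x : C.carrier) :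
    fn (F ≫ G) x = fn G (fn F x) := rfl

end StrictOmegaCat

/-- An ω-graph (globular set), that is a presheaf on the globe category: `face false` and
`face true` are the iterated source and target maps. -/
structure OmegaGraph : Type 1 where
  cells : ℕ → Type
  face : Bool → ∀ {m n : ℕ}, m < n → cells n → cells m
  face_face : ∀ (ε δ : Bool) {k m n : ℕ} (h : k < m) (h' : m < n) (x : cells n),
    face ε h (face δ h' x) = face ε (h.trans h') x

/-- A morphism of ω-graphs. -/
@[ext]
structure OmegaGraph.Hom (X Y : OmegaGraph) : Type where
  app : ∀ n, X.cells n → Y.cells n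
  app_face : ∀ (ε : Bool) {m n : ℕ} (h : m < n) (x : X.cells n),
    app m (X.face ε h x) = Y.face ε h (app n x)

/-- The ω-graph underlying a strict ω-category. -/
def StrictOmegaCat.graph (C : StrictOmegaCat.{0}) : OmegaGraph where
  cells n := { x : C.carrier // C.bd false n x = x }
  face ε m _ _ x := ⟨C.bd ε m x.1, C.bd_bd_of_le _ _ le_rfl _⟩
  face_face ε δ _ _ _ h _ x := Subtype.ext (C.bd_bd_of_lt ε δ h x.1)

/-- The morphism `η` exhibits `C` as the free strict ω-category on the ω-graph `X`. -/
def IsFreeOn (C : StrictOmegaCat.{0}) (X : OmegaGraph) (η : X.Hom C.graph) : Prop :=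
  ∀ (D : StrictOmegaCat.{0}) (φ : X.Hom D.graph),
    ∃! F : C ⟶ D, ∀ n (x : X.cells n), StrictOmegaCat.fn F (η.app n x).1 = (φ.app n x).1

/-! ## Globular sums -/

/-- A table of dimensions `n₀, m₀, n₁, m₁, …, n_p` with `m_i < n_i, n_{i+1}`. -/
structure GlobTable (I : Type) [LT I] : Type where
  len : ℕ
  n : Fin (len + 1) → I
  m : Fin len → I
  lt_left : ∀ i, m i < n i.castSucc
  lt_right : ∀ i, m i < n i.succ

/-- The cells `x_i ∈ X_{n_i}` exhibit the ω-graph `X` as the globular sum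
`D_{n_0} ⨿_{D_{m_0}} D_{n_1} ⨿ ⋯ ⨿ D_{n_p}`, that is, as the colimit in ω-graphs of the zigzag of
globes in which `D_{m_i}` is included as the target in `D_{n_i}` and as the source in
`D_{n_{i+1}}`; morphisms from the globe `D_n` to `Y` are identified with `n`-cells of `Y`. -/
structure IsGlobularSum (t : GlobTable ℕ) (X : OmegaGraph) (x : ∀ i, X.cells (t.n i)) :
    Prop where
  glue : ∀ i, X.face true (t.lt_left i) (x i.castSucc) = X.face false (t.lt_right i) (x i.succ)
  desc : ∀ (Y : OmegaGraph) (y : ∀ i, Y.cells (t.n i)),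
    (∀ i, Y.face true (t.lt_left i) (y i.castSucc) = Y.face false (t.lt_right i) (y i.succ)) →
      ∃! φ : X.Hom Y, ∀ i, φ.app _ (x i) = y i

/-! ## Suspension -/

/-- The cells of a suspension: two objects `pt false`, `pt true` (the first and the second one)
and the cells of the hom ω-category from the first to the second. -/
inductive Susp (α : Type u) : Type u
  | pt : Bool → Susp α
  | cell : α → Susp α

namespace StrictOmegaCat

/-- Sources and targets in a suspension. -/
def suspBd (C : StrictOmegaCat.{u}) (ε : Bool) : ℕ → Susp C.carrier → Susp C.carrier
  | _, .pt δ => .pt δ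
  | 0, .cell _ => .pt ε
  | n + 1, .cell a => .cell (C.bd ε n a)

/-- Composition in a suspension. -/
def suspComp (C : StrictOmegaCat.{u}) : ∀ (n : ℕ) (x y : Susp C.carrier),
    C.suspBd true n x = C.suspBd false n y → Susp C.carrier
  | 0, .pt _, y, _ => y
  | 0, .cell a, _, _ => .cell a
  | _ + 1, .pt ε, _, _ => .pt ε
  | n + 1, .cell a, .cell b, h => .cell (C.comp n a b (Susp.cell.inj h))
  | _ + 1, .cell a, .pt _, _ => .cell a

/-- The suspension `Ξ C`: two objects, and hom ω-category `C` from the first to the second. -/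
def susp (C : StrictOmegaCat.{u}) : StrictOmegaCat.{u} where
  carrier := Susp C.carrier
  bd := C.suspBd
  comp := C.suspComp
  bd_bd_of_lt ε δ m n h x := by
    rcases x with b | a
    · cases m <;> cases n <;> rfl
    · obtain _ | n := n
      · omega
      · obtain _ | m := m
        · rfl
        · exact congrArg Susp.cell (C.bd_bd_of_lt ε δ (by omega) a)
  bd_bd_of_le ε δ m n h x := by
    rcases x with b | a
    · cases m <;> cases n <;> rfl
    · obtain _ | m := m
      · cases n <;> rfl
      · obtain _ | n := n
        · omega
        · exact congrArg Susp.cell (C.bd_bd_of_le ε δ (by omega) a)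
  finite_dim x := by
    rcases x with b | a
    · exact ⟨0, rfl⟩
    · obtain ⟨n, hn⟩ := C.finite_dim a
      exact ⟨n + 1, congrArg Susp.cell hn⟩
  src_comp n x y h := by
    rcases n with _ | n <;> rcases x with b | a <;> rcases y with b' | a' <;>
      first
        | exact congrArg Susp.cell (C.src_comp _ _ _ _)
        | (cases h; rfl)
        | cases h
  tgt_comp n x y h := by
    rcases n with _ | n <;> rcases x with b | a <;> rcases y with b' | a' <;>
      first
        | exact congrArg Susp.cell (C.tgt_comp _ _ _ _)
        | (cases h; rfl)
        | cases h
  bd_comp ε m n hmn x y h h' := by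
    obtain _ | n := n
    · omega
    rcases m with _ | m <;> rcases x with b | a <;> rcases y with b' | a' <;>
      first
        | exact congrArg Susp.cell (C.bd_comp ε (Nat.lt_of_succ_lt_succ hmn) _ _ _ _)
        | rfl
  id_comp n x h := by
    rcases n with _ | n <;> rcases x with b | a <;>
      first
        | exact congrArg Susp.cell (C.id_comp _ _ _)
        | rfl
  comp_id n x h := by
    rcases n with _ | n <;> rcases x with b | a <;>
      first
        | exact congrArg Susp.cell (C.comp_id _ _ _)
        | rfl
  assoc n x y z hxy hyz h h' := by
    rcases n with _ | n <;> rcases x with b | a <;> rcases y with b' | a' <;>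
      rcases z with b'' | a'' <;>
      first
        | exact congrArg Susp.cell (C.assoc _ _ _ _ _ _ _ _)
        | rfl
        | cases hxy
  interchange {m n} hmn x y z w hxy hzw hxz hyw h h' := by
    obtain _ | n := n
    · omega
    rcases m with _ | m <;> rcases x with b | a <;> rcases y with b' | a' <;>
      rcases z with b'' | a'' <;> rcases w with b''' | a''' <;>
      first
        | exact congrArg Susp.cell
            (C.interchange (Nat.lt_of_succ_lt_succ hmn) _ _ _ _ _ _ _ _ _ _)
        | rfl
        | cases hxy
        | cases hzw

/-- The suspension of a strict ω-functor. -/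
def suspMap {C D : StrictOmegaCat.{u}} (F : C ⟶ D) : C.susp ⟶ D.susp where
  toFun
    | .pt ε => .pt ε
    | .cell a => .cell (fn F a)
  map_bd ε n x := by
    rcases n with _ | n <;> rcases x with b | a <;> try rfl
    exact congrArg Susp.cell (Hom.map_bd F ε n a)
  map_comp n x y h h' := by
    rcases n with _ | n <;> rcases x with b | a <;> rcases y with b' | a' <;> try rfl
    exact congrArg Susp.cell (Hom.map_comp F n a a' _ _)

/-- The ω-category of cells of `D` from `a` to `b`. -/
def homCat (D : StrictOmegaCat.{u}) (a b : D.carrier) : StrictOmegaCat.{u} where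
  carrier := { d : D.carrier // D.bd false 0 d = a ∧ D.bd true 0 d = b }
  bd ε n d := ⟨D.bd ε (n + 1) d.1, by
    rw [D.bd_bd_of_lt _ _ n.succ_pos, D.bd_bd_of_lt _ _ n.succ_pos]; exact d.2⟩
  comp n x y h := ⟨D.comp (n + 1) x.1 y.1 (Subtype.ext_iff.1 h), by
    rw [← D.bd_bd_of_lt false false n.succ_pos, D.src_comp,
      ← D.bd_bd_of_lt true true n.succ_pos (D.comp _ _ _ _), D.tgt_comp,
      D.bd_bd_of_lt _ _ n.succ_pos, D.bd_bd_of_lt _ _ n.succ_pos]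
    exact ⟨x.2.1, y.2.2⟩⟩
  bd_bd_of_lt ε δ _ _ h x := Subtype.ext (D.bd_bd_of_lt ε δ (by omega) x.1)
  bd_bd_of_le ε δ _ _ h x := Subtype.ext (D.bd_bd_of_le ε δ (by omega) x.1)
  finite_dim x := by
    obtain ⟨n, hn⟩ := D.finite_dim x.1
    refine ⟨n, Subtype.ext ?_⟩
    change D.bd false (n + 1) x.1 = x.1
    rw [← hn, D.bd_bd_of_le _ _ n.le_succ]
  src_comp _ _ _ _ := Subtype.ext (D.src_comp _ _ _ _)
  tgt_comp _ _ _ _ := Subtype.ext (D.tgt_comp _ _ _ _)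
  bd_comp ε _ _ h _ _ _ h' := Subtype.ext (D.bd_comp ε (by omega) _ _ _ (Subtype.ext_iff.1 h'))
  id_comp _ _ h := Subtype.ext (D.id_comp _ _ (Subtype.ext_iff.1 h))
  comp_id _ _ h := Subtype.ext (D.comp_id _ _ (Subtype.ext_iff.1 h))
  assoc _ _ _ _ _ _ h h' :=
    Subtype.ext (D.assoc _ _ _ _ _ _ (Subtype.ext_iff.1 h) (Subtype.ext_iff.1 h'))
  interchange hmn _ _ _ _ _ _ _ _ h h' :=
    Subtype.ext (D.interchange (by omega) _ _ _ _ _ _ _ _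
      (Subtype.ext_iff.1 h) (Subtype.ext_iff.1 h'))

end StrictOmegaCat

namespace OmegaGraph

/-- The cells of the suspension of an ω-graph. -/
def SuspCells (X : OmegaGraph) : ℕ → Type
  | 0 => Bool
  | n + 1 => X.cells n

/-- The suspension of an ω-graph: two `0`-cells `false`, `true`, and the `n`-cells of `X` as
`(n+1)`-cells from the first to the second. -/
def susp (X : OmegaGraph) : OmegaGraph where
  cells := X.SuspCells
  face ε m n h := match m, n, h with
    | 0, _ + 1, _ => fun _ => ε
    | _ + 1, _ + 1, h => X.face ε (Nat.lt_of_succ_lt_succ h)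
  face_face ε δ k m n h h' x := by
    obtain _ | n := n
    · omega
    obtain _ | m := m
    · omega
    obtain _ | k := k
    · rfl
    · exact X.face_face ε δ (Nat.lt_of_succ_lt_succ h) (Nat.lt_of_succ_lt_succ h') x

/-- The suspension of a morphism of ω-graphs. -/
def Hom.susp {X Y : OmegaGraph} (φ : X.Hom Y) : X.susp.Hom Y.susp where
  app n := match n with
    | 0 => fun b => b
    | n + 1 => φ.app n
  app_face ε m n h x := by
    obtain _ | n := n
    · omega
    obtain _ | m := m
    · rfl
    · exact φ.app_face ε (Nat.lt_of_succ_lt_succ h) x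

/-- The suspension of a morphism from an ω-graph to the ω-graph of a strict ω-category. -/
def suspGen {X : OmegaGraph} {C : StrictOmegaCat.{0}} (η : X.Hom C.graph) :
    X.susp.Hom C.susp.graph where
  app n := match n with
    | 0 => fun b => ⟨.pt b, rfl⟩
    | n + 1 => fun x => ⟨.cell (η.app n x).1, congrArg Susp.cell (η.app n x).2⟩
  app_face ε m n h x := by
    obtain _ | n := n
    · omega
    obtain _ | m := m
    · rfl
    · exact Subtype.ext (congrArg Susp.cell
        (Subtype.ext_iff.1 (η.app_face ε (Nat.lt_of_succ_lt_succ h) x)))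

/-- The ω-graph of cells of `Y` between two objects. -/
def homGraph (Y : OmegaGraph) (a b : Y.cells 0) : OmegaGraph where
  cells n := { y : Y.cells (n + 1) //
    Y.face false n.succ_pos y = a ∧ Y.face true n.succ_pos y = b }
  face ε m n h y := ⟨Y.face ε (Nat.succ_lt_succ h) y.1, by
    rw [Y.face_face, Y.face_face]; exact y.2⟩
  face_face ε δ _ _ _ h h' y :=
    Subtype.ext (Y.face_face ε δ (Nat.succ_lt_succ h) (Nat.succ_lt_succ h') y.1)

end OmegaGraph

theorem isFreeOn_susp {C : StrictOmegaCat.{0}} {X : OmegaGraph} {η : X.Hom C.graph}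
    (hη : IsFreeOn C X η) : IsFreeOn C.susp X.susp (OmegaGraph.suspGen η) := by
  intro D φ
  let p : Bool → D.carrier := fun ε => (φ.app 0 ε).1
  have hp : ∀ n ε δ, D.bd δ n (p ε) = p ε := fun n ε δ => by
    have h0 : D.bd false 0 (p ε) = p ε := (φ.app 0 ε).2
    rw [← h0, D.bd_bd_of_le _ _ (Nat.zero_le n)]
  have hφ0 : ∀ n (x : X.cells n) (ε : Bool), D.bd ε 0 (φ.app (n + 1) x).1 = p ε := fun n x ε =>
    (Subtype.ext_iff.1 (φ.app_face ε (n := n + 1) n.succ_pos x)).symm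
  let ψ : X.Hom (D.homCat (p false) (p true)).graph :=
    { app := fun n x => ⟨⟨(φ.app (n + 1) x).1, hφ0 n x false, hφ0 n x true⟩,
        Subtype.ext (φ.app (n + 1) x).2⟩
      app_face := fun ε m n h x => by
        have e : (φ.app (m + 1) (X.face ε h x)).1 = D.bd ε (m + 1) (φ.app (n + 1) x).1 :=
          Subtype.ext_iff.1 (φ.app_face ε (m := m + 1) (n := n + 1) (Nat.succ_lt_succ h) x)
        exact Subtype.ext (Subtype.ext e) }
  obtain ⟨F, hF, hFu⟩ := hη _ ψ
  refine ⟨⟨fun x => match x with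
    | .pt ε => p ε
    | .cell a => (StrictOmegaCat.fn F a).1, ?_, ?_⟩, ?_, ?_⟩
  · intro ε n x
    rcases x with b | a
    · cases n <;> exact (hp _ _ _).symm
    · obtain _ | n := n
      · cases ε
        · exact (StrictOmegaCat.fn F a).2.1.symm
        · exact (StrictOmegaCat.fn F a).2.2.symm
      · exact Subtype.ext_iff.1 (StrictOmegaCat.Hom.map_bd F ε n a)
  · intro n x y h h'
    have unitL : ∀ (k : ℕ) (q d : D.carrier) (e : D.bd true k q = D.bd false k d),
        D.bd false k d = q → d = D.comp k q d e := by
      intro k q d e e'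
      subst e'
      exact (D.id_comp _ _ _).symm
    have unitR : ∀ (k : ℕ) (q d : D.carrier) (e : D.bd true k d = D.bd false k q),
        D.bd true k d = q → d = D.comp k d q e := by
      intro k q d e e'
      subst e'
      exact (D.comp_id _ _ _).symm
    rcases n with _ | n <;> rcases x with b | a <;> rcases y with b' | a'
    · cases h
      exact unitL _ _ _ h' (hp _ _ _)
    · cases h
      exact unitL _ _ _ h' (StrictOmegaCat.fn F a').2.1
    · cases h
      exact unitR _ _ _ h' (StrictOmegaCat.fn F a).2.2
    · cases h
    · cases h
      exact unitL _ _ _ h' (hp _ _ _)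
    · cases h
    · cases h
    · have h'' : (D.homCat (p false) (p true)).bd true n (StrictOmegaCat.fn F a) =
          (D.homCat (p false) (p true)).bd false n (StrictOmegaCat.fn F a') := Subtype.ext h'
      exact Subtype.ext_iff.1 (StrictOmegaCat.Hom.map_comp F n a a' (Susp.cell.inj h) h'')
  · intro n x
    obtain _ | n := n
    · rfl
    · exact Subtype.ext_iff.1 (hF n x)
  · intro G hG
    have hGp : ∀ ε, StrictOmegaCat.fn G (.pt ε) = p ε := fun ε => hG 0 ε
    have hG0 : ∀ (ε : Bool) a, D.bd ε 0 (StrictOmegaCat.fn G (.cell a)) = p ε := fun ε a => by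
      rw [← hGp]
      exact (StrictOmegaCat.Hom.map_bd G ε 0 (.cell a)).symm
    let G' : C ⟶ D.homCat (p false) (p true) :=
      { toFun := fun a => ⟨StrictOmegaCat.fn G (.cell a), hG0 _ _, hG0 _ _⟩
        map_bd := fun ε n a => Subtype.ext (StrictOmegaCat.Hom.map_bd G ε (n + 1) (.cell a))
        map_comp := fun n a a' h h' => Subtype.ext
          (StrictOmegaCat.Hom.map_comp G (n + 1) (.cell a) (.cell a') (congrArg Susp.cell h)
            (Subtype.ext_iff.1 h')) }
    have hG' : G' = F := hFu G' fun n x => Subtype.ext (hG (n + 1) x)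
    apply StrictOmegaCat.hom_ext
    intro x
    rcases x with ε | a
    · exact hGp ε
    · exact congrArg (fun K : C ⟶ D.homCat (p false) (p true) => (StrictOmegaCat.fn K a).1) hG'

/-- The table of dimensions with all entries increased by one. -/
def GlobTable.succ (t : GlobTable ℕ) : GlobTable ℕ where
  len := t.len
  n i := t.n i + 1
  m i := t.m i + 1
  lt_left i := Nat.succ_lt_succ (t.lt_left i)
  lt_right i := Nat.succ_lt_succ (t.lt_right i)

theorem isGlobularSum_susp {t : GlobTable ℕ} {X : OmegaGraph} {x : ∀ i, X.cells (t.n i)}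
    (hx : IsGlobularSum t X x) : IsGlobularSum t.succ X.susp x := by
  refine ⟨hx.glue, fun Y y hy => ?_⟩
  have hconst : ∀ (ε : Bool) (i : Fin (t.len + 1)),
      Y.face ε (Nat.succ_pos (t.n i)) (y i) = Y.face ε (Nat.succ_pos (t.n 0)) (y 0) := by
    intro ε i
    induction i using Fin.induction with
    | zero => rfl
    | succ i ih =>
      rw [← ih]
      have h := congrArg (Y.face ε (Nat.succ_pos (t.m i))) (hy i)
      exact ((Y.face_face ε false _ _ _).symm.trans h.symm).trans (Y.face_face ε true _ _ _)
  let p : Bool → Y.cells 0 := fun ε => Y.face ε (Nat.succ_pos (t.n 0)) (y 0)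
  obtain ⟨φ, hφ, hφu⟩ := hx.desc (Y.homGraph (p false) (p true))
    (fun i => ⟨y i, hconst _ i, hconst _ i⟩) (fun i => Subtype.ext (hy i))
  refine ⟨⟨fun n => match n with
    | 0 => p
    | n + 1 => fun c => (φ.app n c).1, ?_⟩, ?_, ?_⟩
  · intro ε m n h c
    obtain _ | n := n
    · omega
    obtain _ | m := m
    · cases ε
      · exact (φ.app n c).2.1.symm
      · exact (φ.app n c).2.2.symm
    · exact Subtype.ext_iff.1 (φ.app_face ε (Nat.lt_of_succ_lt_succ h) c)
  · intro i
    exact Subtype.ext_iff.1 (hφ i)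
  · intro ψ hψ
    have hψ0 : ∀ ε, ψ.app 0 ε = p ε := fun ε => by
      have h := ψ.app_face ε (m := 0) (n := t.n 0 + 1) (Nat.succ_pos _) (x 0)
      have h' : ψ.app (t.n 0 + 1) (x 0) = y 0 := hψ 0
      rw [h'] at h
      exact h
    have hψf : ∀ n (c : X.cells n) (ε : Bool),
        Y.face ε n.succ_pos (ψ.app (n + 1) c) = p ε := fun n c ε =>
      (ψ.app_face ε (m := 0) (n := n + 1) n.succ_pos c).symm.trans (hψ0 ε)
    let ψ' : X.Hom (Y.homGraph (p false) (p true)) :=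
      { app := fun n c => ⟨ψ.app (n + 1) c, hψf n c _, hψf n c _⟩
        app_face := fun ε m n h c => Subtype.ext
          (ψ.app_face ε (m := m + 1) (n := n + 1) (Nat.succ_lt_succ h) c) }
    have h' : ψ' = φ := hφu ψ' fun i => Subtype.ext (hψ i)
    ext n c
    obtain _ | n := n
    · exact hψ0 c
    · exact congrArg (fun K : X.Hom (Y.homGraph (p false) (p true)) => (K.app n c).1) h'

/-! ## The category Θ -/

/-- An object of `Θ`: a strict ω-category which is free on a globular sum. -/
structure Theta : Type 1 where
  cat : StrictOmegaCat.{0}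
  graph : OmegaGraph
  isSum : ∃ (t : GlobTable ℕ) (x : ∀ i, graph.cells (t.n i)), IsGlobularSum t graph x
  gen : graph.Hom cat.graph
  free : IsFreeOn cat graph gen

namespace Theta

/-- `Θ` is a full subcategory of the category of strict ω-categories. -/
instance : Category.{0} Theta where
  Hom S T := S.cat ⟶ T.cat
  id S := 𝟙 S.cat
  comp {S T U} f g := @CategoryStruct.comp StrictOmegaCat.{0} _ S.cat T.cat U.cat f g

/-- The function on cells underlying a morphism of `Θ`. -/
def fn {S T : Theta} (f : S ⟶ T) : S.cat.carrier → T.cat.carrier := StrictOmegaCat.fn f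

theorem hom_ext {S T : Theta} {f g : S ⟶ T} (h : ∀ x, fn f x = fn g x) : f = g :=
  StrictOmegaCat.hom_ext h

/-- The inert morphisms of `Θ`: those which are free on a morphism of ω-graphs between the
generating globular sums. -/
def inert : MorphismProperty Theta := fun S T f =>
  ∃ φ : S.graph.Hom T.graph, ∀ n (x : S.graph.cells n),
    fn f (S.gen.app n x).1 = (T.gen.app n (φ.app n x)).1

instance : inert.IsMultiplicative where
  id_mem _ := ⟨⟨fun _ x => x, fun _ _ _ _ _ => rfl⟩, fun _ _ => rfl⟩
  comp_mem := by
    rintro S T U f g ⟨φ, hφ⟩ ⟨ψ, hψ⟩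
    refine ⟨⟨fun n x => ψ.app n (φ.app n x), fun ε m n h x => ?_⟩, fun n x => ?_⟩
    · rw [φ.app_face, ψ.app_face]
    · change fn g (fn f _) = _
      rw [hφ, hψ]

/-- The suspension functor `Ξ : Θ ⥤ Θ`. -/
def susp : Theta ⥤ Theta where
  obj S :=
    { cat := S.cat.susp
      graph := S.graph.susp
      isSum := by
        obtain ⟨t, x, hx⟩ := S.isSum
        exact ⟨t.succ, x, isGlobularSum_susp hx⟩
      gen := OmegaGraph.suspGen S.gen
      free := isFreeOn_susp S.free }
  map f := StrictOmegaCat.suspMap f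
  map_id S := StrictOmegaCat.hom_ext (C := S.cat.susp) (D := S.cat.susp)
    fun x => by rcases x with b | a <;> rfl
  map_comp {S _ U} f g := StrictOmegaCat.hom_ext (C := S.cat.susp) (D := U.cat.susp)
    fun x => by rcases x with b | a <;> rfl

theorem inert_susp {S T : Theta} (f : S ⟶ T) (hf : inert f) : inert (susp.map f) := by
  obtain ⟨φ, hφ⟩ := hf
  refine ⟨φ.susp, fun n x => ?_⟩
  obtain _ | n := n
  · rfl
  · exact congrArg Susp.cell (hφ n x)

/-- The cells of the ω-graph with a single cell, of dimension `0`. -/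
def PointCells : ℕ → Type
  | 0 => Unit
  | _ + 1 => Empty

/-- The globe `D_0`: the terminal strict ω-category, free on the ω-graph with a single cell, of
dimension `0`. -/
def point : Theta where
  cat :=
    { carrier := Unit
      bd := fun _ _ x => x
      comp := fun _ x _ _ => x
      bd_bd_of_lt := fun _ _ _ _ _ _ => rfl
      bd_bd_of_le := fun _ _ _ _ _ _ => rfl
      finite_dim := fun _ => ⟨0, rfl⟩
      src_comp := fun _ _ _ _ => rfl
      tgt_comp := fun _ _ _ _ => rfl
      bd_comp := fun _ _ _ _ _ _ _ _ => rfl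
      id_comp := fun _ _ _ => rfl
      comp_id := fun _ _ _ => rfl
      assoc := fun _ _ _ _ _ _ _ _ => rfl
      interchange := fun _ _ _ _ _ _ _ _ _ _ _ => rfl }
  graph :=
    { cells := PointCells
      face := fun _ {_ n} h x => match n, h, x with
        | 0, h, _ => absurd h (Nat.not_lt_zero _)
        | _ + 1, _, x => Empty.elim x
      face_face := fun _ _ _ _ n _ h' x => match n, h', x with
        | 0, h', _ => absurd h' (Nat.not_lt_zero _)
        | _ + 1, _, x => Empty.elim x }
  isSum := by
    refine ⟨⟨0, fun _ => 0, Fin.elim0, fun i => i.elim0, fun i => i.elim0⟩, fun _ => (),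
      fun i => i.elim0, fun Y y _ => ?_⟩
    refine ⟨⟨fun n x => match n, x with
      | 0, _ => y 0
      | _ + 1, x => Empty.elim x, ?_⟩, ?_, ?_⟩
    · intro ε m n h x
      obtain _ | n := n
      · omega
      · exact Empty.elim x
    · intro i
      obtain rfl : i = 0 := Fin.fin_one_eq_zero i
      rfl
    · intro ψ hψ
      ext n x
      obtain _ | n := n
      · exact hψ 0
      · exact Empty.elim x
  gen :=
    { app := fun _ _ => ⟨(), rfl⟩
      app_face := fun _ _ _ _ _ => rfl }
  free := by
    intro D φ
    let d : D.carrier := (φ.app 0 ()).1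
    have hd : ∀ ε n, D.bd ε n d = d := fun ε n => by
      have h0 : D.bd false 0 d = d := (φ.app 0 ()).2
      rw [← h0, D.bd_bd_of_le _ _ (Nat.zero_le n)]
    refine ⟨⟨fun _ => d, fun ε n _ => (hd ε n).symm, ?_⟩, ?_, ?_⟩
    · intro n _ _ _ h'
      have key : ∀ (q : D.carrier) (e : D.bd true n q = D.bd false n d), q = D.bd false n d →
          d = D.comp n q d e := by
        intro q e e'
        subst e'
        exact (D.id_comp _ _ _).symm
      exact key d h' (hd _ _).symm
    · intro n x
      obtain _ | n := n
      · rfl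
      · exact Empty.elim x
    · intro G hG
      apply StrictOmegaCat.hom_ext
      intro x
      exact hG 0 ()

/-- The globe `D_n`, with `D_{n+1} = Ξ D_n`. -/
def globe : ℕ → Theta
  | 0 => point
  | n + 1 => susp.obj (globe n)

/-- The object of `Ξ S` indicated by `ε`, as a morphism from `D_0`. -/
def pick (ε : Bool) (S : Theta) : point ⟶ susp.obj S where
  toFun _ := .pt ε
  map_bd _ n _ := by cases n <;> rfl
  map_comp n _ _ _ _ := by cases n <;> rfl

theorem inert_pick (ε : Bool) (S : Theta) : inert (pick ε S) := by
  refine ⟨⟨fun n x => match n, x with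
    | 0, _ => ε
    | _ + 1, x => Empty.elim x, ?_⟩, ?_⟩
  · intro ε m n h x
    obtain _ | n := n
    · omega
    · exact Empty.elim x
  · intro n x
    obtain _ | n := n
    · rfl
    · exact Empty.elim x

/-- The inclusion of the source (`ε = false`) or target (`ε = true`) `D_m` in `D_n`, `m < n`. -/
def face (ε : Bool) : ∀ (m n : ℕ), m < n → (globe m ⟶ globe n)
  | 0, n + 1, _ => pick ε (globe n)
  | m + 1, n + 1, h => susp.map (face ε m n (Nat.lt_of_succ_lt_succ h))

theorem inert_face (ε : Bool) : ∀ (m n : ℕ) (h : m < n), inert (face ε m n h)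
  | 0, n + 1, _ => inert_pick ε (globe n)
  | m + 1, n + 1, h => inert_susp _ (inert_face ε m n (Nat.lt_of_succ_lt_succ h))

end Theta

/-! ## Sequential colimits of categories -/

section SeqColim

variable {C : Type u} [Category.{v} C]

/-- The iterates of an endofunctor. -/
def iter (F : C ⥤ C) : ℕ → (C ⥤ C)
  | 0 => 𝟭 C
  | n + 1 => iter F n ⋙ F

/-- The objects of the sequential colimit of categories `C ⥤ C ⥤ C ⥤ ⋯` along an endofunctor
`F`: `⟨k, S⟩` is the image of the object `S` of the `k`-th copy of `C`. -/
structure SeqColim (F : C ⥤ C) : Type u where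
  stage : ℕ
  obj : C

namespace SeqColim

variable {F : C ⥤ C}

/-- A morphism `F^a S ⟶ F^b T` at the common stage `k + a = l + b`, representing a morphism from
`⟨k, S⟩` to `⟨l, T⟩` in the sequential colimit. -/
structure Rep (A B : SeqColim F) : Type v where
  a : ℕ
  b : ℕ
  eq : A.stage + a = B.stage + b
  hom : (iter F a).obj A.obj ⟶ (iter F b).obj B.obj

/-- The image of a representative at the next stage. -/
def Rep.next {A B : SeqColim F} (r : Rep A B) : Rep A B :=
  ⟨r.a + 1, r.b + 1, congrArg Nat.succ r.eq, F.map r.hom⟩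

/-- A representative is identified with its image at the next stage. -/
inductive Step (A B : SeqColim F) : Rep A B → Rep A B → Prop
  | next (r : Rep A B) : Step A B r r.next

/-- Morphisms of the sequential colimit: the colimit of the sets of morphisms at the finite
stages. -/
def Hom (A B : SeqColim F) : Type v := Quot (Step A B)

theorem Rep.ext' {A B : SeqColim F} {r s : Rep A B} (ha : r.a = s.a) (hb : r.b = s.b)
    (h : HEq r.hom s.hom) : r = s := by
  obtain ⟨a, b, e, f⟩ := r
  obtain ⟨a', b', e', f'⟩ := s
  dsimp only at ha hb
  subst ha
  subst hb
  obtain rfl := eq_of_heq h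
  rfl

theorem map_heq (F : C ⥤ C) {X X' Y Y' : C} (hX : X = X') (hY : Y = Y') {f : X ⟶ Y}
    {f' : X' ⟶ Y'} (h : HEq f f') : HEq (F.map f) (F.map f') := by
  subst hX
  subst hY
  obtain rfl := eq_of_heq h
  rfl

theorem comp_heq {X X' Y Y' Z Z' W W' : C} (hX : X = X') (hY : Y = Y') (hZ : Z = Z')
    (hW : W = W') {f : X ⟶ Y} {f' : X' ⟶ Y'} {g : Z ⟶ W} {g' : Z' ⟶ W'} (e : Y = Z) (e' : Y' = Z')
    (hf : HEq f f') (hg : HEq g g') :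
    HEq (f ≫ eqToHom e ≫ g) (f' ≫ eqToHom e' ≫ g') := by
  subst hX
  subst hY
  subst hZ
  subst hW
  obtain rfl := eq_of_heq hf
  obtain rfl := eq_of_heq hg
  rfl

theorem map_comp_eqToHom (F : C ⥤ C) {X Y Z W : C} (f : X ⟶ Y) (e : Y = Z) (g : Z ⟶ W) :
    F.map (f ≫ eqToHom e ≫ g) = F.map f ≫ eqToHom (congrArg F.obj e) ≫ F.map g := by
  subst e
  simp

/-- Iterated suspension of a morphism between iterates. -/
def lift (F : C ⥤ C) {S T : C} {a b : ℕ} (f : (iter F a).obj S ⟶ (iter F b).obj T) :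
    ∀ d : ℕ, (iter F (a + d)).obj S ⟶ (iter F (b + d)).obj T
  | 0 => f
  | d + 1 => F.map (lift F f d)

theorem lift_comp {S T U : C} {a b c : ℕ} (f : (iter F a).obj S ⟶ (iter F b).obj T)
    (g : (iter F b).obj T ⟶ (iter F c).obj U) (d : ℕ) :
    lift F (f ≫ g) d = lift F f d ≫ lift F g d := by
  induction d with
  | zero => rfl
  | succ d ih => exact (congrArg F.map ih).trans (F.map_comp _ _)

theorem iter_obj_congr (F : C ⥤ C) {m n : ℕ} (h : m = n) (S : C) :
    (iter F m).obj S = (iter F n).obj S := by rw [h]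

theorem lift_map {S T : C} {a b : ℕ} (f : (iter F a).obj S ⟶ (iter F b).obj T) (d : ℕ) :
    HEq (lift F (S := S) (T := T) (a := a + 1) (b := b + 1) (F.map f) d) (F.map (lift F f d)) := by
  induction d with
  | zero => rfl
  | succ d ih =>
    exact map_heq F (iter_obj_congr F (n := a + d + 1) (Nat.add_right_comm a 1 d) S)
      (iter_obj_congr F (n := b + d + 1) (Nat.add_right_comm b 1 d) T) ih

/-- The representative `r`, moved `d` stages up. -/
def Rep.up {A B : SeqColim F} (r : Rep A B) (d : ℕ) : Rep A B :=
  ⟨r.a + d, r.b + d, by have := r.eq; omega, lift F r.hom d⟩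

theorem Rep.mk_up {A B : SeqColim F} (r : Rep A B) (d : ℕ) :
    (Quot.mk _ (r.up d) : Hom A B) = Quot.mk _ r := by
  induction d with
  | zero => rfl
  | succ d ih => exact (Quot.sound (Step.next (r.up d))).symm.trans ih

/-- Composition of representatives, at a stage where both are defined. -/
def Rep.comp {A B D : SeqColim F} (r : Rep A B) (s : Rep B D) : Rep A D :=
  ⟨r.a + s.a, s.b + r.b, by have := r.eq; have := s.eq; omega,
    lift F r.hom s.a ≫ eqToHom (by rw [Nat.add_comm]) ≫ lift F s.hom r.b⟩

theorem Rep.next_comp {A B D : SeqColim F} (r : Rep A B) (s : Rep B D) :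
    r.next.comp s = (r.comp s).next := by
  refine Rep.ext' (Nat.add_right_comm _ _ _) rfl (HEq.trans ?_
    (heq_of_eq (map_comp_eqToHom F (lift F r.hom s.a) _ (lift F s.hom r.b)).symm))
  exact comp_heq (iter_obj_congr F (n := r.a + s.a + 1) (Nat.add_right_comm _ _ _) _)
    (iter_obj_congr F (n := r.b + s.a + 1) (Nat.add_right_comm _ _ _) _) rfl rfl _ _
    (lift_map r.hom s.a) HEq.rfl

theorem Rep.comp_next {A B D : SeqColim F} (r : Rep A B) (s : Rep B D) :
    r.comp s.next = (r.comp s).next := by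
  refine Rep.ext' rfl (Nat.add_right_comm _ _ _) (HEq.trans ?_
    (heq_of_eq (map_comp_eqToHom F (lift F r.hom s.a) _ (lift F s.hom r.b)).symm))
  exact comp_heq rfl rfl
    (iter_obj_congr F (n := s.a + r.b + 1) (Nat.add_right_comm _ _ _) _)
    (iter_obj_congr F (n := s.b + r.b + 1) (Nat.add_right_comm _ _ _) _) _ _
    HEq.rfl (lift_map s.hom r.b)

/-- Composition in the sequential colimit. -/
def comp {A B D : SeqColim F} (f : Hom A B) (g : Hom B D) : Hom A D :=
  Quot.map₂ Rep.comp
    (fun r _ _ h => by cases h; rw [Rep.comp_next]; exact Step.next _)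
    (fun _ _ s h => by cases h; rw [Rep.next_comp]; exact Step.next _) f g

/-- Representatives at the same stage are composed in `C`. -/
theorem comp_mk {A B D : SeqColim F} (a b c : ℕ) (h : A.stage + a = B.stage + b)
    (h' : B.stage + b = D.stage + c) (f : (iter F a).obj A.obj ⟶ (iter F b).obj B.obj)
    (g : (iter F b).obj B.obj ⟶ (iter F c).obj D.obj) :
    comp (Quot.mk _ ⟨a, b, h, f⟩ : Hom A B) (Quot.mk _ ⟨b, c, h', g⟩ : Hom B D) =
      Quot.mk _ ⟨a, c, h.trans h', f ≫ g⟩ := by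
  refine Eq.trans ?_ (Rep.mk_up ⟨a, c, h.trans h', f ≫ g⟩ b)
  refine congrArg (Quot.mk _) (Rep.ext' rfl rfl (heq_of_eq ?_))
  simp only [Rep.comp, Rep.up, lift_comp, eqToHom_refl, Category.id_comp]

theorem id_mk (A : SeqColim F) (a : ℕ) :
    (Quot.mk _ ⟨0, 0, rfl, 𝟙 _⟩ : Hom A A) = Quot.mk _ ⟨a, a, rfl, 𝟙 _⟩ := by
  induction a with
  | zero => rfl
  | succ a ih =>
    refine (ih.trans (Quot.sound (Step.next _))).trans (congrArg (Quot.mk _) ?_)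
    exact congrArg (Rep.mk (a + 1) (a + 1) rfl) (F.map_id _)

theorem exists_rep_stage {A B : SeqColim F} (f : Hom A B) :
    ∃ N₀, ∀ N, N₀ ≤ N → ∃ r : Rep A B, Quot.mk _ r = f ∧ A.stage + r.a = N := by
  obtain ⟨r, rfl⟩ := Quot.exists_rep f
  refine ⟨A.stage + r.a, fun N hN => ⟨r.up (N - (A.stage + r.a)), r.mk_up _, ?_⟩⟩
  change A.stage + (r.a + (N - (A.stage + r.a))) = N
  omega

/-- The sequential colimit of `C ⥤ C ⥤ C ⥤ ⋯` along `F`. -/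
instance : Category.{v} (SeqColim F) where
  Hom := Hom
  id A := Quot.mk _ ⟨0, 0, rfl, 𝟙 _⟩
  comp := comp
  id_comp {A B} f := by
    obtain ⟨⟨a, b, e, f⟩, rfl⟩ := Quot.exists_rep f
    rw [id_mk A a, comp_mk, Category.id_comp]
  comp_id {A B} f := by
    obtain ⟨⟨a, b, e, f⟩, rfl⟩ := Quot.exists_rep f
    rw [id_mk B b, comp_mk, Category.comp_id]
  assoc {A B D E} f g h := by
    obtain ⟨N₁, h₁⟩ := exists_rep_stage f
    obtain ⟨N₂, h₂⟩ := exists_rep_stage g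
    obtain ⟨N₃, h₃⟩ := exists_rep_stage h
    obtain ⟨⟨a, b, e, f⟩, rfl, q₁⟩ := h₁ (max N₁ (max N₂ N₃)) (by omega)
    obtain ⟨⟨b', c, e', g⟩, rfl, q₂⟩ := h₂ (max N₁ (max N₂ N₃)) (by omega)
    obtain ⟨⟨c', d, e'', h⟩, rfl, q₃⟩ := h₃ (max N₁ (max N₂ N₃)) (by omega)
    dsimp only at q₁ q₂ q₃
    obtain rfl : b = b' := by omega
    obtain rfl : c = c' := by omega
    rw [comp_mk, comp_mk, comp_mk, comp_mk, Category.assoc]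

/-- The functor from the `k`-th copy of `C` to the sequential colimit. -/
def of (F : C ⥤ C) (k : ℕ) : C ⥤ SeqColim F where
  obj S := ⟨k, S⟩
  map f := Quot.mk _ ⟨0, 0, rfl, f⟩
  map_id _ := rfl
  map_comp {S T U} f g :=
    (comp_mk (A := ⟨k, S⟩) (B := ⟨k, T⟩) (D := ⟨k, U⟩) (F := F) 0 0 0 rfl rfl f g).symm

/-- The morphisms of the sequential colimit represented by a morphism of `C` with property `P`. -/
def colimProp (F : C ⥤ C) (P : MorphismProperty C) : MorphismProperty (SeqColim F) :=
  fun A B f => ∃ r : Rep A B, (Quot.mk _ r : Hom A B) = f ∧ P r.hom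

theorem prop_lift {P : MorphismProperty C}
    (hP : ∀ {S T : C} (f : S ⟶ T), P f → P (F.map f)) {S T : C} {a b : ℕ}
    (f : (iter F a).obj S ⟶ (iter F b).obj T) (hf : P f) (d : ℕ) : P (lift F f d) := by
  induction d with
  | zero => exact hf
  | succ d ih => exact hP _ ih

theorem colimProp_id {P : MorphismProperty C} [P.IsMultiplicative] (A : SeqColim F) :
    colimProp F P (𝟙 A) :=
  ⟨⟨0, 0, rfl, 𝟙 _⟩, rfl, P.id_mem _⟩

theorem colimProp_comp {P : MorphismProperty C} [P.IsMultiplicative]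
    (hP : ∀ {S T : C} (f : S ⟶ T), P f → P (F.map f)) {A B D : SeqColim F} (f : A ⟶ B)
    (g : B ⟶ D) (hf : colimProp F P f) (hg : colimProp F P g) : colimProp F P (f ≫ g) := by
  obtain ⟨r, rfl, hr⟩ := hf
  obtain ⟨s, rfl, hs⟩ := hg
  refine ⟨r.comp s, rfl, P.comp_mem _ _ (prop_lift hP _ hr _) (P.comp_mem _ _ ?_
    (prop_lift hP _ hs _))⟩
  have key : ∀ {X Y : C} (e : X = Y), P (eqToHom e) := by
    intro X Y e
    subst e
    exact P.id_mem _
  exact key _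

end SeqColim

end SeqColim

/-! ## The stable cell category -/

/-- The stable cell category `Θ_ℤ`, the sequential colimit of `Θ` along the suspension. -/
abbrev ThetaZ : Type 1 := SeqColim Theta.susp

namespace ThetaZ

/-- The inert morphisms of `Θ_ℤ`. -/
def inert : MorphismProperty ThetaZ := SeqColim.colimProp Theta.susp Theta.inert

theorem inert_id (T : ThetaZ) : inert (𝟙 T) := SeqColim.colimProp_id T

theorem inert_comp {S T U : ThetaZ} (f : S ⟶ T) (g : T ⟶ U) (hf : inert f) (hg : inert g) :
    inert (f ≫ g) :=
  SeqColim.colimProp_comp (fun f hf => Theta.inert_susp f hf) f g hf hg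

/-- The stable globe of dimension `l`: the globe `D_l` in the copy number `0` of `Θ` if `0 ≤ l`,
and the globe `D_0` in the copy number `-l` if `l < 0`. The stable globes are the elementary
objects of `Θ_ℤ`. -/
def globe : ℤ → ThetaZ
  | .ofNat n => ⟨0, Theta.globe n⟩
  | .negSucc n => ⟨n + 1, Theta.globe 0⟩

/-- The inclusion of the source (`ε = false`) or target (`ε = true`) of dimension `m` in the
stable globe of dimension `n`, for `m < n`. -/
def face (ε : Bool) : ∀ (m n : ℤ), m < n → (globe m ⟶ globe n)
  | .ofNat m, .ofNat n, h =>
    show (SeqColim.of Theta.susp 0).obj (Theta.globe m) ⟶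
        (SeqColim.of Theta.susp 0).obj (Theta.globe n) from
      (SeqColim.of Theta.susp 0).map (Theta.face ε m n (Int.ofNat_lt.1 h))
  | .negSucc m, .ofNat n, _ =>
    Quot.mk _ ⟨0, m + 1, (Nat.zero_add _).symm,
      Theta.pick ε ((iter Theta.susp m).obj (Theta.globe n))⟩
  | .negSucc m, .negSucc n, h =>
    Quot.mk _ ⟨0, (m - n - 1) + 1, by
      change m + 1 + 0 = n + 1 + (m - n - 1 + 1)
      rw [Int.negSucc_eq, Int.negSucc_eq] at h
      omega,
      Theta.pick ε ((iter Theta.susp (m - n - 1)).obj (Theta.globe 0))⟩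
  | .ofNat m, .negSucc n, h =>
    absurd h (not_lt_of_gt ((Int.negSucc_lt_zero n).trans_le (Int.natCast_nonneg m)))

theorem inert_face (ε : Bool) : ∀ (m n : ℤ) (h : m < n), inert (face ε m n h)
  | .ofNat m, .ofNat n, h =>
    ⟨⟨0, 0, rfl, Theta.face ε m n (Int.ofNat_lt.1 h)⟩, rfl,
      Theta.inert_face ε m n (Int.ofNat_lt.1 h)⟩
  | .negSucc _, .ofNat _, _ => ⟨_, rfl, Theta.inert_pick ε _⟩
  | .negSucc _, .negSucc _, _ => ⟨_, rfl, Theta.inert_pick ε _⟩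
  | .ofNat m, .negSucc n, h =>
    absurd h (not_lt_of_gt ((Int.negSucc_lt_zero n).trans_le (Int.natCast_nonneg m)))

end ThetaZ

/-! ## Stable globular presentations -/

/-- The objects of the shape `• ← • → • ← ⋯ → •` of zigzags with `p + 1` objects `top i` and `p`
objects `bot i`. -/
inductive GlobZigzag (p : ℕ) : Type
  | top : Fin (p + 1) → GlobZigzag p
  | bot : Fin p → GlobZigzag p

namespace GlobZigzag

/-- The morphisms of the shape of zigzags. -/
inductive Hom {p : ℕ} : GlobZigzag p → GlobZigzag p → Type
  | id (z : GlobZigzag p) : Hom z z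
  | left (i : Fin p) : Hom (.bot i) (.top i.castSucc)
  | right (i : Fin p) : Hom (.bot i) (.top i.succ)

/-- Composition of morphisms of the shape of zigzags. -/
def Hom.comp {p : ℕ} : ∀ {x y z : GlobZigzag p}, Hom x y → Hom y z → Hom x z
  | _, _, _, .id _, g => g
  | _, _, _, .left i, .id _ => .left i
  | _, _, _, .right i, .id _ => .right i

instance (p : ℕ) : Category.{0} (GlobZigzag p) where
  Hom := Hom
  id := Hom.id
  comp := Hom.comp
  id_comp _ := rfl
  comp_id f := by cases f <;> rfl
  assoc f g h := by cases f <;> cases g <;> rfl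

variable {C : Type u} [Category.{v} C] {p : ℕ}

/-- A zigzag of objects and morphisms of `C`, as a functor. -/
def functor (A : Fin (p + 1) → C) (B : Fin p → C) (l : ∀ i, B i ⟶ A i.castSucc)
    (r : ∀ i, B i ⟶ A i.succ) : GlobZigzag p ⥤ C where
  obj
    | .top i => A i
    | .bot i => B i
  map {x y} f := match x, y, f with
    | _, _, .id _ => 𝟙 _
    | _, _, .left i => l i
    | _, _, .right i => r i
  map_id _ := rfl
  map_comp {x y z} f g := by
    change Hom x y at f
    change Hom y z at g
    cases f
    · exact (Category.id_comp _).symm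
    · cases g
      exact (Category.comp_id _).symm
    · cases g
      exact (Category.comp_id _).symm

end GlobZigzag

namespace ThetaZ

/-- The dimensions of the globes of the zigzag attached to a table of integers. -/
def zigzagDim (t : GlobTable ℤ) : GlobZigzag t.len → ℤ
  | .top i => t.n i
  | .bot i => t.m i

/-- The zigzag of stable globes attached to a table of integers: the globe of dimension `m_i` is
included as the target in the globe of dimension `n_i` and as the source in the globe of
dimension `n_{i+1}`. -/
def zigzag (t : GlobTable ℤ) : GlobZigzag t.len ⥤ ThetaZ :=
  GlobZigzag.functor (fun i => globe (t.n i)) (fun i => globe (t.m i))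
    (fun i => face true _ _ (t.lt_left i)) (fun i => face false _ _ (t.lt_right i))

theorem inert_zigzag_map (t : GlobTable ℤ) {x y : GlobZigzag t.len} (f : x ⟶ y) :
    inert ((zigzag t).map f) := by
  change GlobZigzag.Hom x y at f
  cases f
  · exact inert_id _
  · exact inert_face _ _ _ _
  · exact inert_face _ _ _ _

/-- A stable globular presentation of `T` by the table of integers `t`: a colimit cocone in `Θ_ℤ`
which exhibits `T` as `D_{n_0} ⨿_{D_{m_0}} D_{n_1} ⨿ ⋯ ⨿ D_{n_p}`. -/
structure Presentation (T : ThetaZ) (t : GlobTable ℤ) : Type 1 where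
  ι : zigzag t ⟶ (Functor.const _).obj T
  isColimit : IsColimit (Cocone.mk T ι)

/-- An inert morphism of `Θ_ℤ` from an elementary object to `T`. -/
structure El (T : ThetaZ) : Type where
  dim : ℤ
  hom : globe dim ⟶ T
  isInert : inert hom

/-- The category of inert morphisms of `Θ_ℤ` from an elementary object to `T`; its morphisms are
the inert morphisms over `T`. -/
instance (T : ThetaZ) : Category.{0} (El T) where
  Hom x y := { f : globe x.dim ⟶ globe y.dim // inert f ∧ f ≫ y.hom = x.hom }
  id x := ⟨𝟙 _, inert_id _, Category.id_comp _⟩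
  comp f g := ⟨f.1 ≫ g.1, inert_comp _ _ f.2.1 g.2.1, by rw [Category.assoc, g.2.2, f.2.2]⟩
  id_comp f := Subtype.ext (Category.id_comp f.1)
  comp_id f := Subtype.ext (Category.comp_id f.1)
  assoc f g h := Subtype.ext (Category.assoc f.1 g.1 h.1)

/-- The category `(Θ_ℤᵒᵖ)^el_{T/}` of inert morphisms of `Θ_ℤᵒᵖ` from `T` to an elementary
object. -/
abbrev OpEl (T : ThetaZ) : Type := (El T)ᵒᵖ

/-- The functor which sends an inert morphism from an elementary object to its domain. -/
def El.domain (T : ThetaZ) : El T ⥤ ThetaZ where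
  obj x := globe x.dim
  map f := f.1

/-- The tautological cocone on `El.domain T` with point `T`. -/
def El.cocone (T : ThetaZ) : Cocone (El.domain T) where
  pt := T
  ι :=
    { app := fun x => x.hom
      naturality := fun _ _ f => f.2.2.trans (Category.comp_id _).symm }

/-- The zigzag of stable globes of a presentation of `T` whose cocone consists of inert morphisms,
as a diagram in `(Θ_ℤᵒᵖ)^el_{T/}`. -/
def Presentation.diagram {T : ThetaZ} {t : GlobTable ℤ} (P : Presentation T t)
    (h : ∀ z, inert (P.ι.app z)) : (GlobZigzag t.len)ᵒᵖ ⥤ OpEl T :=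
  Functor.op
    { obj := fun z => match z with
        | .top i => ⟨t.n i, P.ι.app (.top i), h _⟩
        | .bot i => ⟨t.m i, P.ι.app (.bot i), h _⟩
      map := fun {x y} f => match x, y, f with
        | _, _, .id _ => 𝟙 _
        | _, _, .left i => ⟨_, inert_zigzag_map t (GlobZigzag.Hom.left i),
            (P.ι.naturality (GlobZigzag.Hom.left i)).trans (Category.comp_id _)⟩
        | _, _, .right i => ⟨_, inert_zigzag_map t (GlobZigzag.Hom.right i),
            (P.ι.naturality (GlobZigzag.Hom.right i)).trans (Category.comp_id _)⟩
      map_id := fun _ => rfl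
      map_comp := fun {x y z} f g => by
        change GlobZigzag.Hom x y at f
        change GlobZigzag.Hom y z at g
        cases f
        · exact (Category.id_comp _).symm
        · cases g
          exact (Category.comp_id _).symm
        · cases g
          exact (Category.comp_id _).symm }

/-- A Segal `Θ_ℤᵒᵖ`-set: a presheaf `X` on `Θ_ℤ` with `X(T) ≅ lim X(E)`, where the limit is over
the inert morphisms of `Θ_ℤᵒᵖ` from `T` to an elementary object `E`. -/
def IsSegal : ObjectProperty (ThetaZᵒᵖ ⥤ Type w) := fun X =>
  ∀ T : ThetaZ, Nonempty (IsLimit (X.mapCone (El.cocone T).op))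

/-- A strict `ℤ`-category: a presheaf on `Θ_ℤ` which takes stable globular presentations to
limits. -/
def IsStrictZCategory : ObjectProperty (ThetaZᵒᵖ ⥤ Type w) := fun X =>
  ∀ (T : ThetaZ) (t : GlobTable ℤ) (P : Presentation T t),
    Nonempty (IsLimit (X.mapCone (Cocone.mk T P.ι).op))

end ThetaZ

/-- A functor of categories which is initial as a functor of `(∞,1)`-categories: its slices over
the objects of the target have a contractible classifying space. -/
def IsInftyInitial {C : Type u} [Category.{v} C] {D : Type w} [Category.{v} D] (F : C ⥤ D) : Prop :=
  ∀ d : D, ContractibleSpace (SSet.toTop.obj (nerve (CostructuredArrow F d)))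

/-!
A presentation of `T` by the table `n_0, m_0, …, n_p` writes `T` as a zigzag of globes, and the
theorem says that this zigzag knows all inert morphisms from globes to `T`. The reason is that `T`
is, up to isomorphism, free on a globular sum and moved to a finite stage, that inert morphisms from
globes are the cells of this globular sum or of its suspensions, and that the globes of the zigzag
which contain a given cell form an interval.

Reduction to ω-graphs. Suspension is faithful and reflects inert morphisms, so that morphisms of
`Θ_ℤ` and their inertness can be read off at any stage where they are represented
(`SeqColim.Represents.hom_unique`, `ThetaZ.inert_iff`). A morphism from a stable globe amounts to a
cell of a suspension of the target, its dimension being determined by the stage (`ThetaZ.Picks`),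
and it is inert exactly when this cell is a generator (`ThetaZ.Picks.inert_iff`). Every table of
integers is a shift of a table `s` of natural numbers. The globular sum `s.graph` exists, and so
does the free strict ω-category on it (`GlobTable.isGlobularSum_graph`,
`OmegaGraph.isFreeOn_free`); moved to the stage given by the shift, it has a presentation by the
given table (`ThetaZ.exists_presentation`), and any presentation by this table is isomorphic to
this one. Isomorphisms are inert, since generators can be recognized by counting generators: they
are the cells which contain at most one generator in each dimension, and the counts are the values
of ω-functors to ω-categories of chains (`Theta.inert_of_inverse`). So the morphisms of an arbitrary
presentation are inert, and the slices can be computed in the model.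

The slices. The `l`-cells of a globular sum are linearly ordered, so each of them is determined by
its position, and the positions of the `l`-dimensional faces of each globe of the zigzag are
explicit (`IsGlobularSum.exists_code`). From this one reads off that the globes `D_{n_i}` which
contain a given cell form a non-empty interval, that `D_{m_i}` contains it if and only if both of
its neighbours do, and that the cell is a face of each of these globes in only one way. Hence every
slice of the diagram is a finite zigzag without repetitions
(`ThetaZ.Presentation.isZigzag_slice`). The nerve of a finite zigzag has no non-degenerate simplex
of dimension two or more, and the position in the zigzag extends to a map from its classifying space
to the real line; this map has a left inverse, which is constructed edge by edge. The classifying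
space is therefore a retract of a contractible space (`IsZigzag.contractibleSpace`).

The second part follows from the first: limits can be computed along initial functors, and every
object of `Θ_ℤ` has at least one presentation.
-/

/-! ### Morphisms of a sequential colimit -/

namespace SeqColim

variable {C : Type u} [Category.{v} C] {F : C ⥤ C}

/-- The morphism `f'` of `C`, between the `a`-th iterate of the source and the `b`-th iterate of
the target, represents the morphism `f` of the sequential colimit. -/
def Represents {A B : SeqColim F} (a b : ℕ) (f' : (iter F a).obj A.obj ⟶ (iter F b).obj B.obj)
    (f : A ⟶ B) : Prop :=
  ∃ h : A.stage + a = B.stage + b, (Quot.mk _ ⟨a, b, h, f'⟩ : Hom A B) = f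

theorem Represents.next {A B : SeqColim F} {a b : ℕ}
    {f' : (iter F a).obj A.obj ⟶ (iter F b).obj B.obj} {f : A ⟶ B} (h : Represents a b f' f) :
    Represents (a + 1) (b + 1) (F.map f') f := by
  obtain ⟨h, rfl⟩ := h
  exact ⟨congrArg Nat.succ h, (Quot.sound (Step.next ⟨a, b, h, f'⟩)).symm⟩

theorem Represents.comp {A B D : SeqColim F} {a b d : ℕ}
    {f' : (iter F a).obj A.obj ⟶ (iter F b).obj B.obj} {f : A ⟶ B} (hf : Represents a b f' f)
    {g' : (iter F b).obj B.obj ⟶ (iter F d).obj D.obj} {g : B ⟶ D} (hg : Represents b d g' g) :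
    Represents a d (f' ≫ g') (f ≫ g) := by
  obtain ⟨h, rfl⟩ := hf
  obtain ⟨h', rfl⟩ := hg
  exact ⟨h.trans h', (comp_mk a b d h h' f' g').symm⟩

theorem Represents.unique {A B : SeqColim F} {a b : ℕ}
    {f' : (iter F a).obj A.obj ⟶ (iter F b).obj B.obj} {f g : A ⟶ B} (hf : Represents a b f' f)
    (hg : Represents a b f' g) : f = g := by
  obtain ⟨h, rfl⟩ := hf
  obtain ⟨h', rfl⟩ := hg
  rfl

theorem Represents.id (A : SeqColim F) (a : ℕ) : Represents a a (𝟙 _) (𝟙 A) :=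
  ⟨rfl, (id_mk A a).symm⟩

theorem Represents.stage_eq {A B : SeqColim F} {a b : ℕ}
    {f' : (iter F a).obj A.obj ⟶ (iter F b).obj B.obj} {f : A ⟶ B} (h : Represents a b f' f) :
    A.stage + a = B.stage + b := h.1

/-- A morphism of the sequential colimit is represented at every sufficiently late stage. -/
theorem exists_represents {A B : SeqColim F} (f : A ⟶ B) :
    ∃ b₀, ∀ b, b₀ ≤ b → ∃ (a : ℕ) (f' : (iter F a).obj A.obj ⟶ (iter F b).obj B.obj),
      Represents a b f' f := by
  obtain ⟨N₀, h⟩ := exists_rep_stage f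
  refine ⟨N₀, fun b hb => ?_⟩
  obtain ⟨⟨a, b', e, f'⟩, rfl, h'⟩ := h (B.stage + b) (by omega)
  dsimp only at h'
  obtain rfl : b = b' := by omega
  exact ⟨a, f', e, rfl⟩

theorem Rep.up_up {A B : SeqColim F} (r : Rep A B) (d e : ℕ) : (r.up d).up e = r.up (d + e) := by
  induction e with
  | zero => rfl
  | succ e ih => exact congrArg Rep.next ih

/-- Representatives of the same morphism agree at a later stage. -/
theorem Rep.exists_up_eq {A B : SeqColim F} {r s : Rep A B}
    (h : (Quot.mk _ r : Hom A B) = Quot.mk _ s) : ∃ d e, r.up d = s.up e := by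
  replace h := Quot.eqvGen_exact h
  induction h with
  | rel r s h =>
    obtain ⟨r⟩ := h
    exact ⟨1, 0, rfl⟩
  | refl r => exact ⟨0, 0, rfl⟩
  | symm r s _ ih =>
    obtain ⟨d, e, h⟩ := ih
    exact ⟨e, d, h.symm⟩
  | trans r s t _ _ ih₁ ih₂ =>
    obtain ⟨d, e, h⟩ := ih₁
    obtain ⟨d', e', h'⟩ := ih₂
    refine ⟨d + d', e' + e, ?_⟩
    rw [← Rep.up_up, h, Rep.up_up, Nat.add_comm e d', ← Rep.up_up, h', Rep.up_up]

theorem lift_injective [F.Faithful] {S T : C} {a b : ℕ}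
    {f g : (iter F a).obj S ⟶ (iter F b).obj T} (d : ℕ) (h : lift F f d = lift F g d) : f = g := by
  induction d with
  | zero => exact h
  | succ d ih => exact ih (F.map_injective h)

/-- Along a faithful endofunctor, nothing is identified in the sequential colimit. -/
theorem Represents.hom_unique [F.Faithful] {A B : SeqColim F} {a b : ℕ}
    {f' g' : (iter F a).obj A.obj ⟶ (iter F b).obj B.obj} {f : A ⟶ B} (hf : Represents a b f' f)
    (hg : Represents a b g' f) : f' = g' := by
  obtain ⟨h, rfl⟩ := hf
  obtain ⟨h', hg⟩ := hg
  obtain ⟨d, e, hde⟩ := Rep.exists_up_eq hg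
  have hd : a + d = a + e := congrArg Rep.a hde
  obtain rfl : d = e := by omega
  simp only [Rep.up, Rep.mk.injEq, heq_eq_eq, true_and] at hde
  exact (lift_injective d hde).symm

theorem prop_of_lift {P : MorphismProperty C}
    (hP : ∀ {S T : C} (f : S ⟶ T), P (F.map f) → P f) {S T : C} {a b : ℕ}
    (f : (iter F a).obj S ⟶ (iter F b).obj T) (d : ℕ) (hf : P (lift F f d)) : P f := by
  induction d with
  | zero => exact hf
  | succ d ih => exact ih (hP _ hf)

/-- If `F` preserves and reflects `P`, then `colimProp F P` can be tested on any
representative. -/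
theorem Represents.colimProp_iff {P : MorphismProperty C}
    (hP : ∀ {S T : C} (f : S ⟶ T), P f → P (F.map f))
    (hP' : ∀ {S T : C} (f : S ⟶ T), P (F.map f) → P f) {A B : SeqColim F} {a b : ℕ}
    {f' : (iter F a).obj A.obj ⟶ (iter F b).obj B.obj} {f : A ⟶ B} (hf : Represents a b f' f) :
    colimProp F P f ↔ P f' := by
  obtain ⟨h, rfl⟩ := hf
  refine ⟨?_, fun hf' => ⟨_, rfl, hf'⟩⟩
  rintro ⟨r, hr, hr'⟩
  obtain ⟨d, e, hde⟩ := Rep.exists_up_eq hr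
  have h1 : P (r.up d).hom := prop_lift hP _ hr' _
  rw [hde] at h1
  exact prop_of_lift hP' _ _ h1

end SeqColim

/-! ### Generators -/

namespace Theta

instance : susp.Faithful where
  map_injective {S T _ _} h := hom_ext fun x =>
    Susp.cell.inj (congrArg (fun k : susp.obj S ⟶ susp.obj T => fn k (.cell x)) h)

theorem inert_of_inert_susp {S T : Theta} (f : S ⟶ T) (hf : inert (susp.map f)) : inert f := by
  obtain ⟨φ, hφ⟩ := hf
  exact ⟨⟨fun n => φ.app (n + 1), fun ε m n h x =>
    φ.app_face ε (m := m + 1) (n := n + 1) (Nat.succ_lt_succ h) x⟩,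
    fun n x => Susp.cell.inj (hφ (n + 1) x)⟩

/-- The element `c` of the free ω-category `S` is a generating `n`-cell. -/
def IsGen (S : Theta) (n : ℕ) (c : S.cat.carrier) : Prop := ∃ x, (S.gen.app n x).1 = c

theorem isGen_map {S T : Theta} {f : S ⟶ T} (hf : inert f) {n : ℕ} {c : S.cat.carrier}
    (hc : S.IsGen n c) : T.IsGen n (fn f c) := by
  obtain ⟨φ, hφ⟩ := hf
  obtain ⟨x, rfl⟩ := hc
  exact ⟨_, (hφ n x).symm⟩

theorem gen_face (S : Theta) (ε : Bool) {m n : ℕ} (h : m < n) (x : S.graph.cells n) :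
    (S.gen.app m (S.graph.face ε h x)).1 = S.cat.bd ε m (S.gen.app n x).1 :=
  Subtype.ext_iff.1 (S.gen.app_face ε h x)

/-- The elements of a free ω-category are generated by the generating cells under all the
operations. -/
theorem gen_induction_bd (S : Theta) (p : S.cat.carrier → Prop)
    (gen : ∀ n x, p (S.gen.app n x).1)
    (bd : ∀ ε n x, p x → p (S.cat.bd ε n x))
    (comp : ∀ n x y h, p x → p y → p (S.cat.comp n x y h)) (x : S.cat.carrier) : p x := by
  -- The elements with property `p` form a sub-ω-category which contains the generators; by freeness
  -- its inclusion has a section.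
  let D : StrictOmegaCat.{0} :=
    { carrier := { x // p x }
      bd := fun ε n x => ⟨S.cat.bd ε n x.1, bd _ _ _ x.2⟩
      comp := fun n x y h => ⟨S.cat.comp n x.1 y.1 (Subtype.ext_iff.1 h), comp _ _ _ _ x.2 y.2⟩
      bd_bd_of_lt := fun ε δ _ _ h x => Subtype.ext (S.cat.bd_bd_of_lt ε δ h x.1)
      bd_bd_of_le := fun ε δ _ _ h x => Subtype.ext (S.cat.bd_bd_of_le ε δ h x.1)
      finite_dim := fun x => by
        obtain ⟨n, hn⟩ := S.cat.finite_dim x.1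
        exact ⟨n, Subtype.ext hn⟩
      src_comp := fun _ _ _ _ => Subtype.ext (S.cat.src_comp _ _ _ _)
      tgt_comp := fun _ _ _ _ => Subtype.ext (S.cat.tgt_comp _ _ _ _)
      bd_comp := fun ε _ _ h _ _ _ h' =>
        Subtype.ext (S.cat.bd_comp ε h _ _ _ (Subtype.ext_iff.1 h'))
      id_comp := fun _ _ h => Subtype.ext (S.cat.id_comp _ _ (Subtype.ext_iff.1 h))
      comp_id := fun _ _ h => Subtype.ext (S.cat.comp_id _ _ (Subtype.ext_iff.1 h))
      assoc := fun _ _ _ _ _ _ h h' =>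
        Subtype.ext (S.cat.assoc _ _ _ _ _ _ (Subtype.ext_iff.1 h) (Subtype.ext_iff.1 h'))
      interchange := fun hmn _ _ _ _ _ _ _ _ h h' =>
        Subtype.ext (S.cat.interchange hmn _ _ _ _ _ _ _ _
          (Subtype.ext_iff.1 h) (Subtype.ext_iff.1 h')) }
  let i : D ⟶ S.cat :=
    { toFun := Subtype.val, map_bd := fun _ _ _ => rfl, map_comp := fun _ _ _ _ _ => rfl }
  let φ : S.graph.Hom D.graph :=
    { app := fun n x => ⟨⟨(S.gen.app n x).1, gen n x⟩, Subtype.ext (S.gen.app n x).2⟩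
      app_face := fun ε m n h x => Subtype.ext (Subtype.ext (S.gen_face ε h x)) }
  obtain ⟨F, hF, -⟩ := S.free D φ
  obtain ⟨G, -, hG⟩ := S.free S.cat S.gen
  have h1 : F ≫ i = 𝟙 S.cat := by
    rw [hG (𝟙 S.cat) fun _ _ => rfl]
    exact hG _ fun n x => congrArg Subtype.val (hF n x)
  have h2 : (StrictOmegaCat.fn F x).1 = x :=
    congrArg (fun k : S.cat ⟶ S.cat => StrictOmegaCat.fn k x) h1
  exact h2 ▸ (StrictOmegaCat.fn F x).2

end Theta

/-! ### Counting generators -/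

namespace StrictOmegaCat

theorem bd_eq_self (D : StrictOmegaCat.{u}) {n : ℕ} {x : D.carrier} (h : D.bd false n x = x)
    (ε : Bool) {k : ℕ} (hk : n ≤ k) : D.bd ε k x = x := by
  rw [← h, D.bd_bd_of_le _ _ hk]

theorem comp_eq_right (D : StrictOmegaCat.{u}) {n : ℕ} {x y : D.carrier}
    (h : D.bd true n x = D.bd false n y) (hx : D.bd false n x = x) : D.comp n x y h = y := by
  have key : ∀ (q : D.carrier) (e : D.bd true n q = D.bd false n y), q = D.bd false n y →
      D.comp n q y e = y := by
    intro q e e'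
    subst e'
    exact D.id_comp _ _ _
  exact key x h (by rw [← h, D.bd_eq_self hx _ le_rfl])

theorem comp_eq_left (D : StrictOmegaCat.{u}) {n : ℕ} {x y : D.carrier}
    (h : D.bd true n x = D.bd false n y) (hy : D.bd false n y = y) : D.comp n x y h = x := by
  have key : ∀ (q : D.carrier) (e : D.bd true n x = D.bd false n q), q = D.bd true n x →
      D.comp n x q e = x := by
    intro q e e'
    subst e'
    exact D.comp_id _ _ _
  exact key y h (by rw [h, hy])

theorem bd_comp_of_gt (D : StrictOmegaCat.{u}) (ε : Bool) {n k : ℕ} (hn : n < k)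
    (x y : D.carrier) (h : D.bd true k x = D.bd false k y) :
    D.bd ε n (D.comp k x y h) = D.bd ε n x := by
  rw [← D.bd_bd_of_lt ε false hn, D.src_comp, D.bd_bd_of_lt ε false hn]

/-- The strict ω-category of pairs of `n`-chains with coefficients in `A`: below dimension `n`
there is a single cell, the `n`-cells are the elements of `A`, composed by addition along lower
dimensional boundaries, and there is exactly one `(n+1)`-cell between two `n`-cells. -/
def chains (A : Type u) [AddCommMonoid A] (n : ℕ) : StrictOmegaCat.{u} where
  carrier := A × A
  bd ε k x := if k < n then 0 else if k = n then (if ε then (x.2, x.2) else (x.1, x.1)) else x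
  comp k x y _ := if k < n then x + y else if k = n then (x.1, y.2) else x
  bd_bd_of_lt ε δ k l h x := by cases ε <;> cases δ <;> grind
  bd_bd_of_le ε δ k l h x := by
    rcases lt_trichotomy k n with hk | hk | hk <;> rcases lt_trichotomy l n with hl | hl | hl <;>
      cases ε <;> cases δ <;> first | omega | simp_all [not_lt_of_gt, ne_of_gt]
  finite_dim x := ⟨n + 1, by grind⟩
  src_comp k x y h := by grind
  tgt_comp k x y h := by grind
  bd_comp ε k l h x y h1 h2 := by
    rcases lt_trichotomy k n with hk | hk | hk <;> rcases lt_trichotomy l n with hl | hl | hl <;>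
      cases ε <;> first | omega | simp_all [not_lt_of_gt, ne_of_gt]
  id_comp k x h := by
    rcases lt_trichotomy k n with hk | hk | hk <;> simp_all [not_lt_of_gt, ne_of_gt]
  comp_id k x h := by
    rcases lt_trichotomy k n with hk | hk | hk <;> simp_all [not_lt_of_gt, ne_of_gt]
  assoc k x y z _ _ _ _ := by
    rcases lt_trichotomy k n with hk | hk | hk <;> simp_all [not_lt_of_gt, ne_of_gt, add_assoc]
  interchange {k l} hkl x y z w _ _ _ _ _ _ := by
    rcases lt_trichotomy k n with hk | hk | hk <;> rcases lt_trichotomy l n with hl | hl | hl <;>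
      first
        | omega
        | simp_all [not_lt_of_gt, ne_of_gt, add_add_add_comm]

end StrictOmegaCat

namespace Theta

/-- Every element of a free ω-category is an iterated composite of generators. -/
theorem gen_induction (S : Theta) (p : S.cat.carrier → Prop)
    (gen : ∀ n x, p (S.gen.app n x).1)
    (comp : ∀ n x y h, p x → p y → p (S.cat.comp n x y h)) (x : S.cat.carrier) : p x := by
  suffices h : p x ∧ ∀ ε n, p (S.cat.bd ε n x) from h.1
  induction x using S.gen_induction_bd with
  | gen n x =>
    refine ⟨gen n x, fun ε m => ?_⟩
    rcases lt_or_ge m n with h | h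
    · rw [← S.gen_face ε h]
      exact gen _ _
    · rw [S.cat.bd_eq_self (S.gen.app n x).2 _ h]
      exact gen _ _
  | bd ε n x ih =>
    refine ⟨ih.2 _ _, fun δ m => ?_⟩
    rcases lt_or_ge m n with h | h
    · rw [S.cat.bd_bd_of_lt _ _ h]
      exact ih.2 _ _
    · rw [S.cat.bd_bd_of_le _ _ h]
      exact ih.2 _ _
  | comp k x y h hx hy =>
    refine ⟨comp _ _ _ _ hx.1 hy.1, fun ε m => ?_⟩
    rcases lt_trichotomy m k with hm | rfl | hm
    · rw [S.cat.bd_comp_of_gt _ hm]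
      exact hx.2 _ _
    · cases ε
      · rw [S.cat.src_comp]
        exact hx.2 _ _
      · rw [S.cat.tgt_comp]
        exact hy.2 _ _
    · have h' : S.cat.bd true k (S.cat.bd ε m x) = S.cat.bd false k (S.cat.bd ε m y) := by
        rw [S.cat.bd_bd_of_lt _ _ hm, S.cat.bd_bd_of_lt _ _ hm, h]
      rw [S.cat.bd_comp ε hm _ _ _ h']
      exact comp _ _ _ _ (hx.2 _ _) (hy.2 _ _)

/-- A weight on the generating `n`-cells extends to an ω-functor to the `n`-chains. -/
theorem exists_chains (S : Theta) {A : Type} [AddCommMonoid A] {n : ℕ}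
    (w : S.graph.cells n → A) :
    ∃ F : S.cat ⟶ StrictOmegaCat.chains A n,
      (∀ m (x : S.graph.cells m), m < n → StrictOmegaCat.fn F (S.gen.app m x).1 = (0, 0)) ∧
      (∀ x : S.graph.cells n, StrictOmegaCat.fn F (S.gen.app n x).1 = (w x, w x)) ∧
      ∀ m (x : S.graph.cells m) (h : n < m), StrictOmegaCat.fn F (S.gen.app m x).1 =
        (w (S.graph.face false h x), w (S.graph.face true h x)) := by
  let a : ∀ m, S.graph.cells m → A × A := fun m x =>
    if h : n < m then (w (S.graph.face false h x), w (S.graph.face true h x))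
    else if h : m = n then (w (h ▸ x), w (h ▸ x)) else (0, 0)
  have ha_gt : ∀ m (x : S.graph.cells m) (h : n < m),
      a m x = (w (S.graph.face false h x), w (S.graph.face true h x)) := fun m x h => dif_pos h
  have ha_eq : ∀ x : S.graph.cells n, a n x = (w x, w x) := fun x => by simp [a]
  have ha_lt : ∀ m (x : S.graph.cells m), m < n → a m x = (0, 0) := fun m x h => by
    simp only [a, dif_neg (not_lt_of_gt h), dif_neg (ne_of_lt h)]
  let φ : S.graph.Hom (StrictOmegaCat.chains A n).graph :=
    { app := fun m x => ⟨a m x, by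
        rcases lt_trichotomy m n with h | rfl | h
        · simp only [ha_lt m x h, StrictOmegaCat.chains, if_pos h]
          rfl
        · rw [ha_eq]
          simp [StrictOmegaCat.chains]
        · simp [StrictOmegaCat.chains, not_lt_of_gt h, ne_of_gt h]⟩
      app_face := fun ε m k h x => Subtype.ext (by
        change a m (S.graph.face ε h x) = (StrictOmegaCat.chains A n).bd ε m (a k x)
        rcases lt_trichotomy m n with h' | rfl | h'
        · rw [ha_lt m _ h']
          simp [StrictOmegaCat.chains, h']
        · rw [ha_eq, ha_gt k x h]
          cases ε <;> simp [StrictOmegaCat.chains]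
        · rw [ha_gt m _ h', ha_gt k x (h'.trans h), S.graph.face_face, S.graph.face_face]
          simp [StrictOmegaCat.chains, not_lt_of_gt h', ne_of_gt h']) }
  obtain ⟨F, hF, -⟩ := S.free _ φ
  exact ⟨F, fun m x h => (hF m x).trans (ha_lt m x h), fun x => (hF n x).trans (ha_eq x),
    fun m x h => (hF m x).trans (ha_gt m x h)⟩

/-- Distinct cells of the generating ω-graph remain distinct in the free ω-category: they have
different images in the chains with coefficients in multisets of cells. -/
theorem gen_injective (S : Theta) {n : ℕ} {x y : S.graph.cells n}
    (h : (S.gen.app n x).1 = (S.gen.app n y).1) : x = y := by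
  obtain ⟨F, -, hF, -⟩ := S.exists_chains fun x : S.graph.cells n => ({x} : Multiset _)
  have h' := congrArg (fun z => (StrictOmegaCat.fn F z).1) h
  simp only [hF] at h'
  exact Multiset.singleton_inj.1 h'

/-- The number of generating `m`-cells in an element of a free ω-category: more precisely in its
`m`-dimensional source. -/
noncomputable def len (S : Theta) (m : ℕ) (x : S.cat.carrier) : ℕ :=
  (StrictOmegaCat.fn (S.exists_chains fun _ : S.graph.cells m => 1).choose x).1

theorem len_gen (S : Theta) (m n : ℕ) (x : S.graph.cells n) :
    S.len m (S.gen.app n x).1 = if m ≤ n then 1 else 0 := by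
  obtain ⟨h₁, h₂, h₃⟩ := (S.exists_chains fun _ : S.graph.cells m => 1).choose_spec
  rcases lt_trichotomy m n with h | rfl | h
  · rw [if_pos h.le, len, h₃ _ _ h]
  · rw [if_pos le_rfl, len, h₂]
  · rw [if_neg (not_le_of_gt h), len, h₁ _ _ h]

theorem len_bd (S : Theta) (ε : Bool) {m k : ℕ} (h : k < m) (x : S.cat.carrier) :
    S.len m (S.cat.bd ε k x) = 0 := by
  rw [len, StrictOmegaCat.fn, StrictOmegaCat.Hom.map_bd]
  simp [StrictOmegaCat.chains, h]

theorem len_comp_of_lt (S : Theta) {m k : ℕ} (h : k < m) (x y : S.cat.carrier) (hxy) :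
    S.len m (S.cat.comp k x y hxy) = S.len m x + S.len m y := by
  rw [len, StrictOmegaCat.fn, StrictOmegaCat.Hom.map_comp _ _ _ _ _
    (by rw [← StrictOmegaCat.Hom.map_bd, ← StrictOmegaCat.Hom.map_bd, hxy])]
  simp [StrictOmegaCat.chains, h, len, StrictOmegaCat.fn]

theorem len_comp_of_ge (S : Theta) {m k : ℕ} (h : m ≤ k) (x y : S.cat.carrier) (hxy) :
    S.len m (S.cat.comp k x y hxy) = S.len m x := by
  rw [len, StrictOmegaCat.fn, StrictOmegaCat.Hom.map_comp _ _ _ _ _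
    (by rw [← StrictOmegaCat.Hom.map_bd, ← StrictOmegaCat.Hom.map_bd, hxy])]
  rcases h.lt_or_eq with h | rfl
  · simp [StrictOmegaCat.chains, not_lt_of_gt h, ne_of_gt h, len, StrictOmegaCat.fn]
  · simp [StrictOmegaCat.chains, len, StrictOmegaCat.fn]

/-- A cell which contains no generator of dimension `m + 1` has dimension at most `m`. -/
theorem bd_of_len_eq_zero (S : Theta) {m : ℕ} (x : S.cat.carrier) (hx : S.len (m + 1) x = 0) :
    S.cat.bd false m x = x := by
  induction x using S.gen_induction with
  | gen n x =>
    rw [len_gen] at hx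
    refine S.cat.bd_eq_self (S.gen.app n x).2 _ ?_
    by_contra h
    rw [if_pos (by omega)] at hx
    exact one_ne_zero hx
  | comp k x y h ihx ihy =>
    rcases lt_or_ge k (m + 1) with hk | hk
    · rw [S.len_comp_of_lt hk, Nat.add_eq_zero_iff] at hx
      have hx' := ihx hx.1
      have hy' := ihy hx.2
      rcases (Nat.lt_succ_iff.1 hk).lt_or_eq with hk | rfl
      · rw [S.cat.bd_comp false hk _ _ _ (by rw [hx', hy', h])]
        simp only [hx', hy']
      · rw [S.cat.comp_eq_right h hx', hy']
    · have hx' := ihx (by rwa [S.len_comp_of_ge hk] at hx)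
      rw [S.cat.comp_eq_right h (S.cat.bd_eq_self hx' _ (by omega))] at hx ⊢
      exact ihy hx

/-- A cell which contains at most one generator in each dimension is a generator. -/
theorem isGen_of_len_le_one (S : Theta) (x : S.cat.carrier) (hx : ∀ m, S.len m x ≤ 1) :
    ∃ n, S.IsGen n x := by
  induction x using S.gen_induction with
  | gen n x => exact ⟨n, x, rfl⟩
  | comp k x y h ihx ihy =>
    have hk := hx (k + 1)
    rw [S.len_comp_of_lt (Nat.lt_add_one k)] at hk
    rcases Nat.eq_zero_or_pos (S.len (k + 1) y) with h0 | h0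
    · rw [S.cat.comp_eq_left h (S.bd_of_len_eq_zero y h0)] at hx ⊢
      exact ihx hx
    · rw [S.cat.comp_eq_right h (S.bd_of_len_eq_zero x (by omega))] at hx ⊢
      exact ihy hx

theorem len_zero (S : Theta) (x : S.cat.carrier) : S.len 0 x = 1 := by
  induction x using S.gen_induction with
  | gen n x => rw [len_gen, if_pos n.zero_le]
  | comp k x y h ihx _ => rw [S.len_comp_of_ge k.zero_le, ihx]

/-- An injective ω-functor does not decrease the number of generators: the image of a generator of
dimension at least `m` is not a cell of dimension below `m`, so it contains an `m`-generator. -/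
theorem len_le_len_fn {S T : Theta} (f : S ⟶ T) (hf : Function.Injective (fn f)) (m : ℕ)
    (x : S.cat.carrier) : S.len m x ≤ T.len m (fn f x) := by
  induction x using S.gen_induction with
  | gen n x =>
    rw [len_gen]
    split_ifs with h
    -- Otherwise the image, and hence the generator itself, would be a cell of dimension below `m`.
    · rw [Nat.one_le_iff_ne_zero]
      intro h0
      obtain _ | m := m
      · rw [len_zero] at h0
        exact one_ne_zero h0
      · have h1 := T.bd_of_len_eq_zero _ h0
        have h2 : S.cat.bd false m (S.gen.app n x).1 = (S.gen.app n x).1 :=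
          hf ((StrictOmegaCat.Hom.map_bd f _ _ _).trans h1)
        have h3 := S.len_gen (m + 1) n x
        rw [← h2, S.len_bd _ m.lt_succ_self, if_pos h] at h3
        exact zero_ne_one h3
    · exact Nat.zero_le _
  | comp k x y h ihx ihy =>
    have h' : T.cat.bd true k (fn f x) = T.cat.bd false k (fn f y) :=
      (StrictOmegaCat.Hom.map_bd f _ _ _).symm.trans
        ((congrArg (fn f) h).trans (StrictOmegaCat.Hom.map_bd f _ _ _))
    have e : fn f (S.cat.comp k x y h) = T.cat.comp k (fn f x) (fn f y) h' :=
      StrictOmegaCat.Hom.map_comp f _ _ _ _ _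
    rw [e]
    rcases lt_or_ge k m with hk | hk
    · rw [S.len_comp_of_lt hk, T.len_comp_of_lt hk]
      omega
    · rwa [S.len_comp_of_ge hk, T.len_comp_of_ge hk]

/-- Generators are the cells which contain at most one generator in each dimension, and the number
of generators in a cell is invariant under isomorphism. -/
theorem inert_of_inverse {S T : Theta} (f : S ⟶ T) (g : T ⟶ S) (hfg : f ≫ g = 𝟙 S)
    (hgf : g ≫ f = 𝟙 T) : inert f := by
  have h1 : ∀ x, fn g (fn f x) = x := fun x => congrArg (fun k : S ⟶ S => fn k x) hfg
  have h2 : ∀ x, fn f (fn g x) = x := fun x => congrArg (fun k : T ⟶ T => fn k x) hgf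
  have hlen : ∀ m x, T.len m (fn f x) = S.len m x := fun m x => by
    refine le_antisymm ?_ (len_le_len_fn f (Function.LeftInverse.injective h1) m x)
    have h := len_le_len_fn g (Function.LeftInverse.injective h2) m (fn f x)
    rwa [h1] at h
  have hgen : ∀ n (x : S.graph.cells n), ∃ y : T.graph.cells n,
      (T.gen.app n y).1 = fn f (S.gen.app n x).1 := fun n x => by
    obtain ⟨n', y, hy⟩ := T.isGen_of_len_le_one (fn f (S.gen.app n x).1) fun m => by
      rw [hlen, len_gen]
      split_ifs <;> omega
    have key : ∀ m, m ≤ n ↔ m ≤ n' := fun m => by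
      have h := T.len_gen m n' y
      rw [hy, hlen, len_gen] at h
      split_ifs at h <;> omega
    obtain rfl : n = n' := le_antisymm ((key n).1 le_rfl) ((key n').2 le_rfl)
    exact ⟨y, hy⟩
  choose φ hφ using hgen
  refine ⟨⟨φ, fun ε m n h x => T.gen_injective ?_⟩, fun n x => (hφ n x).symm⟩
  rw [hφ, gen_face, gen_face, hφ]
  exact StrictOmegaCat.Hom.map_bd f _ _ _

end Theta

namespace ThetaZ

/-- Whether a morphism of `Θ_ℤ` is inert can be tested on any representative. -/
theorem inert_iff {A B : ThetaZ} {a b : ℕ}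
    {f' : (iter Theta.susp a).obj A.obj ⟶ (iter Theta.susp b).obj B.obj} {f : A ⟶ B}
    (h : SeqColim.Represents a b f' f) : inert f ↔ Theta.inert f' :=
  h.colimProp_iff (fun f => Theta.inert_susp f) (fun f => Theta.inert_of_inert_susp f)

theorem inert_of_iso {A B : ThetaZ} (e : A ≅ B) : inert e.hom := by
  obtain ⟨b₁, h₁⟩ := SeqColim.exists_represents e.hom
  obtain ⟨b₂, h₂⟩ := SeqColim.exists_represents e.inv
  obtain ⟨b₃, f, hf⟩ := h₂ (b₂ + A.stage + B.stage + b₁) (by omega)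
  obtain ⟨a, g, hg⟩ := h₁ b₃ (by have := hf.stage_eq; omega)
  obtain rfl : a = b₂ + A.stage + B.stage + b₁ := by
    have := hf.stage_eq
    have := hg.stage_eq
    omega
  refine (inert_iff hg).2 (Theta.inert_of_inverse g f ?_ ?_)
  · refine (hg.comp hf).hom_unique ?_
    rw [e.hom_inv_id]
    exact SeqColim.Represents.id _ _
  · refine (hf.comp hg).hom_unique ?_
    rw [e.inv_hom_id]
    exact SeqColim.Represents.id _ _

end ThetaZ

/-! ### The free strict ω-category on an ω-graph -/

namespace OmegaGraph

/-- Formal expressions in the operations of strict ω-categories and the cells of an ω-graph. No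
composability is required. -/
inductive Term (X : OmegaGraph) : Type
  | gen (n : ℕ) (x : X.cells n) : Term X
  | bd (ε : Bool) (n : ℕ) (t : Term X) : Term X
  | comp (n : ℕ) (s t : Term X) : Term X

variable {X : OmegaGraph}

/-- The expression `t` is defined, with value `d`, in the ω-category `D` over `X`. -/
inductive Eval {D : StrictOmegaCat.{0}} (φ : X.Hom D.graph) : Term X → D.carrier → Prop
  | gen (n : ℕ) (x : X.cells n) : Eval φ (.gen n x) (φ.app n x).1
  | bd (ε : Bool) (n : ℕ) {t : Term X} {d : D.carrier} (h : Eval φ t d) :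
      Eval φ (.bd ε n t) (D.bd ε n d)
  | comp (n : ℕ) {s t : Term X} {c d : D.carrier} (hs : Eval φ s c) (ht : Eval φ t d)
      (h : D.bd true n c = D.bd false n d) : Eval φ (.comp n s t) (D.comp n c d h)

theorem Eval.unique {D : StrictOmegaCat.{0}} {φ : X.Hom D.graph} {t : Term X} {c d : D.carrier}
    (hc : Eval φ t c) (hd : Eval φ t d) : c = d := by
  induction hc generalizing d with
  | gen n x =>
    cases hd
    rfl
  | bd ε n h ih =>
    cases hd with
    | bd _ _ h' => rw [ih h']
  | comp n hs ht h ihs iht =>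
    cases hd with
    | comp _ hs' ht' h' =>
      obtain rfl := ihs hs'
      obtain rfl := iht ht'
      rfl

/-- Two expressions which are defined in every ω-category over `X` are identified if they have the
same value in every ω-category over `X`. As the quantifier ranges over all ω-categories, the
universal property and the laws of an ω-category hold by construction, without an explicit
congruence. -/
def freeSetoid (X : OmegaGraph) :
    Setoid { t : Term X // ∀ (D : StrictOmegaCat.{0}) (φ : X.Hom D.graph), ∃ d, Eval φ t d } where
  r s t := ∀ (D : StrictOmegaCat.{0}) (φ : X.Hom D.graph) (d), Eval φ s.1 d → Eval φ t.1 d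
  iseqv :=
    { refl := fun _ _ _ _ h => h
      symm := fun {s t} h D φ d hd => by
        obtain ⟨d', hd'⟩ := s.2 D φ
        rwa [hd.unique (h D φ d' hd')]
      trans := fun h h' D φ d hd => h' D φ d (h D φ d hd) }

/-- The cells of the free strict ω-category on `X`. -/
def FreeCells (X : OmegaGraph) : Type := Quotient X.freeSetoid

namespace FreeCells

/-- The value of an element of the free ω-category in an ω-category over `X`. -/
noncomputable def ev {D : StrictOmegaCat.{0}} (φ : X.Hom D.graph) (a : X.FreeCells) : D.carrier :=
  ((Quotient.out a).2 D φ).choose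

theorem ev_mk {D : StrictOmegaCat.{0}} (φ : X.Hom D.graph) {t : Term X} (ht) {d : D.carrier}
    (h : Eval φ t d) : ev φ (Quotient.mk X.freeSetoid ⟨t, ht⟩) = d := by
  have h1 := ((Quotient.out (Quotient.mk X.freeSetoid ⟨t, ht⟩)).2 D φ).choose_spec
  exact (Quotient.exact (Quotient.out_eq (Quotient.mk X.freeSetoid ⟨t, ht⟩)) D φ _ h1).unique h

theorem eval_out {D : StrictOmegaCat.{0}} (φ : X.Hom D.graph) (a : X.FreeCells) :
    Eval φ (Quotient.out a).1 (ev φ a) :=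
  ((Quotient.out a).2 D φ).choose_spec

theorem ext {a b : X.FreeCells}
    (h : ∀ (D : StrictOmegaCat.{0}) (φ : X.Hom D.graph), ev φ a = ev φ b) : a = b := by
  rw [← Quotient.out_eq a, ← Quotient.out_eq b]
  refine Quotient.sound fun D φ d hd => ?_
  rw [hd.unique (eval_out φ a), h D φ]
  exact eval_out φ b

/-- The boundary operators of the free ω-category. -/
noncomputable def bd (ε : Bool) (n : ℕ) (a : X.FreeCells) : X.FreeCells :=
  Quotient.mk X.freeSetoid ⟨.bd ε n (Quotient.out a).1, fun _ φ => ⟨_, .bd ε n (eval_out φ a)⟩⟩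

theorem ev_bd {D : StrictOmegaCat.{0}} (φ : X.Hom D.graph) (ε : Bool) (n : ℕ) (a : X.FreeCells) :
    ev φ (bd ε n a) = D.bd ε n (ev φ a) :=
  ev_mk φ _ (.bd ε n (eval_out φ a))

theorem ev_compat {D : StrictOmegaCat.{0}} (φ : X.Hom D.graph) {n : ℕ} {a b : X.FreeCells}
    (h : bd true n a = bd false n b) : D.bd true n (ev φ a) = D.bd false n (ev φ b) := by
  rw [← ev_bd, ← ev_bd, h]

/-- Composition in the free ω-category. -/
noncomputable def comp (n : ℕ) (a b : X.FreeCells) (h : bd true n a = bd false n b) :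
    X.FreeCells :=
  Quotient.mk X.freeSetoid ⟨.comp n (Quotient.out a).1 (Quotient.out b).1,
    fun _ φ => ⟨_, .comp n (eval_out φ a) (eval_out φ b) (ev_compat φ h)⟩⟩

theorem ev_comp {D : StrictOmegaCat.{0}} (φ : X.Hom D.graph) (n : ℕ) (a b : X.FreeCells) (h) :
    ev φ (comp n a b h) = D.comp n (ev φ a) (ev φ b) (ev_compat φ h) :=
  ev_mk φ _ (.comp n (eval_out φ a) (eval_out φ b) (ev_compat φ h))

/-- The generators of the free ω-category. -/
def gen (n : ℕ) (x : X.cells n) : X.FreeCells :=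
  Quotient.mk X.freeSetoid ⟨.gen n x, fun _ _ => ⟨_, .gen n x⟩⟩

theorem ev_gen {D : StrictOmegaCat.{0}} (φ : X.Hom D.graph) (n : ℕ) (x : X.cells n) :
    ev φ (gen n x) = (φ.app n x).1 :=
  ev_mk φ _ (.gen n x)

/-- The dimension of an expression bounds the dimension of its values, uniformly in the
ω-category. -/
theorem exists_dim (t : Term X) : ∃ n, ∀ (D : StrictOmegaCat.{0}) (φ : X.Hom D.graph) (d),
    Eval φ t d → D.bd false n d = d := by
  induction t with
  | gen n x =>
    refine ⟨n, fun D φ d hd => ?_⟩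
    cases hd
    exact (φ.app n x).2
  | bd ε n t _ =>
    refine ⟨n, fun D _ d hd => ?_⟩
    cases hd
    exact D.bd_bd_of_le _ _ le_rfl _
  | comp n s t ihs iht =>
    obtain ⟨k, hk⟩ := ihs
    obtain ⟨l, hl⟩ := iht
    refine ⟨n + k + l + 1, fun D φ d hd => ?_⟩
    cases hd with
    | comp _ hs ht h =>
      have h1 := D.bd_eq_self (hk D φ _ hs) false (show k ≤ n + k + l + 1 by omega)
      have h2 := D.bd_eq_self (hl D φ _ ht) false (show l ≤ n + k + l + 1 by omega)
      rw [D.bd_comp false (by omega) _ _ _ (by rw [h1, h2, h])]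
      simp only [h1, h2]

theorem finite_dim (a : X.FreeCells) : ∃ n, bd false n a = a := by
  obtain ⟨n, hn⟩ := exists_dim (Quotient.out a).1
  exact ⟨n, ext fun D φ => by rw [ev_bd, hn D φ _ (eval_out φ a)]⟩

end FreeCells

/-- The free strict ω-category on an ω-graph. -/
noncomputable def free (X : OmegaGraph) : StrictOmegaCat.{0} where
  carrier := X.FreeCells
  bd := FreeCells.bd
  comp := FreeCells.comp
  bd_bd_of_lt ε δ _ _ h x := FreeCells.ext fun D φ => by
    simp only [FreeCells.ev_bd, D.bd_bd_of_lt ε δ h]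
  bd_bd_of_le ε δ _ _ h x := FreeCells.ext fun D φ => by
    simp only [FreeCells.ev_bd, D.bd_bd_of_le ε δ h]
  finite_dim := FreeCells.finite_dim
  src_comp n x y h := FreeCells.ext fun D φ => by
    simp only [FreeCells.ev_bd, FreeCells.ev_comp, D.src_comp]
  tgt_comp n x y h := FreeCells.ext fun D φ => by
    simp only [FreeCells.ev_bd, FreeCells.ev_comp, D.tgt_comp]
  bd_comp ε _ _ h x y _ h' := FreeCells.ext fun D φ => by
    have e := FreeCells.ev_compat φ h'
    simp only [FreeCells.ev_bd, FreeCells.ev_comp] at e ⊢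
    exact D.bd_comp ε h _ _ _ e
  id_comp n x h := FreeCells.ext fun D φ => by
    simp only [FreeCells.ev_bd, FreeCells.ev_comp, D.id_comp]
  comp_id n x h := FreeCells.ext fun D φ => by
    simp only [FreeCells.ev_bd, FreeCells.ev_comp, D.comp_id]
  assoc n x y z _ _ _ h' := FreeCells.ext fun D φ => by
    have e := FreeCells.ev_compat φ h'
    simp only [FreeCells.ev_comp] at e ⊢
    exact D.assoc _ _ _ _ _ _ _ e
  interchange hmn x y z w _ _ _ _ _ h' := FreeCells.ext fun D φ => by
    have e := FreeCells.ev_compat φ h'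
    simp only [FreeCells.ev_comp] at e ⊢
    exact D.interchange hmn _ _ _ _ _ _ _ _ _ e

/-- The inclusion of the generators in the free ω-category. -/
noncomputable def freeGen (X : OmegaGraph) : X.Hom X.free.graph where
  app n x := ⟨FreeCells.gen n x, FreeCells.ext fun D φ => by
    rw [show X.free.bd false n (FreeCells.gen n x) = FreeCells.bd false n (FreeCells.gen n x)
      from rfl, FreeCells.ev_bd, FreeCells.ev_gen, (φ.app n x).2]⟩
  app_face ε m n h x := Subtype.ext (FreeCells.ext fun D φ => by
    change FreeCells.ev φ (FreeCells.gen m (X.face ε h x)) =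
      FreeCells.ev φ (FreeCells.bd ε m (FreeCells.gen n x))
    rw [FreeCells.ev_bd, FreeCells.ev_gen, FreeCells.ev_gen, φ.app_face]
    rfl)

/-- An ω-functor over `X` preserves the values of expressions. -/
theorem Eval.map {D : StrictOmegaCat.{0}} {φ : X.Hom D.graph} {G : X.free ⟶ D}
    (hG : ∀ n (x : X.cells n), StrictOmegaCat.fn G (X.freeGen.app n x).1 = (φ.app n x).1)
    {t : Term X} {a : X.free.carrier} (h : Eval X.freeGen t a) :
    Eval φ t (StrictOmegaCat.fn G a) := by
  induction h with
  | gen n x =>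
    rw [hG]
    exact .gen n x
  | bd ε n h ih =>
    rw [StrictOmegaCat.fn, StrictOmegaCat.Hom.map_bd]
    exact .bd ε n ih
  | comp n hs ht h ihs iht =>
    rw [StrictOmegaCat.fn, StrictOmegaCat.Hom.map_comp G n _ _ h (by
      rw [← StrictOmegaCat.Hom.map_bd, ← StrictOmegaCat.Hom.map_bd]
      exact congrArg (StrictOmegaCat.fn G) h)]
    exact .comp n ihs iht _

/-- Evaluation, as an ω-functor. -/
noncomputable def evHom {D : StrictOmegaCat.{0}} (φ : X.Hom D.graph) : X.free ⟶ D where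
  toFun := FreeCells.ev φ
  map_bd ε n x := FreeCells.ev_bd φ ε n x
  map_comp n x y h _ := FreeCells.ev_comp φ n x y h

theorem isFreeOn_free (X : OmegaGraph) : IsFreeOn X.free X X.freeGen := by
  intro D φ
  refine ⟨evHom φ, fun n x => FreeCells.ev_gen φ n x, fun G hG => ?_⟩
  apply StrictOmegaCat.hom_ext
  intro a
  change StrictOmegaCat.fn G a = FreeCells.ev φ a
  have h1 : FreeCells.ev X.freeGen a = a := FreeCells.ext fun D φ =>
    (Eval.map (G := evHom φ) (fun n x => FreeCells.ev_gen φ n x)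
      (FreeCells.eval_out X.freeGen a)).unique (FreeCells.eval_out φ a)
  have h2 := Eval.map hG (FreeCells.eval_out X.freeGen a)
  rw [h1] at h2
  exact h2.unique (FreeCells.eval_out φ a)

end OmegaGraph

/-! ### Cells of globular sums -/

/-- Induction on the larger one of two indices `i ≤ j`. -/
theorem Fin.le_induction_succ {n : ℕ} {p : Fin (n + 1) → Fin (n + 1) → Prop} (refl : ∀ i, p i i)
    (step : ∀ (i : Fin (n + 1)) (k : Fin n), i ≤ k.castSucc → p i k.castSucc → p i k.succ)
    {i j : Fin (n + 1)} (h : i ≤ j) : p i j := by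
  induction j using Fin.induction with
  | zero =>
    obtain rfl : i = 0 := Fin.le_zero_iff.1 h
    exact refl _
  | succ k ih =>
    rcases h.lt_or_eq with h | rfl
    · have h' : i ≤ k.castSucc := Fin.le_castSucc_iff.2 h
      exact step i k h' (ih h')
    · exact refl _

namespace GlobTable

variable (t : GlobTable ℕ)

/-- The number of `l`-dimensional cells separating the `l`-dimensional sources of two globes which
are glued along a globe of dimension `m`: these sources agree if `l < m`, and the second is the
target of the first if `l = m`. -/
def gap (m l : ℕ) : ℕ := if l < m then 0 else if l = m then 1 else 2

/-- The position of the `l`-dimensional source of the `i`-th globe of a globular sum among its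
`l`-dimensional cells; the `l`-dimensional target, if different, is in the next position. -/
def off (l : ℕ) (i : Fin (t.len + 1)) : ℕ :=
  Fin.induction (motive := fun _ => ℕ) 0 (fun i r => r + gap (t.m i) l) i

theorem off_succ (l : ℕ) (i : Fin t.len) :
    t.off l i.succ = t.off l i.castSucc + gap (t.m i) l := rfl

theorem off_mono (l : ℕ) : Monotone (t.off l) :=
  Fin.monotone_iff_le_succ.2 fun i => by rw [off_succ]; omega

/-- The `l`-dimensional cell in position `c` belongs to the `i`-th globe. -/
def Top (i : Fin (t.len + 1)) (l c : ℕ) : Prop :=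
  (l ≤ t.n i ∧ c = t.off l i) ∨ (l < t.n i ∧ c = t.off l i + 1)

/-- The `l`-dimensional cell in position `c` belongs to the globe along which the `k`-th and the
`(k+1)`-st globe are glued. -/
def Bot (k : Fin t.len) (l c : ℕ) : Prop :=
  (l < t.m k ∧ c = t.off l k.castSucc) ∨ (l ≤ t.m k ∧ c = t.off l k.castSucc + 1)

theorem bot_iff (k : Fin t.len) (l c : ℕ) :
    t.Bot k l c ↔ t.Top k.castSucc l c ∧ t.Top k.succ l c := by
  have h1 := t.lt_left k
  have h2 := t.lt_right k
  unfold Bot Top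
  rw [off_succ, gap]
  split_ifs <;> omega

theorem off_eq_of_lt {k l : ℕ} (hkl : k < l) {i j : Fin (t.len + 1)} (hij : i ≤ j)
    (h : t.off l j ≤ t.off l i + 1) : t.off k i = t.off k j := by
  revert h
  refine Fin.le_induction_succ (p := fun i j => t.off l j ≤ t.off l i + 1 →
    t.off k i = t.off k j) (fun _ _ => rfl) (fun i r hir ih h => ?_) hij
  have hm := t.off_mono l hir
  rw [off_succ] at h
  rw [ih (by omega), off_succ]
  unfold gap at h ⊢
  split_ifs at h ⊢ <;> omega

/-- The `k`-dimensional faces of a cell of dimension `l > k` have the same position in every globe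
which contains this cell. -/
theorem off_eq {k l c : ℕ} (hkl : k < l) {i j : Fin (t.len + 1)} (hi : t.Top i l c)
    (hj : t.Top j l c) : t.off k i = t.off k j := by
  unfold Top at hi hj
  rcases le_total i j with h | h
  · exact t.off_eq_of_lt hkl h (by omega)
  · exact (t.off_eq_of_lt hkl h (by omega)).symm

/-- The globes which contain a given cell form an interval. -/
theorem top_of_le_of_le {l c : ℕ} {i j k : Fin (t.len + 1)} (hij : i ≤ j) (hjk : j ≤ k)
    (hi : t.Top i l c) (hk : t.Top k l c) : t.Top j l c := by
  rcases hij.lt_or_eq with hij' | rfl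
  · obtain ⟨r, rfl⟩ := Fin.exists_succ_eq.2 (Fin.ne_zero_of_lt hij')
    have h1 := t.off_mono l (Fin.le_castSucc_iff.2 hij')
    have h2 := t.off_mono l hjk
    have h3 := t.lt_right r
    unfold Top at hi hk ⊢
    rw [off_succ] at h2 ⊢
    unfold gap at h2 ⊢
    split_ifs at h2 ⊢ <;> omega
  · exact hi

end GlobTable

namespace OmegaGraph

/-- The face of dimension `l ≤ n` of an `n`-cell; it is the cell itself if `l = n`. -/
def faceLE (Y : OmegaGraph) (ε : Bool) {l n : ℕ} (h : l ≤ n) (y : Y.cells n) : Y.cells l :=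
  if h' : l < n then Y.face ε h' y else cast (by rw [le_antisymm h (not_lt.1 h')]) y

theorem faceLE_of_lt (Y : OmegaGraph) (ε : Bool) {l n : ℕ} (h : l < n) (y : Y.cells n) :
    Y.faceLE ε h.le y = Y.face ε h y := dif_pos h

theorem faceLE_self (Y : OmegaGraph) (ε : Bool) {n : ℕ} (y : Y.cells n) :
    Y.faceLE ε le_rfl y = y := by simp [faceLE]

theorem face_faceLE (Y : OmegaGraph) (ε δ : Bool) {k l n : ℕ} (h : k < l) (h' : l ≤ n)
    (y : Y.cells n) : Y.face ε h (Y.faceLE δ h' y) = Y.face ε (h.trans_le h') y := by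
  rcases h'.lt_or_eq with h' | rfl
  · rw [faceLE_of_lt _ _ h', face_face]
  · rw [faceLE_self]

end OmegaGraph

namespace GlobTable

variable (t : GlobTable ℕ)

/-- The globular sum attached to a table of dimensions; an `l`-cell is the position of a cell which
belongs to some globe. -/
noncomputable def graph : OmegaGraph where
  cells l := { c : ℕ // ∃ i, t.Top i l c }
  face ε k l h c := ⟨t.off k c.2.choose + ε.toNat, c.2.choose, by
    have := c.2.choose_spec
    unfold Top at this ⊢
    cases ε <;> simp <;> omega⟩
  face_face ε δ j k l h h' x := by
    refine Subtype.ext (congrArg (· + ε.toNat) ?_)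
    have h1 := x.2.choose_spec
    refine t.off_eq h (c := t.off k x.2.choose + δ.toNat)
      (Exists.choose_spec (p := fun i => t.Top i k (t.off k x.2.choose + δ.toNat)) _) ?_
    unfold Top at h1 ⊢
    cases δ <;> simp <;> omega

theorem graph_face_val (ε : Bool) {k l : ℕ} (h : k < l) (c : t.graph.cells l)
    {i : Fin (t.len + 1)} (hi : t.Top i l c.1) :
    (t.graph.face ε h c).1 = t.off k i + ε.toNat :=
  congrArg (· + ε.toNat) (t.off_eq h c.2.choose_spec hi)

theorem top_self (i : Fin (t.len + 1)) : t.Top i (t.n i) (t.off (t.n i) i) :=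
  .inl ⟨le_rfl, rfl⟩

/-- The top cells of the globes of the globular sum attached to a table of dimensions. -/
def graphTop (i : Fin (t.len + 1)) : t.graph.cells (t.n i) := ⟨_, i, t.top_self i⟩

theorem graph_cells_cases {l : ℕ} (c : t.graph.cells l) :
    ∃ (i : Fin (t.len + 1)) (h : l ≤ t.n i) (ε : Bool),
      c = t.graph.faceLE ε h (t.graphTop i) := by
  obtain ⟨c, i, ⟨h, rfl⟩ | ⟨h, rfl⟩⟩ := c
  · refine ⟨i, h, false, ?_⟩
    rcases h.lt_or_eq with h | rfl
    · rw [OmegaGraph.faceLE_of_lt _ _ h]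
      exact Subtype.ext (t.graph_face_val false h (t.graphTop i) (t.top_self i)).symm
    · rw [OmegaGraph.faceLE_self]
      rfl
  · refine ⟨i, h.le, true, ?_⟩
    rw [OmegaGraph.faceLE_of_lt _ _ h]
    exact Subtype.ext (t.graph_face_val true h (t.graphTop i) (t.top_self i)).symm

section Desc

variable {t} {Y : OmegaGraph} {y : ∀ i, Y.cells (t.n i)}

theorem face_eq_face_succ
    (hy : ∀ i, Y.face true (t.lt_left i) (y i.castSucc) = Y.face false (t.lt_right i) (y i.succ))
    (k : Fin t.len) {l : ℕ} (h : l < t.m k) (ε : Bool) :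
    Y.face ε (h.trans (t.lt_left k)) (y k.castSucc) =
      Y.face ε (h.trans (t.lt_right k)) (y k.succ) := by
  rw [← Y.face_face ε true h (t.lt_left k), hy, Y.face_face]

/-- Compatible cells have the same `l`-dimensional sources and targets on all globes whose sources
have the same position. -/
theorem faceLE_eq_of_off_eq
    (hy : ∀ i, Y.face true (t.lt_left i) (y i.castSucc) = Y.face false (t.lt_right i) (y i.succ))
    {l : ℕ} {i j : Fin (t.len + 1)} (hij : i ≤ j) (hi : l ≤ t.n i)
    (hj : l ≤ t.n j) (h : t.off l i = t.off l j) (ε : Bool) :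
    Y.faceLE ε hi (y i) = Y.faceLE ε hj (y j) := by
  revert hi hj h
  refine Fin.le_induction_succ (p := fun i j => ∀ (hi : l ≤ t.n i) (hj : l ≤ t.n j),
    t.off l i = t.off l j → Y.faceLE ε hi (y i) = Y.faceLE ε hj (y j))
    (fun _ _ _ _ => rfl) (fun i k hik ih hi hj h => ?_) hij
  have hm := t.off_mono l hik
  rw [off_succ] at h
  have hl : l < t.m k := by
    unfold gap at h
    split_ifs at h <;> omega
  rw [ih hi (hl.trans (t.lt_left k)).le (by omega),
    Y.faceLE_of_lt _ (hl.trans (t.lt_left k)), Y.faceLE_of_lt _ (hl.trans (t.lt_right k)),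
    face_eq_face_succ hy k hl]

/-- The `l`-dimensional target of a compatible cell is the source of any other one whose position is
the next. -/
theorem faceLE_eq_of_off_succ_eq
    (hy : ∀ i, Y.face true (t.lt_left i) (y i.castSucc) = Y.face false (t.lt_right i) (y i.succ))
    {l : ℕ} {i j : Fin (t.len + 1)} (hij : i ≤ j) (hi : l ≤ t.n i)
    (hj : l ≤ t.n j) (h : t.off l i + 1 = t.off l j) :
    Y.faceLE true hi (y i) = Y.faceLE false hj (y j) := by
  revert hi hj h
  refine Fin.le_induction_succ (p := fun i j => ∀ (hi : l ≤ t.n i) (hj : l ≤ t.n j),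
    t.off l i + 1 = t.off l j → Y.faceLE true hi (y i) = Y.faceLE false hj (y j))
    (fun _ _ _ h => by omega) (fun i k hik ih hi hj h => ?_) hij
  have hm := t.off_mono l hik
  rw [off_succ] at h
  unfold gap at h
  split_ifs at h with h1 h2
  · rw [ih hi (h1.trans (t.lt_left k)).le h, Y.faceLE_of_lt _ (h1.trans (t.lt_left k)),
      Y.faceLE_of_lt _ (h1.trans (t.lt_right k)), face_eq_face_succ hy k h1]
  · subst h2
    rw [faceLE_eq_of_off_eq hy hik hi (t.lt_left k).le (by omega),
      Y.faceLE_of_lt _ (t.lt_left k), Y.faceLE_of_lt _ (t.lt_right k), hy]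
  · omega

/-- The value at a cell of the globular sum of the morphism determined by compatible cells of
`Y`. -/
theorem exists_value
    (hy : ∀ i, Y.face true (t.lt_left i) (y i.castSucc) = Y.face false (t.lt_right i) (y i.succ))
    {l : ℕ} (c : t.graph.cells l) : ∃ z : Y.cells l,
    ∀ (i : Fin (t.len + 1)) (h : l ≤ t.n i), (c.1 = t.off l i → z = Y.faceLE false h (y i)) ∧
      (l < t.n i → c.1 = t.off l i + 1 → z = Y.faceLE true h (y i)) := by
  obtain ⟨c, j, ⟨hj, rfl⟩ | ⟨hj, rfl⟩⟩ := c
  · refine ⟨Y.faceLE false hj (y j), fun i hi => ⟨fun h => ?_, fun _ h => ?_⟩⟩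
    · dsimp only at h
      rcases le_total i j with hij | hij
      · exact (faceLE_eq_of_off_eq hy hij hi hj h.symm _).symm
      · exact faceLE_eq_of_off_eq hy hij hj hi h _
    · dsimp only at h
      rcases le_total i j with hij | hij
      · exact (faceLE_eq_of_off_succ_eq hy hij hi hj h.symm).symm
      · have := t.off_mono l hij
        omega
  · refine ⟨Y.faceLE true hj.le (y j), fun i hi => ⟨fun h => ?_, fun _ h => ?_⟩⟩
    · dsimp only at h
      rcases le_total i j with hij | hij
      · have := t.off_mono l hij
        omega
      · exact faceLE_eq_of_off_succ_eq hy hij hj.le hi h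
    · dsimp only at h
      rcases le_total i j with hij | hij
      · exact (faceLE_eq_of_off_eq hy hij hi hj.le (by omega) _).symm
      · exact faceLE_eq_of_off_eq hy hij hj.le hi (by omega) _

end Desc

/-- The ω-graph of positions is the globular sum of its table. -/
theorem isGlobularSum_graph : IsGlobularSum t t.graph t.graphTop := by
  refine ⟨fun k => Subtype.ext ?_, fun Y y hy => ?_⟩
  · rw [t.graph_face_val _ _ _ (t.top_self _), t.graph_face_val _ _ _ (t.top_self _), off_succ]
    simp [gap]
  · choose φ hφ using fun l => exists_value hy (l := l)
    have hface : ∀ (i) (l) (h : l ≤ t.n i) (ε),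
        φ l (t.graph.faceLE ε h (t.graphTop i)) = Y.faceLE ε h (y i) := by
      intro i l h ε
      rcases h.lt_or_eq with h' | rfl
      · have hv := t.graph_face_val ε h' (t.graphTop i) (t.top_self i)
        rw [OmegaGraph.faceLE_of_lt _ _ h']
        cases ε
        · exact (hφ l _ i h).1 hv
        · exact (hφ l _ i h).2 h' hv
      · rw [OmegaGraph.faceLE_self, (hφ _ _ i le_rfl).1 rfl, Y.faceLE_self, Y.faceLE_self]
    refine ⟨⟨φ, ?_⟩, ?_, ?_⟩
    · intro ε k l h c
      obtain ⟨i, hi, δ, rfl⟩ := t.graph_cells_cases c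
      rw [OmegaGraph.face_faceLE, hface, OmegaGraph.face_faceLE,
        ← OmegaGraph.faceLE_of_lt, hface, OmegaGraph.faceLE_of_lt]
    · intro i
      have h := hface i _ le_rfl false
      rwa [OmegaGraph.faceLE_self, OmegaGraph.faceLE_self] at h
    · intro ψ hψ
      ext l c
      obtain ⟨i, hi, δ, rfl⟩ := t.graph_cells_cases c
      change ψ.app l _ = φ l _
      rw [hface]
      rcases hi.lt_or_eq with h | rfl
      · rw [OmegaGraph.faceLE_of_lt _ _ h, OmegaGraph.faceLE_of_lt _ _ h, ψ.app_face, hψ]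
      · rw [OmegaGraph.faceLE_self, OmegaGraph.faceLE_self, hψ]

end GlobTable

namespace IsGlobularSum

variable {t : GlobTable ℕ} {X : OmegaGraph} {x : ∀ i, X.cells (t.n i)}

theorem hom_ext (hx : IsGlobularSum t X x) {Y : OmegaGraph} {φ ψ : X.Hom Y}
    (h : ∀ i, φ.app _ (x i) = ψ.app _ (x i)) : φ = ψ :=
  (hx.desc Y (fun i => ψ.app _ (x i)) (fun i => by
    rw [← ψ.app_face, ← ψ.app_face, hx.glue])).unique h fun _ => rfl

/-- The position of a cell of a globular sum among the cells of the same dimension. -/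
theorem exists_code (hx : IsGlobularSum t X x) : ∃ code : ∀ l, X.cells l → ℕ,
    (∀ l, Function.Injective (code l)) ∧ (∀ i, code _ (x i) = t.off (t.n i) i) ∧
    (∀ i l (h : l < t.n i) (ε : Bool), code l (X.face ε h (x i)) = t.off l i + ε.toNat) ∧
    ∀ l (c : X.cells l), ∃ i, t.Top i l (code l c) := by
  obtain ⟨φ, hφ, -⟩ := hx.desc t.graph t.graphTop t.isGlobularSum_graph.glue
  obtain ⟨ψ, hψ, -⟩ := t.isGlobularSum_graph.desc X x hx.glue
  let χ : X.Hom X := ⟨fun n c => ψ.app n (φ.app n c), fun ε m n h c => by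
    rw [φ.app_face, ψ.app_face]⟩
  have hχ : χ = ⟨fun _ c => c, fun _ _ _ _ _ => rfl⟩ := hx.hom_ext fun i => by
    change ψ.app _ (φ.app _ (x i)) = x i
    rw [hφ, hψ]
  have hχ' : ∀ l c, ψ.app l (φ.app l c) = c := fun l c => congrArg (fun k => k.app l c) hχ
  refine ⟨fun l c => (φ.app l c).1, fun l c c' h => ?_, fun i => ?_, fun i l h ε => ?_,
    fun l c => (φ.app l c).2⟩
  · rw [← hχ' l c, ← hχ' l c', Subtype.ext h]
  · exact congrArg Subtype.val (hφ i)
  · dsimp only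
    rw [φ.app_face, hφ, t.graph_face_val _ _ _ (t.top_self i)]

end IsGlobularSum

/-! ### Maps out of globular sums -/

namespace GlobTable

/-- The table of dimensions with all entries increased by `k`. -/
def add (t : GlobTable ℕ) (k : ℕ) : GlobTable ℕ where
  len := t.len
  n i := t.n i + k
  m i := t.m i + k
  lt_left i := Nat.add_lt_add_right (t.lt_left i) k
  lt_right i := Nat.add_lt_add_right (t.lt_right i) k

/-- The table of the globular sum which consists of a single globe. -/
def single (n : ℕ) : GlobTable ℕ where
  len := 0
  n _ := n
  m := Fin.elim0
  lt_left i := i.elim0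
  lt_right i := i.elim0

/-- The table of integers with all entries decreased by `N`. -/
def toInt (t : GlobTable ℕ) (N : ℕ) : GlobTable ℤ where
  len := t.len
  n i := (t.n i : ℤ) - N
  m i := (t.m i : ℤ) - N
  lt_left i := by have := t.lt_left i; omega
  lt_right i := by have := t.lt_right i; omega

/-- Every table of integers is a shift of a table of natural numbers. -/
theorem exists_toInt (t : GlobTable ℤ) : ∃ (s : GlobTable ℕ) (N : ℕ), t = s.toInt N := by
  obtain ⟨N, hN⟩ := (Set.finite_range fun i => -t.m i).bddAbove
  obtain ⟨N', hN'⟩ := (Set.finite_range fun i => -t.n i).bddAbove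
  have hm : ∀ i, 0 ≤ t.m i + (max N N').toNat := fun i => by
    have := hN ⟨i, rfl⟩
    dsimp only at this
    omega
  have hn : ∀ i, 0 ≤ t.n i + (max N N').toNat := fun i => by
    have := hN' ⟨i, rfl⟩
    dsimp only at this
    omega
  refine ⟨⟨t.len, fun i => (t.n i + (max N N').toNat).toNat,
    fun i => (t.m i + (max N N').toNat).toNat, fun i => ?_, fun i => ?_⟩, (max N N').toNat, ?_⟩
  · have := t.lt_left i
    have := hm i
    have := hn i.castSucc
    omega
  · have := t.lt_right i
    have := hm i
    have := hn i.succ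
    omega
  · obtain ⟨len, n, m, h, h'⟩ := t
    simp only [toInt, mk.injEq, heq_eq_eq, true_and]
    exact ⟨funext fun i => by have := hn i; dsimp only at this; omega,
      funext fun i => by have := hm i; dsimp only at this; omega⟩

end GlobTable

theorem isGlobularSum_single_iff {n : ℕ} {X : OmegaGraph} {x : X.cells n} :
    IsGlobularSum (.single n) X (fun _ => x) ↔
      ∀ (Y : OmegaGraph) (y : Y.cells n), ∃! φ : X.Hom Y, φ.app n x = y := by
  constructor
  · intro h Y y
    obtain ⟨φ, hφ, hφ'⟩ := h.desc Y (fun _ => y) fun i => i.elim0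
    exact ⟨φ, hφ 0, fun ψ hψ => hφ' ψ fun _ => hψ⟩
  · refine fun h => ⟨fun i => i.elim0, fun Y y _ => ?_⟩
    obtain ⟨φ, hφ, hφ'⟩ := h Y (y 0)
    refine ⟨φ, fun i => ?_, fun ψ hψ => hφ' ψ (hψ 0)⟩
    obtain rfl : i = 0 := Fin.fin_one_eq_zero i
    exact hφ

namespace Theta

/-- The image of a cell under an iterated suspension. -/
def up {S : Theta} : ∀ k : ℕ, S.cat.carrier → ((iter susp k).obj S).cat.carrier
  | 0, c => c
  | k + 1, c => .cell (up k c)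

/-- The image of a cell of the generating ω-graph under an iterated suspension. -/
def upCell {S : Theta} {n : ℕ} : ∀ k : ℕ, S.graph.cells n →
    ((iter susp k).obj S).graph.cells (n + k)
  | 0, x => x
  | k + 1, x => upCell k x

theorem gen_upCell {S : Theta} {n : ℕ} (k : ℕ) (x : S.graph.cells n) :
    (((iter susp k).obj S).gen.app (n + k) (upCell k x)).1 = up k (S.gen.app n x).1 := by
  induction k with
  | zero => rfl
  | succ k ih => exact congrArg Susp.cell ih

theorem isGlobularSum_iter {S : Theta} {t : GlobTable ℕ} {x : ∀ i, S.graph.cells (t.n i)}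
    (hx : IsGlobularSum t S.graph x) (k : ℕ) :
    IsGlobularSum (t.add k) ((iter susp k).obj S).graph (fun i => upCell k (x i)) := by
  induction k with
  | zero => exact hx
  | succ k ih => exact isGlobularSum_susp ih

/-- Morphisms out of the free ω-category on a globular sum are families of cells, one for each
globe, with matching boundaries. -/
theorem existsUnique_hom {S : Theta} {t : GlobTable ℕ} {x : ∀ i, S.graph.cells (t.n i)}
    (hx : IsGlobularSum t S.graph x) (D : StrictOmegaCat.{0}) (d : Fin (t.len + 1) → D.carrier)
    (hd : ∀ i, D.bd false (t.n i) (d i) = d i)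
    (h : ∀ i, D.bd true (t.m i) (d i.castSucc) = D.bd false (t.m i) (d i.succ)) :
    ∃! F : S.cat ⟶ D, ∀ i, StrictOmegaCat.fn F (S.gen.app _ (x i)).1 = d i := by
  obtain ⟨φ, hφ, -⟩ := hx.desc D.graph (fun i => ⟨d i, hd i⟩) fun i => Subtype.ext (h i)
  obtain ⟨F, hF, hF'⟩ := S.free D φ
  refine ⟨F, fun i => by rw [hF, hφ], fun G hG => hF' G fun n c => ?_⟩
  let ψ : S.graph.Hom D.graph :=
    { app := fun n c => ⟨StrictOmegaCat.fn G (S.gen.app n c).1, by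
        rw [StrictOmegaCat.fn, ← StrictOmegaCat.Hom.map_bd, (S.gen.app n c).2]⟩
      app_face := fun ε m n h c => Subtype.ext (by
        change StrictOmegaCat.fn G _ = D.bd ε m (StrictOmegaCat.fn G _)
        rw [gen_face]
        exact StrictOmegaCat.Hom.map_bd G _ _ _) }
  have hψ : ψ = φ := hx.hom_ext fun i => by
    rw [hφ]
    exact Subtype.ext (hG i)
  rw [← hψ]

theorem hom_ext_of_isGlobularSum {S T : Theta} {t : GlobTable ℕ} {x : ∀ i, S.graph.cells (t.n i)}
    (hx : IsGlobularSum t S.graph x) {f g : S ⟶ T}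
    (h : ∀ i, fn f (S.gen.app _ (x i)).1 = fn g (S.gen.app _ (x i)).1) : f = g := by
  have hbd : ∀ (ε : Bool) (n : ℕ) (c : S.cat.carrier), fn g (S.cat.bd ε n c) =
    T.cat.bd ε n (fn g c) := StrictOmegaCat.Hom.map_bd g
  refine (existsUnique_hom hx T.cat (fun i => fn g (S.gen.app _ (x i)).1) (fun i => ?_)
    fun i => ?_).unique h fun _ => rfl
  · rw [← hbd, (S.gen.app _ (x i)).2]
  · rw [← hbd, ← hbd, ← gen_face _ _ (t.lt_left i), hx.glue, gen_face]

theorem exists_iter_hom {S T : Theta} {t : GlobTable ℕ} {x : ∀ i, S.graph.cells (t.n i)}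
    (hx : IsGlobularSum t S.graph x) (k : ℕ) (d : Fin (t.len + 1) → T.cat.carrier)
    (hd : ∀ i, T.cat.bd false (t.n i + k) (d i) = d i)
    (h : ∀ i, T.cat.bd true (t.m i + k) (d i.castSucc) =
      T.cat.bd false (t.m i + k) (d i.succ)) :
    ∃ f : (iter susp k).obj S ⟶ T, ∀ i, fn f (up k (S.gen.app _ (x i)).1) = d i := by
  obtain ⟨F, hF, -⟩ := existsUnique_hom (isGlobularSum_iter hx k) T.cat d hd h
  exact ⟨F, fun i => (congrArg (StrictOmegaCat.fn F) (gen_upCell k (x i))).symm.trans (hF i)⟩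

theorem iter_hom_ext {S T : Theta} {t : GlobTable ℕ} {x : ∀ i, S.graph.cells (t.n i)}
    (hx : IsGlobularSum t S.graph x) (k : ℕ) {f g : (iter susp k).obj S ⟶ T}
    (h : ∀ i, fn f (up k (S.gen.app _ (x i)).1) = fn g (up k (S.gen.app _ (x i)).1)) : f = g :=
  hom_ext_of_isGlobularSum (isGlobularSum_iter hx k) fun i =>
    (congrArg (fn f) (gen_upCell k (x i))).trans
      ((h i).trans (congrArg (fn g) (gen_upCell k (x i))).symm)

/-- The generating cell of maximal dimension of a globe. -/
def topCell : ∀ n : ℕ, (globe n).graph.cells n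
  | 0 => ()
  | n + 1 => topCell n

theorem isGlobularSum_globe (n : ℕ) :
    IsGlobularSum (.single n) (globe n).graph (fun _ => topCell n) := by
  rw [isGlobularSum_single_iff]
  induction n with
  | zero =>
    intro Y y
    refine ⟨⟨fun n x => match n, x with
      | 0, _ => y
      | _ + 1, x => Empty.elim x, ?_⟩, rfl, ?_⟩
    · intro ε m n h x
      obtain _ | n := n
      · omega
      · exact Empty.elim x
    · intro ψ hψ
      ext n x
      obtain _ | n := n
      · exact hψ
      · exact Empty.elim x
  | succ n ih =>
    intro Y y
    obtain ⟨φ, hφ, hφ'⟩ := (isGlobularSum_susp (isGlobularSum_single_iff.2 ih)).desc Y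
      (fun _ => y) fun i => i.elim0
    exact ⟨φ, hφ 0, fun ψ hψ => hφ' ψ fun _ => hψ⟩

theorem fn_face (ε : Bool) : ∀ (m n : ℕ) (h : m < n),
    fn (face ε m n h) ((globe m).gen.app m (topCell m)).1 =
      (globe n).cat.bd ε m ((globe n).gen.app n (topCell n)).1
  | 0, _ + 1, _ => rfl
  | m + 1, n + 1, h => congrArg Susp.cell (fn_face ε m n (Nat.lt_of_succ_lt_succ h))

end Theta

/-! ### Maps out of stable globes -/

namespace ThetaZ

theorem stage_globe (l : ℤ) : (globe l).stage = (-l).toNat := by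
  rcases l with n | n
  · change 0 = (-(n : ℤ)).toNat
    omega
  · rfl

/-- The generating cell of maximal dimension of a stable globe. -/
def topCell : ∀ l : ℤ, (globe l).obj.graph.cells l.toNat
  | .ofNat n => Theta.topCell n
  | .negSucc _ => Theta.topCell 0

theorem isGlobularSum_globe : ∀ l : ℤ,
    IsGlobularSum (.single l.toNat) (globe l).obj.graph (fun _ => topCell l)
  | .ofNat n => Theta.isGlobularSum_globe n
  | .negSucc _ => Theta.isGlobularSum_globe 0

/-- The generator of maximal dimension `l.toNat + a` of the `a`-fold suspension of the globe which
defines the stable globe of dimension `l`. -/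
def top (l : ℤ) (a : ℕ) : ((iter Theta.susp a).obj (globe l).obj).cat.carrier :=
  Theta.up a ((globe l).obj.gen.app _ (topCell l)).1

theorem gen_topCell (l : ℤ) (a : ℕ) : (((iter Theta.susp a).obj (globe l).obj).gen.app _
    (Theta.upCell a (topCell l))).1 = top l a :=
  Theta.gen_upCell a _

theorem bd_top (l : ℤ) (a : ℕ) :
    ((iter Theta.susp a).obj (globe l).obj).cat.bd false (l.toNat + a) (top l a) = top l a := by
  rw [← gen_topCell]
  exact (((iter Theta.susp a).obj (globe l).obj).gen.app _ _).2

/-- Morphisms out of a suspended globe are cells of the dimension of this globe. -/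
theorem existsUnique_top (l : ℤ) (a : ℕ) {S : Theta} {c : S.cat.carrier}
    (hc : S.cat.bd false (l.toNat + a) c = c) :
    ∃! f : (iter Theta.susp a).obj (globe l).obj ⟶ S, Theta.fn f (top l a) = c := by
  obtain ⟨F, hF, hF'⟩ := Theta.existsUnique_hom
    (Theta.isGlobularSum_iter (isGlobularSum_globe l) a) S.cat (fun _ => c) (fun _ => hc)
    fun i => i.elim0
  exact ⟨F, (congrArg (StrictOmegaCat.fn F) (gen_topCell l a)).symm.trans (hF 0), fun G hG =>
    hF' G fun _ => (congrArg (StrictOmegaCat.fn G) (gen_topCell l a)).trans hG⟩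

theorem bd_fn_top {l : ℤ} {a : ℕ} {S : Theta} (f : (iter Theta.susp a).obj (globe l).obj ⟶ S) :
    S.cat.bd false (l.toNat + a) (Theta.fn f (top l a)) = Theta.fn f (top l a) :=
  (StrictOmegaCat.Hom.map_bd f _ _ _).symm.trans (congrArg (Theta.fn f) (bd_top l a))

theorem hom_ext_top {l : ℤ} {a : ℕ} {S : Theta} {f g : (iter Theta.susp a).obj (globe l).obj ⟶ S}
    (h : Theta.fn f (top l a) = Theta.fn g (top l a)) : f = g :=
  (existsUnique_top l a (bd_fn_top g)).unique h rfl

/-- A morphism from a suspended globe is inert if and only if the image of the top cell is a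
generator. -/
theorem inert_iff_isGen {l : ℤ} {a : ℕ} {S : Theta}
    (f : (iter Theta.susp a).obj (globe l).obj ⟶ S) :
    Theta.inert f ↔ S.IsGen (l.toNat + a) (Theta.fn f (top l a)) := by
  constructor
  · intro h
    exact Theta.isGen_map h ⟨_, gen_topCell l a⟩
  · rintro ⟨y, hy⟩
    obtain ⟨φ, hφ, -⟩ := (Theta.isGlobularSum_iter (isGlobularSum_globe l) a).desc S.graph
      (fun _ => y) fun i => i.elim0
    obtain ⟨F, hF, -⟩ := ((iter Theta.susp a).obj (globe l).obj).free S.cat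
      ⟨fun n c => S.gen.app n (φ.app n c), fun ε m n h c => by rw [φ.app_face, S.gen.app_face]⟩
    have hfF : f = F := hom_ext_top (by
      rw [← hy, ← gen_topCell]
      refine Eq.symm ((hF _ _).trans ?_)
      exact congrArg (fun z => (S.gen.app _ z).1) (hφ 0))
    subst hfF
    exact ⟨φ, hF⟩

/-- The morphism `f` from a stable globe to `A` corresponds to the cell `c` of the `b`-th
suspension of `A`: it has a representative which sends the generator of maximal dimension
to `c`. -/
def Picks {l : ℤ} {A : ThetaZ} (b : ℕ) (f : globe l ⟶ A)
    (c : ((iter Theta.susp b).obj A.obj).cat.carrier) : Prop :=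
  ∃ (a : ℕ) (f' : (iter Theta.susp a).obj (globe l).obj ⟶ (iter Theta.susp b).obj A.obj),
    SeqColim.Represents a b f' f ∧ Theta.fn f' (top l a) = c

theorem exists_picks {l : ℤ} {A : ThetaZ} (f : globe l ⟶ A) :
    ∃ b₀, ∀ b, b₀ ≤ b → ∃ c, Picks b f c := by
  obtain ⟨b₀, h⟩ := SeqColim.exists_represents f
  refine ⟨b₀, fun b hb => ?_⟩
  obtain ⟨a, f', hf⟩ := h b hb
  exact ⟨_, a, f', hf, rfl⟩

theorem exists_hom_picks {l : ℤ} {A : ThetaZ} {b D : ℕ} (hD : (D : ℤ) = l + A.stage + b)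
    {c : ((iter Theta.susp b).obj A.obj).cat.carrier}
    (hc : ((iter Theta.susp b).obj A.obj).cat.bd false D c = c) :
    ∃ f : globe l ⟶ A, Picks b f c := by
  have hs := stage_globe l
  obtain rfl : D = l.toNat + (A.stage + b - (-l).toNat) := by omega
  obtain ⟨f', hf, -⟩ := existsUnique_top l _ hc
  exact ⟨Quot.mk _ ⟨_, b, by omega, f'⟩, _, f', ⟨_, rfl⟩, hf⟩

namespace Picks

variable {l : ℤ} {A : ThetaZ} {b : ℕ} {f : globe l ⟶ A}
  {c : ((iter Theta.susp b).obj A.obj).cat.carrier}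

theorem cell_unique {c' : ((iter Theta.susp b).obj A.obj).cat.carrier} (h : Picks b f c)
    (h' : Picks b f c') : c = c' := by
  obtain ⟨a, f₁, h₁, rfl⟩ := h
  obtain ⟨a', f₂, h₂, rfl⟩ := h'
  obtain rfl : a = a' := by
    have := h₁.stage_eq
    have := h₂.stage_eq
    omega
  rw [h₁.hom_unique h₂]

theorem hom_unique {g : globe l ⟶ A} (h : Picks b f c) (h' : Picks b g c) : f = g := by
  obtain ⟨a, f₁, h₁, rfl⟩ := h
  obtain ⟨a', f₂, h₂, h⟩ := h'
  obtain rfl : a = a' := by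
    have := h₁.stage_eq
    have := h₂.stage_eq
    omega
  obtain rfl := hom_ext_top h
  exact h₁.unique h₂

theorem congr {g : globe l ⟶ A} (h : Picks b f c) (hfg : f = g) : Picks b g c := hfg ▸ h

theorem next (h : Picks b f c) : Picks (b + 1) f (.cell c) := by
  obtain ⟨a, f', h, rfl⟩ := h
  exact ⟨a + 1, _, h.next, rfl⟩

theorem up {c : A.obj.cat.carrier} (h : Picks 0 f c) (k : ℕ) : Picks k f (Theta.up k c) := by
  induction k with
  | zero => exact h
  | succ k ih => exact ih.next

theorem comp {B : ThetaZ} {b' : ℕ} {g : A ⟶ B}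
    {g' : (iter Theta.susp b).obj A.obj ⟶ (iter Theta.susp b').obj B.obj} (h : Picks b f c)
    (hg : SeqColim.Represents b b' g' g) : Picks b' (f ≫ g) (Theta.fn g' c) := by
  obtain ⟨a, f', h, rfl⟩ := h
  exact ⟨a, _, h.comp hg, rfl⟩

/-- The cell picked by a morphism from the stable globe of dimension `l` has dimension
`l + A.stage + b`; in particular this integer is not negative. -/
theorem dim_eq (h : Picks b f c) : ∃ D : ℕ, (D : ℤ) = l + A.stage + b := by
  obtain ⟨a, f', h, -⟩ := h
  have h1 := h.stage_eq
  rw [stage_globe] at h1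
  exact ⟨l.toNat + a, by omega⟩

theorem bd_eq (h : Picks b f c) {D : ℕ} (hD : (D : ℤ) = l + A.stage + b) :
    ((iter Theta.susp b).obj A.obj).cat.bd false D c = c := by
  obtain ⟨a, f', h, rfl⟩ := h
  have h1 := h.stage_eq
  rw [stage_globe] at h1
  obtain rfl : D = l.toNat + a := by omega
  exact bd_fn_top f'

/-- A morphism from a stable globe is inert if and only if it picks a generator. -/
theorem inert_iff (h : Picks b f c) {D : ℕ} (hD : (D : ℤ) = l + A.stage + b) :
    inert f ↔ ((iter Theta.susp b).obj A.obj).IsGen D c := by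
  obtain ⟨a, f', h, rfl⟩ := h
  have h1 := h.stage_eq
  rw [stage_globe] at h1
  obtain rfl : D = l.toNat + a := by omega
  rw [ThetaZ.inert_iff h, inert_iff_isGen]

end Picks

theorem picks_id (l : ℤ) (a : ℕ) : Picks a (𝟙 (globe l)) (top l a) :=
  ⟨a, 𝟙 _, .id _ a, rfl⟩

/-- The face inclusions of stable globes pick faces of the top cell. They are defined at the first
stage where source and target both exist; either this is the stage of the target, or the source is
a point there. -/
theorem exists_picks_face (ε : Bool) : ∀ (m n : ℤ) (h : m < n),
    ∃ a D : ℕ, (D : ℤ) = m + (globe n).stage + a ∧ (a = 0 ∨ D = 0) ∧ Picks a (face ε m n h)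
      (((iter Theta.susp a).obj (globe n).obj).cat.bd ε D (top n a))
  | .ofNat m, .ofNat n, h =>
    ⟨0, m, rfl, .inl rfl, 0, Theta.face ε m n (Int.ofNat_lt.1 h), ⟨rfl, rfl⟩,
      Theta.fn_face ε m n (Int.ofNat_lt.1 h)⟩
  | .negSucc m, .ofNat n, _ =>
    ⟨m + 1, 0, by change (0 : ℤ) = Int.negSucc m + (0 : ℕ) + (m + 1 : ℕ); omega, .inr rfl,
      0, _, ⟨_, rfl⟩, rfl⟩
  | .negSucc m, .negSucc n, h =>
    ⟨(m - n - 1) + 1, 0, by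
      change (0 : ℤ) = Int.negSucc m + (n + 1 : ℕ) + (m - n - 1 + 1 : ℕ)
      omega, .inr rfl, 0, _, ⟨_, rfl⟩, rfl⟩
  | .ofNat m, .negSucc n, h =>
    absurd h (not_lt_of_gt ((Int.negSucc_lt_zero n).trans_le (Int.natCast_nonneg m)))

theorem picks_face (ε : Bool) {m n : ℤ} (h : m < n) {a D : ℕ}
    (hD : (D : ℤ) = m + (globe n).stage + a) : Picks a (face ε m n h)
      (((iter Theta.susp a).obj (globe n).obj).cat.bd ε D (top n a)) := by
  obtain ⟨a₀, D₀, h₀, h₁, hp⟩ := exists_picks_face ε m n h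
  have key : ∀ k, Picks (a₀ + k) (face ε m n h)
      (((iter Theta.susp (a₀ + k)).obj (globe n).obj).cat.bd ε (D₀ + k) (top n (a₀ + k))) := by
    intro k
    induction k with
    | zero => exact hp
    | succ k ih => exact ih.next
  obtain ⟨k, rfl⟩ := Nat.exists_eq_add_of_le (show a₀ ≤ a by omega)
  obtain rfl : D = D₀ + k := by omega
  exact key k

theorem Picks.face_comp {l m : ℤ} {A : ThetaZ} {b : ℕ} {f : globe l ⟶ A}
    {c : ((iter Theta.susp b).obj A.obj).cat.carrier} (hf : Picks b f c) (ε : Bool) (h : m < l)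
    {D : ℕ} (hD : (D : ℤ) = m + A.stage + b) :
    Picks b (face ε m l h ≫ f) (((iter Theta.susp b).obj A.obj).cat.bd ε D c) := by
  obtain ⟨a, f', hf, rfl⟩ := hf
  have h1 := hf.stage_eq
  have h2 := (picks_face ε h (a := a) (D := D) (by omega)).comp hf
  exact (StrictOmegaCat.Hom.map_bd f' ε D _ : Theta.fn f' _ = _) ▸ h2

end ThetaZ

/-! ### Existence and uniqueness of stable globular presentations -/

namespace ThetaZ

section Canonical

variable {S : Theta} {s : GlobTable ℕ} {x : ∀ i, S.graph.cells (s.n i)} {N : ℕ}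

/-- A morphism out of an object of `Θ_ℤ` which comes from a globular sum is determined by its
restrictions to the globes. -/
theorem hom_ext_of_picks (hx : IsGlobularSum s S.graph x) {U : ThetaZ}
    {leg : ∀ i, globe ((s.n i : ℤ) - N) ⟶ (⟨N, S⟩ : ThetaZ)}
    (hleg : ∀ i, Picks 0 (leg i) (S.gen.app _ (x i)).1) {f g : (⟨N, S⟩ : ThetaZ) ⟶ U}
    (h : ∀ i, leg i ≫ f = leg i ≫ g) : f = g := by
  obtain ⟨b₁, h₁⟩ := SeqColim.exists_represents f
  obtain ⟨b₂, h₂⟩ := SeqColim.exists_represents g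
  obtain ⟨k, f', hf⟩ := h₁ (max b₁ b₂) (le_max_left _ _)
  obtain ⟨k', g', hg⟩ := h₂ (max b₁ b₂) (le_max_right _ _)
  obtain rfl : k = k' := by
    have := hf.stage_eq
    have := hg.stage_eq
    omega
  suffices e : f' = g' by
    subst e
    exact hf.unique hg
  refine Theta.iter_hom_ext hx k fun i => ?_
  exact ((((hleg i).up k).comp hf).congr (h i)).cell_unique (((hleg i).up k).comp hg)

/-- Compatible morphisms from the globes of a globular sum extend to a morphism out of the
corresponding object of `Θ_ℤ`: they are all represented at a common stage, where the universal
property of the globular sum applies. -/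
theorem exists_hom_of_picks (hx : IsGlobularSum s S.graph x) {U : ThetaZ}
    {leg : ∀ i, globe ((s.n i : ℤ) - N) ⟶ (⟨N, S⟩ : ThetaZ)}
    (hleg : ∀ i, Picks 0 (leg i) (S.gen.app _ (x i)).1)
    (f : ∀ i, globe ((s.n i : ℤ) - N) ⟶ U)
    (hf : ∀ i, face true _ _ ((s.toInt N).lt_left i) ≫ f i.castSucc =
      face false _ _ ((s.toInt N).lt_right i) ≫ f i.succ) :
    ∃ g : (⟨N, S⟩ : ThetaZ) ⟶ U, ∀ i, leg i ≫ g = f i := by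
  choose b₀ hb₀ using fun i => exists_picks (f i)
  obtain ⟨b, hb⟩ := (Set.finite_range b₀).bddAbove
  choose d hd using fun i => hb₀ i (max b N) ((hb ⟨i, rfl⟩).trans (le_max_left _ _))
  obtain ⟨k, hk⟩ := Nat.exists_eq_add_of_le (show N ≤ U.stage + max b N by omega)
  obtain ⟨F, hF⟩ := Theta.exists_iter_hom hx k d
    (fun i => (hd i).bd_eq (by push_cast; omega))
    (fun i => by
      have h1 := (hd i.castSucc).face_comp true ((s.toInt N).lt_left i) (D := s.m i + k) (by
        change ((s.m i + k : ℕ) : ℤ) = ((s.m i : ℤ) - N) + _ + _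
        omega)
      have h2 := (hd i.succ).face_comp false ((s.toInt N).lt_right i) (D := s.m i + k) (by
        change ((s.m i + k : ℕ) : ℤ) = ((s.m i : ℤ) - N) + _ + _
        omega)
      exact (h1.congr (hf i)).cell_unique h2)
  have hr : SeqColim.Represents (F := Theta.susp) (A := ⟨N, S⟩) (B := U) k (max b N) F
    (Quot.mk _ ⟨k, max b N, hk.symm, F⟩) := ⟨_, rfl⟩
  refine ⟨_, fun i => (((hleg i).up k).comp hr).hom_unique ?_⟩
  exact (hF i).symm ▸ hd i

/-- An object of `Θ_ℤ` which comes from a globular sum has a presentation by the globes of this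
globular sum. -/
theorem exists_presentation (hx : IsGlobularSum s S.graph x) (N : ℕ) :
    ∃ P : Presentation ⟨N, S⟩ (s.toInt N), ∀ i,
      Picks (l := (s.n i : ℤ) - N) (A := ⟨N, S⟩) 0 (P.ι.app (.top i)) (S.gen.app _ (x i)).1 := by
  choose leg hleg using fun i => exists_hom_picks (l := (s.n i : ℤ) - N) (A := ⟨N, S⟩) (b := 0)
    (D := s.n i) (c := (S.gen.app _ (x i)).1) (by dsimp only; omega) (S.gen.app _ (x i)).2
  have hface : ∀ i, face true _ _ ((s.toInt N).lt_left i) ≫ leg i.castSucc =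
      face false _ _ ((s.toInt N).lt_right i) ≫ leg i.succ := fun i => by
    refine ((hleg i.castSucc).face_comp true ((s.toInt N).lt_left i) (D := s.m i) (by
      change ((s.m i : ℕ) : ℤ) = ((s.m i : ℤ) - N) + (N : ℕ) + (0 : ℕ)
      omega)).hom_unique ?_
    have h2 := (hleg i.succ).face_comp false ((s.toInt N).lt_right i) (D := s.m i) (by
      change ((s.m i : ℕ) : ℤ) = ((s.m i : ℤ) - N) + (N : ℕ) + (0 : ℕ)
      omega)
    have e := congrArg (fun z => (S.gen.app _ z).1) (hx.glue i)
    simp only [Theta.gen_face] at e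
    have e' : ((iter Theta.susp 0).obj S).cat.bd true (s.m i) (S.gen.app _ (x i.castSucc)).1 =
      ((iter Theta.susp 0).obj S).cat.bd false (s.m i) (S.gen.app _ (x i.succ)).1 := e
    exact e' ▸ h2
  let ι : zigzag (s.toInt N) ⟶ (Functor.const _).obj (⟨N, S⟩ : ThetaZ) :=
    { app := fun z => match z with
        | .top i => leg i
        | .bot i => face true _ _ ((s.toInt N).lt_left i) ≫ leg i.castSucc
      naturality := fun y z f => by
        change GlobZigzag.Hom y z at f
        cases f with
        | id z =>
          exact (Category.id_comp _).trans (Category.comp_id _).symm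
        | left i => exact (Category.comp_id _).symm
        | right i => exact (hface i).symm.trans (Category.comp_id _).symm }
  have hc : ∀ c : Cocone (zigzag (s.toInt N)), ∃ g : (⟨N, S⟩ : ThetaZ) ⟶ c.pt,
      ∀ i, leg i ≫ g = c.ι.app (.top i) := fun c =>
    exists_hom_of_picks hx hleg (fun i => c.ι.app (.top i)) fun i =>
      (c.w (GlobZigzag.Hom.left i : GlobZigzag.bot i ⟶ _)).trans
        (c.w (GlobZigzag.Hom.right i : GlobZigzag.bot i ⟶ _)).symm
  choose desc hdesc using hc
  refine ⟨⟨ι, ⟨desc, fun c z => ?_, fun c g hg => ?_⟩⟩, hleg⟩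
  · obtain i | i := z
    · exact hdesc c i
    · change (face true _ _ ((s.toInt N).lt_left i) ≫ leg i.castSucc) ≫ desc c = _
      refine (Category.assoc _ _ _).trans (Eq.trans (congrArg _ (hdesc c i.castSucc)) ?_)
      exact c.w (GlobZigzag.Hom.left i : GlobZigzag.bot i ⟶ _)
  · exact hom_ext_of_picks hx hleg fun i => (hg (.top i)).trans (hdesc c i).symm

end Canonical

/-! ### Inert morphisms from globes -/

/-- The generators of a suspended globe are its top cell and the faces of this cell. -/
theorem gen_globe_cases (n : ℤ) (a : ℕ) {D : ℕ}
    (y : ((iter Theta.susp a).obj (globe n).obj).graph.cells D) :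
    (D = n.toNat + a ∧ (((iter Theta.susp a).obj (globe n).obj).gen.app D y).1 = top n a) ∨
      ∃ ε : Bool, D < n.toNat + a ∧ (((iter Theta.susp a).obj (globe n).obj).gen.app D y).1 =
        ((iter Theta.susp a).obj (globe n).obj).cat.bd ε D (top n a) := by
  obtain ⟨code, hinj, htop, hface, hcode⟩ :=
    (Theta.isGlobularSum_iter (isGlobularSum_globe n) a).exists_code
  have h0 : ∀ D i, (GlobTable.add (.single n.toNat) a).off D i = 0 := fun D i => by
    obtain rfl : i = 0 := Fin.fin_one_eq_zero i
    rfl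
  simp only [h0, Nat.zero_add, GlobTable.Top] at htop hface hcode
  have hfaceCase : ∀ ε : Bool, D < n.toNat + a → code D y = ε.toNat →
      ∃ ε : Bool, D < n.toNat + a ∧ (((iter Theta.susp a).obj (globe n).obj).gen.app D y).1 =
        ((iter Theta.susp a).obj (globe n).obj).cat.bd ε D (top n a) := fun ε hD hε => by
    refine ⟨ε, hD, ?_⟩
    have e : y = ((iter Theta.susp a).obj (globe n).obj).graph.face ε hD
        (Theta.upCell a (topCell n)) := hinj D (hε.trans (hface 0 D hD ε).symm)
    rw [e, Theta.gen_face, gen_topCell]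
  obtain ⟨i, ⟨h, h'⟩ | ⟨h, h'⟩⟩ := hcode D y
  · change D ≤ n.toNat + a at h
    rcases h.lt_or_eq with h | rfl
    · exact .inr (hfaceCase false h h')
    · have e : y = Theta.upCell a (topCell n) := hinj _ (h'.trans (htop 0).symm)
      exact .inl ⟨rfl, by rw [e, gen_topCell]⟩
  · exact .inr (hfaceCase true h h')

/-- An inert morphism between stable globes is an identity or a face inclusion. -/
theorem eq_face_of_inert {l n : ℤ} (f : globe l ⟶ globe n) (hf : inert f) :
    (∃ h : l = n, f = eqToHom (congrArg globe h)) ∨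
      ∃ (ε : Bool) (h : l < n), f = face ε l n h := by
  obtain ⟨a, ha⟩ := exists_picks f
  obtain ⟨c, hc⟩ := ha a le_rfl
  obtain ⟨D, hD⟩ := hc.dim_eq
  obtain ⟨y, rfl⟩ := (hc.inert_iff hD).1 hf
  have hs := stage_globe n
  rcases gen_globe_cases n a y with ⟨h, h'⟩ | ⟨ε, h, h'⟩
  · obtain rfl : l = n := by omega
    refine .inl ⟨rfl, hc.hom_unique ?_⟩
    rw [eqToHom_refl, h']
    exact picks_id l a
  · refine .inr ⟨ε, by omega, hc.hom_unique ?_⟩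
    rw [h']
    exact picks_face ε _ hD

section Factor

variable {A : ThetaZ} {l n : ℤ} {b : ℕ} {e : globe l ⟶ A} {g : globe n ⟶ A} {L D : ℕ}
  {y : ((iter Theta.susp b).obj A.obj).graph.cells L}
  {z : ((iter Theta.susp b).obj A.obj).graph.cells D}

/-- An inert morphism `e` from a globe factors through another one, `g`, if and only if the cell
corresponding to `e` is a face of the cell corresponding to `g`. -/
theorem exists_inert_comp_eq_iff (hL : (L : ℤ) = l + A.stage + b) (hD : (D : ℤ) = n + A.stage + b)
    (he : Picks b e (((iter Theta.susp b).obj A.obj).gen.app _ y).1)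
    (hg : Picks b g (((iter Theta.susp b).obj A.obj).gen.app _ z).1) :
    (∃ f : globe l ⟶ globe n, inert f ∧ f ≫ g = e) ↔
      (L = D ∧ HEq y z) ∨ ∃ (ε : Bool) (h : L < D),
        y = ((iter Theta.susp b).obj A.obj).graph.face ε h z := by
  constructor
  · rintro ⟨f, hf, rfl⟩
    obtain ⟨rfl, rfl⟩ | ⟨ε, h, rfl⟩ := eq_face_of_inert f hf
    · obtain rfl : L = D := by omega
      rw [eqToHom_refl, Category.id_comp] at he
      exact .inl ⟨rfl, heq_of_eq (Theta.gen_injective _ (he.cell_unique hg))⟩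
    · refine .inr ⟨ε, by omega, Theta.gen_injective _ ?_⟩
      rw [Theta.gen_face]
      exact he.cell_unique (hg.face_comp ε h hL)
  · rintro (⟨rfl, h⟩ | ⟨ε, h, rfl⟩)
    · obtain rfl := eq_of_heq h
      obtain rfl : l = n := by omega
      exact ⟨𝟙 _, inert_id _, by rw [Category.id_comp, he.hom_unique hg]⟩
    · rw [Theta.gen_face] at he
      exact ⟨face ε l n (by omega), inert_face _ _ _ _,
        (hg.face_comp ε (by omega) hL).hom_unique he⟩

/-- An inert morphism from a globe factors in at most one way through another one if the source and
the target of the relevant dimension are different. -/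
theorem inert_comp_right_cancel (hD : (D : ℤ) = n + A.stage + b)
    (hL : (L : ℤ) = l + A.stage + b)
    (hg : Picks b g (((iter Theta.susp b).obj A.obj).gen.app _ z).1)
    (hz : ∀ h : L < D, ((iter Theta.susp b).obj A.obj).graph.face false h z ≠
      ((iter Theta.susp b).obj A.obj).graph.face true h z)
    {f f' : globe l ⟶ globe n} (hf : inert f) (hf' : inert f') (h : f ≫ g = f' ≫ g) : f = f' := by
  have key : ∀ h : l < n, face false l n h ≫ g ≠ face true l n h ≫ g := fun h e => by
    have h1 := hg.face_comp false h hL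
    have h2 := hg.face_comp true h hL
    rw [← Theta.gen_face _ _ (by omega)] at h1 h2
    rw [e] at h1
    exact hz (by omega) (Theta.gen_injective _ (h1.cell_unique h2))
  obtain ⟨rfl, rfl⟩ | ⟨ε, hln, rfl⟩ := eq_face_of_inert f hf
  · obtain ⟨-, rfl⟩ | ⟨ε, hln, rfl⟩ := eq_face_of_inert f' hf'
    · rfl
    · omega
  · obtain ⟨rfl, -⟩ | ⟨ε', hln, rfl⟩ := eq_face_of_inert f' hf'
    · omega
    · cases ε <;> cases ε'
      · rfl
      · exact absurd h (key _)
      · exact absurd h.symm (key _)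
      · rfl

end Factor

end ThetaZ

/-! ### Classifying spaces of zigzags -/

namespace SSet

open Simplicial

/-- The characteristic map of a simplex of a simplicial set. -/
noncomputable def charMap (K : SSet.{0}) {n : SimplexCategory} (σ : K.obj (op n)) :
    C(_root_.stdSimplex ℝ (Fin (n.len + 1)), SSet.toTop.obj K) :=
  TopCat.toSSetObjEquiv _ (op n) ((sSetTopAdj.unit.app K).app (op n) σ)

theorem charMap_map (K : SSet.{0}) {n m : SimplexCategory} (θ : n ⟶ m) (σ : K.obj (op m))
    (z : _root_.stdSimplex ℝ (Fin (n.len + 1))) :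
    K.charMap (K.map θ.op σ) z = K.charMap σ (_root_.stdSimplex.map θ z) := by
  have h := ConcreteCategory.congr_hom ((sSetTopAdj.unit.app K).naturality θ.op) σ
  exact (congrArg (fun s => TopCat.toSSetObjEquiv _ (op n) s z) h).trans
    (TopCat.toSSetObjEquiv_naturality_apply θ _ z)

/-- A continuous map out of the geometric realization is determined by its composites with the
characteristic maps. -/
theorem toTop_hom_ext {K : SSet.{0}} {Y : TopCat.{0}} {f g : SSet.toTop.obj K ⟶ Y}
    (h : ∀ (n : SimplexCategory) (σ : K.obj (op n)) (z : _root_.stdSimplex ℝ (Fin (n.len + 1))),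
      f (K.charMap σ z) = g (K.charMap σ z)) :
    f = g := by
  apply (sSetTopAdj.homEquiv K Y).injective
  rw [Adjunction.homEquiv_unit, Adjunction.homEquiv_unit]
  ext n σ
  apply (TopCat.toSSetObjEquiv _ _).injective
  ext z
  exact h n.unop σ z

/-- A simplicial map to the singular simplicial set of `Y` is induced by a continuous map from the
geometric realization. -/
theorem exists_toTop_desc {K : SSet.{0}} {Y : TopCat.{0}} (φ : K ⟶ TopCat.toSSet.obj Y) :
    ∃ f : SSet.toTop.obj K ⟶ Y, ∀ (n : SimplexCategory) (σ : K.obj (op n))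
      (z : _root_.stdSimplex ℝ (Fin (n.len + 1))),
      f (K.charMap σ z) = TopCat.toSSetObjEquiv _ (op n) (φ.app (op n) σ) z := by
  refine ⟨(sSetTopAdj.homEquiv K Y).symm φ, fun n σ z => ?_⟩
  have h := (sSetTopAdj.homEquiv K Y).apply_symm_apply φ
  rw [Adjunction.homEquiv_unit] at h
  exact congrArg (fun s : K ⟶ TopCat.toSSet.obj Y =>
    TopCat.toSSetObjEquiv _ (op n) (s.app (op n) σ) z) h

end SSet

theorem stdSimplex.sum_map_mul {X Y : Type} [Fintype X] [Fintype Y] (θ : X → Y) (v : Y → ℝ)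
    (z : stdSimplex ℝ X) : ∑ j, stdSimplex.map θ z j * v j = ∑ i, z i * v (θ i) := by
  classical
  simp only [stdSimplex.map_coe, FunOnFinite.linearMap_apply_apply, Finset.sum_mul]
  rw [← Finset.sum_fiberwise Finset.univ θ fun i => z i * v (θ i)]
  refine Finset.sum_congr rfl fun j _ => Finset.sum_congr rfl fun i hi => ?_
  rw [(Finset.mem_filter.1 hi).2]

section ZigzagNerve

variable {J : Type} [Category.{0} J]

/-- A real function on the objects of a category extends to the classifying space, affinely on the
simplices of the nerve. -/
theorem exists_affine_extension (pos : J → ℝ) :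
    ∃ f : SSet.toTop.obj (nerve J) ⟶ TopCat.of ℝ,
      ∀ (n : SimplexCategory) (σ : (nerve J).obj (op n)) (z : stdSimplex ℝ (Fin (n.len + 1))),
        f ((nerve J).charMap σ z) = ∑ i, z i * pos (Functor.obj σ i) := by
  let aff : ∀ (n : SimplexCategory) (σ : (nerve J).obj (op n)),
      C(stdSimplex ℝ (Fin (n.len + 1)), ℝ) := fun n σ =>
    ⟨fun z => ∑ i, z i * pos (Functor.obj σ i), continuous_finsetSum _ fun i _ =>
      ((continuous_apply i).comp continuous_subtype_val).mul continuous_const⟩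
  let φ : nerve J ⟶ TopCat.toSSet.obj (TopCat.of ℝ) :=
    { app := fun n => ↾fun σ => (TopCat.toSSetObjEquiv _ n).symm (aff n.unop σ)
      naturality := fun n m θ => by
        ext σ
        apply (TopCat.toSSetObjEquiv _ _).injective
        ext z
        exact (stdSimplex.sum_map_mul θ.unop (fun j => pos (Functor.obj σ j)) z).symm }
  obtain ⟨f, hf⟩ := SSet.exists_toTop_desc φ
  exact ⟨f, fun n σ z => hf n σ z⟩

open Simplicial in
/-- The point of the classifying space corresponding to an object. -/
noncomputable def nerveVertex (x : J) : SSet.toTop.obj (nerve J) :=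
  (nerve J).charMap (n := ⦋0⦌) (ComposableArrows.mk₀ x) (stdSimplex.vertex 0)

open Simplicial in
/-- The path in the classifying space corresponding to a morphism. -/
noncomputable def nervePath {x y : J} (f : x ⟶ y) : C(unitInterval, SSet.toTop.obj (nerve J)) :=
  ((nerve J).charMap (n := ⦋1⦌) (ComposableArrows.mk₁ f)).comp
    ⟨stdSimplexHomeomorphUnitInterval.symm, stdSimplexHomeomorphUnitInterval.symm.continuous⟩

open Simplicial in
theorem nervePath_zero {x y : J} (f : x ⟶ y) : nervePath f 0 = nerveVertex x := by
  have h := (nerve J).charMap_map (SimplexCategory.δ (1 : Fin 2)) (ComposableArrows.mk₁ f)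
    (stdSimplex.vertex (S := ℝ) (0 : Fin 1))
  rw [stdSimplex.map_vertex] at h
  refine Eq.trans ?_ (h.symm.trans ?_)
  · refine congrArg ((nerve J).charMap (n := ⦋1⦌) (ComposableArrows.mk₁ f)) ?_
    exact stdSimplexHomeomorphUnitInterval.symm_apply_eq.2
      stdSimplexHomeomorphUnitInterval_zero.symm
  · exact congrArg (fun σ => (nerve J).charMap (n := ⦋0⦌) σ _) (ComposableArrows.ext₀ rfl)

open Simplicial in
theorem nervePath_one {x y : J} (f : x ⟶ y) : nervePath f 1 = nerveVertex y := by
  have h := (nerve J).charMap_map (SimplexCategory.δ (0 : Fin 2)) (ComposableArrows.mk₁ f)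
    (stdSimplex.vertex (S := ℝ) (0 : Fin 1))
  rw [stdSimplex.map_vertex] at h
  refine Eq.trans ?_ (h.symm.trans ?_)
  · refine congrArg ((nerve J).charMap (n := ⦋1⦌) (ComposableArrows.mk₁ f)) ?_
    exact stdSimplexHomeomorphUnitInterval.symm_apply_eq.2
      stdSimplexHomeomorphUnitInterval_one.symm
  · exact congrArg (fun σ => (nerve J).charMap (n := ⦋0⦌) σ _) (ComposableArrows.ext₀ rfl)

open Simplicial in
theorem nervePath_id (x : J) (u : unitInterval) : nervePath (𝟙 x) u = nerveVertex x := by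
  have h := (nerve J).charMap_map (SimplexCategory.σ (0 : Fin 1)) (ComposableArrows.mk₀ x)
    (stdSimplexHomeomorphUnitInterval.symm u)
  refine Eq.trans ?_ (h.trans (congrArg _ (Subsingleton.elim (α := stdSimplex ℝ (Fin 1)) _ _)))
  exact congrArg (fun σ => (nerve J).charMap (n := ⦋1⦌) σ _) (nerve.σ₀_mk₀_eq x).symm

/-- The function `pos` identifies `J` with a finite zigzag: a non-empty finite set of consecutive
natural numbers, with a unique morphism from each even number to each of its neighbours. -/
structure IsZigzag (pos : J → ℕ) : Prop where
  thin : Quiver.IsThin J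
  injective : Function.Injective pos
  adjacent : ∀ {x y : J}, (x ⟶ y) →
    x = y ∨ (pos x % 2 = 0 ∧ (pos y = pos x + 1 ∨ pos x = pos y + 1))
  nonempty_hom : ∀ {x y : J}, pos x % 2 = 0 → (pos y = pos x + 1 ∨ pos x = pos y + 1) →
    Nonempty (x ⟶ y)
  exists_pos : ∀ {x y : J} {n : ℕ}, pos x ≤ n → n ≤ pos y → ∃ z, pos z = n
  bounded : ∃ n, ∀ x, pos x < n
  nonempty : Nonempty J

namespace IsZigzag

variable {pos : J → ℕ}

theorem eq_of_hom_of_hom (h : IsZigzag pos) {x y z : J} (f : x ⟶ y) (g : y ⟶ z) (hxy : x ≠ y) :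
    y = z := by
  have h1 := h.adjacent f
  have h2 := h.adjacent g
  by_contra hyz
  have h3 := h1.resolve_left hxy
  have h4 := h2.resolve_left hyz
  omega

open Simplicial in
/-- A zigzag has no pair of composable morphisms which are not identities, so its nerve is
one-dimensional. -/
theorem exists_eq_map_mk₁ (h : IsZigzag pos) {n : SimplexCategory} (σ : (nerve J).obj (op n)) :
    ∃ (x y : J) (f : x ⟶ y) (θ : n ⟶ ⦋1⦌), σ = (nerve J).map θ.op (ComposableArrows.mk₁ f) := by
  classical
  have := h.thin
  let s : Fin (n.len + 1) ⥤ J := σ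
  have hs : ∀ i, s.obj i = s.obj 0 ∨ s.obj i = s.obj (Fin.last _) := fun i => by
    by_cases hi : s.obj 0 = s.obj i
    · exact .inl hi.symm
    · exact .inr (h.eq_of_hom_of_hom (s.map (homOfLE (Fin.zero_le i)))
        (s.map (homOfLE (Fin.le_last i))) hi)
  -- The simplex takes the value `s.obj 0` on an initial segment, and its last value afterwards.
  have hmono : Monotone fun i => if s.obj i = s.obj 0 then (0 : Fin 2) else 1 := by
    intro i j hij
    dsimp only
    split_ifs with h1 h2
    · exact le_rfl
    · exact Fin.zero_le _
    · exact absurd (h.eq_of_hom_of_hom (s.map (homOfLE (Fin.zero_le i)))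
        (s.map (homOfLE hij)) (Ne.symm h1)) (by rwa [‹s.obj j = s.obj 0›])
    · exact le_rfl
  refine ⟨_, _, s.map (homOfLE (Fin.zero_le (Fin.last _))),
    SimplexCategory.mkHom ⟨_, hmono⟩, nerve.ext_of_isThin (funext fun i => ?_)⟩
  change s.obj i = (ComposableArrows.mk₁ (s.map (homOfLE (Fin.zero_le (Fin.last _))))).obj
    (if s.obj i = s.obj 0 then (0 : Fin 2) else 1)
  split_ifs with h1
  · exact h1
  · exact (hs i).resolve_left h1

/-- A continuous map from the real line which inverts the affine extension of `pos` on the part of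
the zigzag in positions below `n`. -/
theorem exists_inverse (h : IsZigzag pos) (n : ℕ) :
    ∃ g : C(ℝ, SSet.toTop.obj (nerve J)), ∀ {x y : J} (f : x ⟶ y) (u : unitInterval),
      pos x < n → pos y < n → nervePath f u = g ((1 - u) * pos x + u * pos y) := by
  have := h.thin
  induction n with
  | zero =>
    obtain ⟨x⟩ := h.nonempty
    exact ⟨.const _ (nerveVertex x), fun _ _ h => absurd h (Nat.not_lt_zero _)⟩
  | succ n ih =>
    obtain ⟨g, hg⟩ := ih
    by_cases hz : ∃ z, pos z = n
    · obtain ⟨z, hz⟩ := hz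
      -- The path `p` is the last segment, which ends in `z`, or constant if `z` is the first
      -- object of the zigzag.
      obtain ⟨p, hp0, hp1, hp', hp⟩ : ∃ p : C(unitInterval, SSet.toTop.obj (nerve J)),
          ((∃ x, pos x < n) → p 0 = g (n - 1)) ∧ p 1 = nerveVertex z ∧
            (∀ (x : J) (f : x ⟶ z) (u), pos x < n → nervePath f u = p u) ∧
            ∀ (x : J) (f : z ⟶ x) (u), pos x < n → nervePath f u = p (unitInterval.symm u) := by
        by_cases hx : ∃ x, pos x < n
        · obtain ⟨x, hx⟩ := hx
          obtain ⟨y, hy⟩ := h.exists_pos (x := x) (y := z) (n := n - 1) (by omega) (by omega)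
          have hgy : nerveVertex y = g (n - 1) := by
            have := hg (𝟙 y) 0 (by omega) (by omega)
            rw [nervePath_id] at this
            rw [this, hy, Nat.cast_sub (by omega)]
            simp
          rcases Nat.mod_two_eq_zero_or_one (pos y) with hpar | hpar
          · obtain ⟨f⟩ := h.nonempty_hom (x := y) (y := z) hpar (by omega)
            refine ⟨nervePath f, fun _ => (nervePath_zero f).trans hgy, nervePath_one f,
              fun x f' u hx => ?_, fun x f' u hx => ?_⟩
            · obtain rfl : x = y := h.injective (by
                rcases h.adjacent f' with rfl | h' <;> omega)
              rw [Subsingleton.elim f f']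
            · rcases h.adjacent f' with rfl | h' <;> omega
          · obtain ⟨f⟩ := h.nonempty_hom (x := z) (y := y) (by omega) (by omega)
            refine ⟨(nervePath f).comp ⟨unitInterval.symm, unitInterval.continuous_symm⟩,
              fun _ => ?_, ?_, fun x f' u hx => ?_, fun x f' u hx => ?_⟩
            · change nervePath f (unitInterval.symm 0) = _
              rw [unitInterval.symm_zero, nervePath_one, hgy]
            · change nervePath f (unitInterval.symm 1) = _
              rw [unitInterval.symm_one, nervePath_zero]
            · rcases h.adjacent f' with rfl | h'
              · omega
              · have := h.adjacent f
                exfalso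
                have h1 : pos x = pos y := by omega
                omega
            · obtain rfl : x = y := h.injective (by
                rcases h.adjacent f' with rfl | h' <;> omega)
              change _ = nervePath f (unitInterval.symm (unitInterval.symm u))
              rw [Subsingleton.elim f f', unitInterval.symm_symm]
        · exact ⟨.const _ (nerveVertex z), fun h => absurd h hx, rfl,
            fun x _ _ h' => absurd ⟨x, h'⟩ hx, fun x _ _ h' => absurd ⟨x, h'⟩ hx⟩
      -- The extended map is `g` up to `n - 1`, and follows `p` from there on. If `z` is the first
      -- object, then there is nothing to be kept of `g`.
      obtain ⟨G, hG, hG'⟩ : ∃ G : C(ℝ, SSet.toTop.obj (nerve J)),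
          ((∃ x, pos x < n) → ∀ s : ℝ, s ≤ n - 1 → G s = g s) ∧
            ∀ s : ℝ, n - 1 ≤ s → G s = p (Set.projIcc 0 1 zero_le_one (s - (n - 1))) := by
        have hq : Continuous fun s : ℝ => p (Set.projIcc 0 1 zero_le_one (s - (n - 1))) :=
          p.continuous.comp (continuous_projIcc.comp (continuous_id.sub continuous_const))
        by_cases hx : ∃ x, pos x < n
        · have hglue : ∀ s : ℝ, s = n - 1 →
              g s = p (Set.projIcc 0 1 zero_le_one (s - (n - 1))) := fun s hs => by
            rw [hs, sub_self, Set.projIcc_left]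
            exact (hp0 hx).symm
          refine ⟨⟨_, Continuous.if_le g.continuous hq continuous_id
            (continuous_const (y := (n : ℝ) - 1)) hglue⟩, fun _ s hs => if_pos hs, fun s hs => ?_⟩
          rcases hs.eq_or_lt with hs' | hs'
          · exact (if_pos hs'.symm.le).trans (hglue s hs'.symm)
          · exact if_neg (not_le.2 hs')
        · exact ⟨⟨_, hq⟩, fun h => absurd h hx, fun _ _ => rfl⟩
      have hproj : ∀ u : unitInterval, ∀ s : ℝ, s = u →
          Set.projIcc (0 : ℝ) 1 zero_le_one s = u := fun u s hs => by
        rw [hs, Set.projIcc_val]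
      refine ⟨G, fun {x y} f u hx hy => ?_⟩
      rcases (Nat.lt_succ_iff.1 hx).eq_or_lt with hxn | hxn <;>
        rcases (Nat.lt_succ_iff.1 hy).eq_or_lt with hyn | hyn
      · obtain rfl : x = z := h.injective (hxn.trans hz.symm)
        obtain rfl : y = x := h.injective (hyn.trans hz.symm)
        obtain rfl : f = 𝟙 y := Subsingleton.elim _ _
        have e : (1 - u : ℝ) * pos y + u * pos y = n := by rw [hz]; ring
        rw [nervePath_id, e, hG' _ (by linarith), hproj 1 _ (by simp), hp1]
      · obtain rfl : x = z := h.injective (hxn.trans hz.symm)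
        have hn : pos y + 1 = n := by rcases h.adjacent f with rfl | h' <;> omega
        have hn' : (pos y : ℝ) = n - 1 := by rw [← hn]; push_cast; ring
        rw [hp _ f u hyn, hz, hn', hG' _ (by nlinarith [u.2.2]),
          hproj (unitInterval.symm u) _ (by rw [unitInterval.coe_symm_eq]; ring)]
      · obtain rfl : y = z := h.injective (hyn.trans hz.symm)
        have hn : pos x + 1 = n := by rcases h.adjacent f with rfl | h' <;> omega
        have hn' : (pos x : ℝ) = n - 1 := by rw [← hn]; push_cast; ring
        rw [hp' _ f u hxn, hz, hn', hG' _ (by nlinarith [u.2.1]), hproj u _ (by ring)]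
      · rw [hG ⟨x, hxn⟩ _ ?_]
        · exact hg f u hxn hyn
        · have h1 : (pos x : ℝ) + 1 ≤ n := by exact_mod_cast hxn
          have h2 : (pos y : ℝ) + 1 ≤ n := by exact_mod_cast hyn
          nlinarith [u.2.1, u.2.2]
    · exact ⟨g, fun {x y} f u hx hy => hg f u (lt_of_le_of_ne (Nat.lt_succ_iff.1 hx) fun h =>
        hz ⟨x, h⟩) (lt_of_le_of_ne (Nat.lt_succ_iff.1 hy) fun h => hz ⟨y, h⟩)⟩

open Simplicial in
/-- The classifying space of a zigzag is contractible: it is a retract of the real line. -/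
theorem contractibleSpace (h : IsZigzag pos) :
    ContractibleSpace (SSet.toTop.obj (nerve J)) := by
  obtain ⟨n, hn⟩ := h.bounded
  obtain ⟨f, hf⟩ := exists_affine_extension fun x => (pos x : ℝ)
  obtain ⟨g, hg⟩ := h.exists_inverse n
  have key : f ≫ TopCat.ofHom g = 𝟙 _ := by
    -- It suffices to compare on simplices, and these degenerate to edges.
    refine SSet.toTop_hom_ext fun k σ z => ?_
    obtain ⟨x, y, e, θ, hσ⟩ := h.exists_eq_map_mk₁ σ
    rw [(congrArg (fun τ => (nerve J).charMap τ z) hσ).trans (SSet.charMap_map _ θ _ z)]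
    generalize stdSimplex.map θ z = w
    obtain ⟨u, rfl⟩ := stdSimplexHomeomorphUnitInterval.symm.surjective w
    change g (f ((nerve J).charMap (n := ⦋1⦌) (ComposableArrows.mk₁ e) _)) = nervePath e u
    rw [hg e u (hn x) (hn y)]
    refine congrArg g ((hf _ _ _).trans ((Fin.sum_univ_two _).trans ?_))
    have hu := stdSimplexHomeomorphUnitInterval.apply_symm_apply u
    set w := stdSimplexHomeomorphUnitInterval.symm u
    have hw : w 0 + w 1 = 1 := (Fin.sum_univ_two _).symm.trans w.2.2
    have hw1 : w 1 = u := congrArg Subtype.val hu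
    have hw0 : w 0 = 1 - u := by linarith
    exact congrArg₂ (· + ·) (congrArg (· * (pos x : ℝ)) hw0) (congrArg (· * (pos y : ℝ)) hw1)
  rw [contractible_iff_id_nullhomotopic]
  have hfg : g.comp f.hom = .id _ := congrArg TopCat.Hom.hom key
  rw [← hfg]
  exact ((id_nullhomotopic ℝ).comp_left f.hom).comp_right g

theorem isConnected (h : IsZigzag pos) : IsConnected J := by
  have := h.nonempty
  have hle : ∀ (n : ℕ) (x y : J), pos y = pos x + n → Zigzag x y := by
    intro n
    induction n with
    | zero =>
      intro x y hxy
      obtain rfl := h.injective hxy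
      exact Zigzag.refl _
    | succ n ih =>
      intro x y hxy
      obtain ⟨z, hz⟩ := h.exists_pos (x := x) (y := y) (n := pos x + n) (by omega) (by omega)
      refine (ih x z hz).trans ?_
      rcases Nat.mod_two_eq_zero_or_one (pos z) with hpar | hpar
      · obtain ⟨f⟩ := h.nonempty_hom (x := z) (y := y) hpar (by omega)
        exact Zigzag.of_hom f
      · obtain ⟨f⟩ := h.nonempty_hom (x := y) (y := z) (by omega) (by omega)
        exact Zigzag.of_inv f
  exact zigzag_isConnected fun x y => (le_total (pos x) (pos y)).elim
    (fun hxy => hle _ x y (Nat.add_sub_cancel' hxy).symm)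
    fun hxy => (hle _ y x (Nat.add_sub_cancel' hxy).symm).symm

end IsZigzag

end ZigzagNerve

/-! ### The globes of a presentation containing a given generator -/

namespace ThetaZ

/-- The inert morphism `e` factors through the leg of `P` at `z` by an inert morphism. -/
def Presentation.Contains {T : ThetaZ} {t : GlobTable ℤ} (P : Presentation T t) {l : ℤ}
    (e : globe l ⟶ T) (z : GlobZigzag t.len) : Prop :=
  ∃ f : globe l ⟶ (zigzag t).obj z, inert f ∧ f ≫ P.ι.app z = e

/-- The globes of the presentation `P` through which an inert morphism `e` from a globe factors
form a connected piece of the zigzag, and the factorizations are unique. -/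
structure Presentation.IsSlice {T : ThetaZ} {t : GlobTable ℤ} (P : Presentation T t) {l : ℤ}
    (e : globe l ⟶ T) : Prop where
  exists_top : ∃ i, P.Contains e (.top i)
  bot_iff : ∀ k, P.Contains e (.bot k) ↔
    P.Contains e (.top k.castSucc) ∧ P.Contains e (.top k.succ)
  convex : ∀ {i j k}, i ≤ j → j ≤ k → P.Contains e (.top i) → P.Contains e (.top k) →
    P.Contains e (.top j)
  unique : ∀ {z} {f f' : globe l ⟶ (zigzag t).obj z}, inert f → inert f' →
    f ≫ P.ι.app z = e → f' ≫ P.ι.app z = e → f = f'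

section Canonical

variable {S : Theta} {s : GlobTable ℕ} {x : ∀ i, S.graph.cells (s.n i)} {N : ℕ}
  {P : Presentation ⟨N, S⟩ (s.toInt N)}

theorem inert_app_of_picks
    (hP : ∀ i, Picks (l := (s.n i : ℤ) - N) (A := ⟨N, S⟩) 0 (P.ι.app (.top i))
      (S.gen.app _ (x i)).1) (z) : inert (P.ι.app z) := by
  have htop : ∀ i, inert (P.ι.app (.top i)) := fun i =>
    ((hP i).inert_iff (D := s.n i) (by dsimp only; omega)).2 ⟨x i, rfl⟩
  obtain i | i := z
  · exact htop i
  · have hn := P.ι.naturality (GlobZigzag.Hom.left i : GlobZigzag.bot i ⟶ .top i.castSucc)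
    rw [show P.ι.app (.bot i) = _ from (hn.trans (Category.comp_id _)).symm]
    exact inert_comp _ _ (inert_face _ _ _ _) (htop _)

/-- The factorizations of an inert morphism through the globes of a globular sum: the morphism
corresponds to a cell `y` of a suspension, and the globes which contain it can be read off from the
position of `y`. -/
theorem isSlice_of_picks (hx : IsGlobularSum s S.graph x)
    (hP : ∀ i, Picks (l := (s.n i : ℤ) - N) (A := ⟨N, S⟩) 0 (P.ι.app (.top i))
      (S.gen.app _ (x i)).1) {l : ℤ} {e : globe l ⟶ ⟨N, S⟩} (he : inert e) : P.IsSlice e := by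
  obtain ⟨b, hb⟩ := exists_picks e
  obtain ⟨c, hc⟩ := hb b le_rfl
  obtain ⟨L, hL⟩ := hc.dim_eq
  obtain ⟨y, rfl⟩ := (hc.inert_iff hL).1 he
  obtain ⟨code, hinj, hcode, hface, hcase⟩ := (Theta.isGlobularSum_iter hx b).exists_code
  have hD : ∀ i, ((s.n i + b : ℕ) : ℤ) = ((s.n i : ℤ) - N) + N + b := fun i => by omega
  have hD' : ∀ k, ((s.m k + b : ℕ) : ℤ) = ((s.m k : ℤ) - N) + N + b := fun k => by omega
  have htop : ∀ i, Picks (l := (s.n i : ℤ) - N) (A := ⟨N, S⟩) b (P.ι.app (.top i))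
      (((iter Theta.susp b).obj S).gen.app (s.n i + b) (Theta.upCell b (x i))).1 := fun i => by
    rw [Theta.gen_upCell]
    exact (hP i).up b
  have hlt : ∀ k, s.m k + b < s.n (Fin.castSucc k) + b := (s.add b).lt_left
  have hbot : ∀ k, Picks (l := (s.m k : ℤ) - N) (A := ⟨N, S⟩) b (P.ι.app (.bot k))
      (((iter Theta.susp b).obj S).gen.app (s.m k + b)
        (((iter Theta.susp b).obj S).graph.face true (hlt k) (Theta.upCell b (x k.castSucc)))).1 :=
    fun k => by
    have hn := P.ι.naturality (GlobZigzag.Hom.left k : GlobZigzag.bot k ⟶ .top k.castSucc)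
    rw [Theta.gen_face]
    exact ((htop k.castSucc).face_comp true ((s.toInt N).lt_left k) (hD' k)).congr
      (hn.trans (Category.comp_id _))
  have hcodeBot : ∀ k ε (h : L < s.m k + b), code L (((iter Theta.susp b).obj S).graph.face ε h
      (((iter Theta.susp b).obj S).graph.face true (hlt k) (Theta.upCell b (x k.castSucc)))) =
        (s.add b).off L k.castSucc + ε.toNat := fun k ε h => by
    rw [OmegaGraph.face_face]
    exact hface k.castSucc L _ ε
  -- The cell `y` is the top cell of the globe, its source or its target; these have position
  -- `off`, `off` and `off + 1`.
  have hTop : ∀ i, P.Contains e (.top i) ↔ (s.add b).Top i L (code L y) := fun i => by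
    refine (exists_inert_comp_eq_iff hL (hD i) hc (htop i)).trans ⟨?_, ?_⟩
    · rintro (⟨rfl, hy⟩ | ⟨ε, h, rfl⟩)
      · obtain rfl := eq_of_heq hy
        exact .inl ⟨le_rfl, hcode i⟩
      · have hc := hface i L h ε
        cases ε
        · exact .inl ⟨h.le, hc⟩
        · exact .inr ⟨h, hc⟩
    · rintro (⟨h, h'⟩ | ⟨h, h'⟩)
      · rcases h.lt_or_eq with h | rfl
        · exact .inr ⟨false, h, hinj L (h'.trans (hface i L h false).symm)⟩
        · exact .inl ⟨rfl, heq_of_eq (hinj _ (h'.trans (hcode i).symm))⟩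
      · exact .inr ⟨true, h, hinj L (h'.trans (hface i L h true).symm)⟩
  have hBot : ∀ k, P.Contains e (.bot k) ↔ (s.add b).Bot k L (code L y) := fun k => by
    refine (exists_inert_comp_eq_iff hL (hD' k) hc (hbot k)).trans ⟨?_, ?_⟩
    · rintro (⟨rfl, hy⟩ | ⟨ε, h, rfl⟩)
      · obtain rfl := eq_of_heq hy
        exact .inr ⟨le_rfl, hface k.castSucc _ _ true⟩
      · have hc := hcodeBot k ε h
        cases ε
        · exact .inl ⟨h, hc⟩
        · exact .inr ⟨h.le, hc⟩
    · rintro (⟨h, h'⟩ | ⟨h, h'⟩)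
      · exact .inr ⟨false, h, hinj L (h'.trans (hcodeBot k false h).symm)⟩
      · rcases h.lt_or_eq with h | rfl
        · exact .inr ⟨true, h, hinj L (h'.trans (hcodeBot k true h).symm)⟩
        · exact .inl ⟨rfl, heq_of_eq (hinj _ (h'.trans (hface k.castSucc _ (hlt k) true).symm))⟩
  refine ⟨?_, fun k => ?_, fun {i j k} hij hjk hi hk => ?_, fun {z f f'} hf hf' h h' => ?_⟩
  · obtain ⟨i, hi⟩ := hcase L y
    exact ⟨i, (hTop i).2 hi⟩
  · rw [hBot, hTop, hTop]
    exact (s.add b).bot_iff k L _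
  · rw [hTop] at hi hk ⊢
    exact (s.add b).top_of_le_of_le hij hjk hi hk
  · obtain i | k := z
    · refine inert_comp_right_cancel (hD i) hL (htop i) (fun h e => ?_) hf hf' (h.trans h'.symm)
      exact absurd (Nat.add_left_cancel ((hface i L h false).symm.trans
        ((congrArg (code L) e).trans (hface i L h true)))) Nat.zero_ne_one
    · refine inert_comp_right_cancel (hD' k) hL (hbot k) (fun h e => ?_) hf hf' (h.trans h'.symm)
      exact absurd (Nat.add_left_cancel ((hcodeBot k false h).symm.trans
        ((congrArg (code L) e).trans (hcodeBot k true h)))) Nat.zero_ne_one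

end Canonical

/-- Every presentation is isomorphic to that of a globular sum in `Θ`, moved to a finite stage. -/
theorem Presentation.exists_iso {T : ThetaZ} {t : GlobTable ℤ} (P : Presentation T t) :
    ∃ (T₀ : ThetaZ) (P₀ : Presentation T₀ t) (φ : T₀ ≅ T),
      (∀ z, P₀.ι.app z ≫ φ.hom = P.ι.app z) ∧ (∀ z, inert (P₀.ι.app z)) ∧
      ∀ {l : ℤ} (e : globe l ⟶ T₀), inert e → P₀.IsSlice e := by
  obtain ⟨s, N, rfl⟩ := t.exists_toInt
  let S : Theta :=
    { cat := s.graph.free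
      graph := s.graph
      isSum := ⟨s, _, s.isGlobularSum_graph⟩
      gen := s.graph.freeGen
      free := s.graph.isFreeOn_free }
  have hx : IsGlobularSum s S.graph s.graphTop := s.isGlobularSum_graph
  obtain ⟨P₀, hP₀⟩ := exists_presentation hx N
  exact ⟨_, P₀, P₀.isColimit.coconePointUniqueUpToIso P.isColimit,
    fun z => P₀.isColimit.comp_coconePointUniqueUpToIso_hom P.isColimit z,
    inert_app_of_picks hP₀, fun e he => isSlice_of_picks hx hP₀ he⟩

/-- The morphisms of a presentation are inert. -/
theorem Presentation.inert_app {T : ThetaZ} {t : GlobTable ℤ} (P : Presentation T t) (z) :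
    inert (P.ι.app z) := by
  obtain ⟨T₀, P₀, φ, hφ, h, -⟩ := P.exists_iso
  rw [← hφ]
  exact inert_comp _ _ (h z) (inert_of_iso φ)

/-- The factorizations of an inert morphism through the globes of any presentation. -/
theorem Presentation.isSlice {T : ThetaZ} {t : GlobTable ℤ} (P : Presentation T t) {l : ℤ}
    (e : globe l ⟶ T) (he : inert e) : P.IsSlice e := by
  obtain ⟨T₀, P₀, φ, hφ, -, h⟩ := P.exists_iso
  have h₀ := h (e ≫ φ.inv) (inert_comp _ _ he (inert_of_iso φ.symm))
  have hiff : ∀ {z} (f : globe l ⟶ (zigzag t).obj z),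
      f ≫ P.ι.app z = e ↔ f ≫ P₀.ι.app z = e ≫ φ.inv := fun {z} f => by
    rw [Iso.eq_comp_inv, Category.assoc, hφ]
  have hc : ∀ z, P.Contains e z ↔ P₀.Contains (e ≫ φ.inv) z := fun z =>
    exists_congr fun f => and_congr_right fun _ => hiff f
  refine ⟨?_, ?_, ?_, ?_⟩
  · simpa only [hc] using h₀.exists_top
  · simpa only [hc] using h₀.bot_iff
  · simpa only [hc] using fun {i j k} => h₀.convex (i := i) (j := j) (k := k)
  · simpa only [hiff] using fun {z f f'} => h₀.unique (z := z) (f := f) (f' := f')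

end ThetaZ

/-! ### The slices of the diagram of a presentation -/

namespace GlobZigzag

variable {p : ℕ}

/-- The position of an object of the zigzag; globes have even and glueing globes odd positions. -/
def pos : GlobZigzag p → ℕ
  | .top i => 2 * i
  | .bot i => 2 * i + 1

theorem pos_injective : Function.Injective (pos (p := p)) := by
  rintro (i | i) (j | j) h <;> simp only [pos] at h
  · rw [Fin.ext (by omega : (i : ℕ) = j)]
  · omega
  · omega
  · rw [Fin.ext (by omega : (i : ℕ) = j)]

theorem Hom.heq_of_eq {x y z : GlobZigzag p} (f : Hom x y) (g : Hom x z) (h : y = z) :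
    HEq f g := by
  cases f <;> cases g
  case left.right i => exact absurd (top.inj h) (Fin.castSucc_lt_succ (i := i)).ne
  case right.left i => exact absurd (top.inj h) (Fin.castSucc_lt_succ (i := i)).ne'
  all_goals first | exact HEq.rfl | cases h

instance (x y : GlobZigzag p) : Subsingleton (x ⟶ y) :=
  ⟨fun f g => eq_of_heq (Hom.heq_of_eq f g rfl)⟩

/-- A morphism which is not an identity leads from an odd position to a neighbour. -/
theorem eq_or_pos_of_hom {x y : GlobZigzag p} (f : x ⟶ y) :
    y = x ∨ (pos y % 2 = 0 ∧ (pos x = pos y + 1 ∨ pos y = pos x + 1)) := by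
  change Hom x y at f
  cases f with
  | id => exact .inl rfl
  | left i =>
    simp only [pos, Fin.val_castSucc]
    exact .inr ⟨by omega, .inl trivial⟩
  | right i =>
    simp only [pos, Fin.val_succ]
    exact .inr ⟨by omega, .inr (by omega)⟩

theorem nonempty_hom_of_pos {x y : GlobZigzag p} (hy : pos y % 2 = 0)
    (h : pos x = pos y + 1 ∨ pos y = pos x + 1) : Nonempty (x ⟶ y) := by
  obtain j | j := y
  · obtain i | i := x
    · simp only [pos] at h
      omega
    · simp only [pos] at h
      rcases h with h | h
      · obtain rfl : j = i.castSucc := Fin.ext (by rw [Fin.val_castSucc]; omega)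
        exact ⟨Hom.left i⟩
      · obtain rfl : j = i.succ := Fin.ext (by rw [Fin.val_succ]; omega)
        exact ⟨Hom.right i⟩
  · simp only [pos] at hy
    omega

theorem pos_lt (z : GlobZigzag p) : pos z < 2 * p + 1 := by
  obtain i | i := z <;> simp only [pos] <;> omega

end GlobZigzag

namespace ThetaZ

section Slice

variable {T : ThetaZ} {t : GlobTable ℤ} {P : Presentation T t}

/-- The objects of the zigzag through which an inert morphism factors have consecutive positions. -/
theorem Presentation.IsSlice.exists_pos {l : ℤ} {e : globe l ⟶ T} (he : P.IsSlice e)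
    {x y : GlobZigzag t.len} (hx : P.Contains e x) (hy : P.Contains e y) {n : ℕ}
    (hxn : x.pos ≤ n) (hny : n ≤ y.pos) : ∃ z, P.Contains e z ∧ z.pos = n := by
  obtain ⟨i, hi, hix⟩ : ∃ i, P.Contains e (.top i) ∧ 2 * (i : ℕ) ≤ n := by
    obtain i | i := x
    · exact ⟨i, hx, hxn⟩
    · exact ⟨i.castSucc, ((he.bot_iff i).1 hx).1, (Nat.le_succ _).trans hxn⟩
  obtain ⟨k, hk, hky⟩ : ∃ k, P.Contains e (.top k) ∧ n ≤ 2 * (k : ℕ) := by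
    obtain k | k := y
    · exact ⟨k, hy, hny⟩
    · exact ⟨k.succ, ((he.bot_iff k).1 hy).2, hny.trans (by
        rw [Fin.val_succ, GlobZigzag.pos]; omega)⟩
  have htop : ∀ j : Fin (t.len + 1), 2 * (i : ℕ) ≤ 2 * j → (j : ℕ) ≤ k →
      P.Contains e (.top j) := fun j hij hjk =>
    he.convex (Fin.le_def.2 (by omega)) (Fin.le_def.2 hjk) hi hk
  obtain ⟨m, rfl | rfl⟩ := Nat.even_or_odd' n
  · exact ⟨.top ⟨m, by omega⟩, htop _ hix (by dsimp only; omega), rfl⟩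
  · refine ⟨.bot ⟨m, by omega⟩, (he.bot_iff _).2 ⟨htop _ ?_ ?_, htop _ ?_ ?_⟩, rfl⟩ <;>
      simp only [Fin.val_castSucc, Fin.val_succ] <;> omega

variable (h : ∀ z, inert (P.ι.app z)) (d : OpEl T)

theorem Presentation.contains_iff_nonempty (z : GlobZigzag t.len) :
    P.Contains d.unop.hom z ↔ Nonempty (d.unop ⟶ ((P.diagram h).obj (op z)).unop) := by
  obtain i | i := z <;> exact ⟨fun ⟨f, hf⟩ => ⟨⟨f, hf⟩⟩, fun ⟨f⟩ => ⟨f.1, f.2⟩⟩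

theorem Presentation.subsingleton_hom (z : GlobZigzag t.len) :
    Subsingleton (d.unop ⟶ ((P.diagram h).obj (op z)).unop) := by
  have hs := P.isSlice d.unop.hom d.unop.isInert
  obtain i | i := z
  · exact ⟨fun f g => Subtype.ext (hs.unique (z := .top i) f.2.1 g.2.1 f.2.2 g.2.2)⟩
  · exact ⟨fun f g => Subtype.ext (hs.unique (z := .bot i) f.2.1 g.2.1 f.2.2 g.2.2)⟩

/-- The slices of the diagram of a presentation are zigzags. -/
theorem Presentation.isZigzag_slice :
    IsZigzag fun X : CostructuredArrow (P.diagram h) d => X.left.unop.pos := by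
  have hs := P.isSlice d.unop.hom d.unop.isInert
  have hcont : ∀ X : CostructuredArrow (P.diagram h) d, P.Contains d.unop.hom X.left.unop :=
    fun X => (P.contains_iff_nonempty h d _).2 ⟨X.hom.unop⟩
  have hobj : ∀ z, P.Contains d.unop.hom z →
      ∃ X : CostructuredArrow (P.diagram h) d, X.left.unop = z := fun z hz => by
    obtain ⟨f⟩ := (P.contains_iff_nonempty h d z).1 hz
    exact ⟨CostructuredArrow.mk (Y := op z) f.op, rfl⟩
  have hext : ∀ {z : (GlobZigzag t.len)ᵒᵖ} (f g : (P.diagram h).obj z ⟶ d), f = g :=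
    fun {z} f g => Quiver.Hom.unop_inj ((P.subsingleton_hom h d z.unop).elim f.unop g.unop)
  have hinj : Function.Injective
      fun X : CostructuredArrow (P.diagram h) d => X.left.unop.pos := by
    rintro ⟨z, ⟨⟨⟩⟩, f⟩ ⟨z', ⟨⟨⟩⟩, f'⟩ hzz
    obtain rfl : z = z' := unop_injective (GlobZigzag.pos_injective hzz)
    obtain rfl : f = f' := hext f f'
    rfl
  refine ⟨fun X Y => ⟨fun f g => ?_⟩, hinj, fun {X Y} f => ?_, fun {X Y} hX hXY => ?_,
    fun {X Y n} hX hY => ?_, ⟨_, fun X => X.left.unop.pos_lt⟩, ?_⟩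
  · exact CostructuredArrow.hom_ext _ _ (Quiver.Hom.unop_inj (Subsingleton.elim _ _))
  · exact (GlobZigzag.eq_or_pos_of_hom f.left.unop).imp (fun e => hinj (congrArg _ e)) id
  · obtain ⟨f⟩ := GlobZigzag.nonempty_hom_of_pos hX hXY
    exact ⟨CostructuredArrow.homMk f.op (hext _ _)⟩
  · obtain ⟨z, hz, rfl⟩ := hs.exists_pos (hcont X) (hcont Y) hX hY
    obtain ⟨Z, rfl⟩ := hobj z hz
    exact ⟨Z, rfl⟩
  · obtain ⟨i, hi⟩ := hs.exists_top
    exact ⟨(hobj _ hi).choose⟩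

theorem Presentation.initial_diagram : (P.diagram h).Initial :=
  ⟨fun d => (P.isZigzag_slice h d).isConnected⟩

theorem Presentation.isInftyInitial_diagram : IsInftyInitial (P.diagram h) :=
  fun d => (P.isZigzag_slice h d).contractibleSpace

/-- The composite of the diagram of a presentation with the domain functor is the zigzag. -/
def Presentation.diagramCompDomain : P.diagram h ⋙ (El.domain T).op ≅ (zigzag t).op :=
  NatIso.ofComponents
    (fun z => match z with
      | ⟨.top _⟩ => Iso.refl _
      | ⟨.bot _⟩ => Iso.refl _)
    (fun {x y} f => by
      obtain ⟨x⟩ := x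
      obtain ⟨y⟩ := y
      obtain ⟨f⟩ := f
      change GlobZigzag.Hom y x at f
      cases f with
      | id => cases x <;> rfl
      | left i => exact (Category.comp_id _).trans (Category.id_comp _).symm
      | right i => exact (Category.comp_id _).trans (Category.id_comp _).symm)

/-- The limit over all inert morphisms from globes and the limit over the globes of a presentation
agree. -/
theorem Presentation.nonempty_isLimit_iff (P : Presentation T t) (X : ThetaZᵒᵖ ⥤ Type w) :
    Nonempty (IsLimit (X.mapCone (El.cocone T).op)) ↔
      Nonempty (IsLimit (X.mapCone (Cocone.mk T P.ι).op)) := by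
  have := P.initial_diagram P.inert_app
  refine ((Functor.Initial.isLimitWhiskerEquiv (P.diagram P.inert_app) _).symm.trans
    (IsLimit.equivOfNatIsoOfIso
      (Functor.isoWhiskerRight (P.diagramCompDomain P.inert_app) X)
      ((X.mapCone (El.cocone T).op).whisker (P.diagram P.inert_app))
      (X.mapCone (Cocone.mk T P.ι).op) (Cone.ext (Iso.refl _) fun z => ?_))).nonempty_congr
  obtain ⟨i | i⟩ := z
  all_goals
    refine Eq.trans ?_ (Category.id_comp _).symm
    exact (congrArg (X.map _ ≫ ·) (X.map_id _)).trans (Category.comp_id _)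

end Slice

end ThetaZ

theorem mainTheorem9 :
    (∀ (T : ThetaZ) (t : GlobTable ℤ) (P : ThetaZ.Presentation T t),
      ∃ h : ∀ z, ThetaZ.inert (P.ι.app z),
        (P.diagram h).Initial ∧ IsInftyInitial (P.diagram h)) ∧
    (∀ X : ThetaZᵒᵖ ⥤ Type w, ThetaZ.IsSegal X ↔ ThetaZ.IsStrictZCategory X) := by
  refine ⟨fun T t P => ⟨P.inert_app, P.initial_diagram _, P.isInftyInitial_diagram _⟩,
    fun X => ⟨fun hX T t P => (P.nonempty_isLimit_iff X).1 (hX T), fun hX T => ?_⟩⟩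
  obtain ⟨N, S⟩ := T
  obtain ⟨s, x, hx⟩ := S.isSum
  obtain ⟨P, -⟩ := ThetaZ.exists_presentation hx N
  exact (P.nonempty_isLimit_iff X).2 (hX _ _ P)
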